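/- Let $\alpha,a,b,h>0$ and $s\ge 0$. Let $\mathcal L$ be either the Hilbert transform $\mathcal H$, with $\widehat{\mathcal Hf}(k)=\mathrm i\,\mathrm{sgn}(k)\widehat f(k)$, or the Hilbert transform $\mathcal T$ on the strip of height $h$, with $\widehat{\mathcal Tf}(k)=\mathrm i\coth(hk)\widehat f(k)$ ($k\neq 0$). Accordingly put $$m(k)=1+b|k|+ak^2\quad(\mathcal L=\mathcal H),\qquad m(k)=1+bk\coth(hk)+ak^2\quad(\mathcal L=\mathcal T),$$ where $k\coth(hk)$ is given its limit value $1/h$ at $k=0$, and let $A$ be the Fourier multiplier $$\widehat{A\psi}(k)=-\mathrm i\,\frac{k}{m(k)}\,\widehat\psi(k).$$ Let $H^s$ be either the Sobolev space of real-valued functions on $\mathbb R$, with norm $\|f\|_s^2=\int_{\mathbb R}(1+k^2)^s|\widehat f(k)|^2\,dk$ where $\widehat f(k)=(2\pi)^{-1/2}\int_{\mathbb R} f(x)e^{-\mathrm ikx}dx$, or the Sobolev space of real-valued $2\pi$-periodic functions, with norm $\|f\|_s^2=\sum_{k\in\mathbb Z}(1+k^2)^s|\widehat f(k)|^2$ where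 $\widehat f(k)=\frac1{2\pi}\int_{-\pi}^{\pi}f(x)e^{-\mathrm ikx}dx$. Then $F(\eta)=A\left(\eta-\tfrac34\alpha\eta^2\right)$ defines a continuous map $F:H^s\to H^s$, and the Cauchy problem $$\eta_t=A\left(\eta-\tfrac34\alpha\eta^2\right),\qquad \eta(0)=\eta_0,$$ (which is the equation $\eta_t+\eta_x-\tfrac32\alpha\eta\eta_x-a\eta_{xxt}-b\mathcal L(\eta_{xt})=0$ solved for $\eta_t$) is globally well-posed in $H^s$. That is, for every $T>0$: (a) for every $\eta_0\in H^s$ there is $\eta\in C([-T,T];H^s)$ with $\eta(0)=\eta_0$ that satisfies, for every $t\in[-T,T]$, $$\lim_{\tau\to0}\left\|\frac{\eta(t+\tau)-\eta(t)}{\tau}-F(\eta(t))\right\|_s=0$$ (the limit is one-sided at $t=\pm T$); (b) for every $\eta_0\in H^s$ there is at most one such $\eta$; (c) if $\eta_0^n\to\eta_0^*$ in $H^s$ and $\eta^*\in C([-T,T];H^s)$ is the solution with initial value $\eta_0^*$, then for all sufficiently large $n$ the solution $\eta_n$ with initial value $\eta_0^n$ is defined on $[-T,T]$, and $\sup_{t\in[-T,T]}\|\eta_n(t)-\eta^*(t)\|_s\to0$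 as $n\to\infty$. In particular, for every $\eta_0\in H^s$ there is a unique $\eta\in C(\mathbb R;H^s)$ that solves the Cauchy problem for all $t\in\mathbb R$. -/

import Mathlib

open MeasureTheory Filter Topology FourierTransform
open scoped Real ENNReal

noncomputable section

/-! ### The dispersive symbols -/

/-- The two choices of the operator `𝓛`: the Hilbert transform `𝓗`, with symbol `i sgn k`, and the
Hilbert transform `𝓣` on the strip of height `h`, with symbol `i coth (h k)`. -/
inductive DispersionOperator
  | hilbert
  | finiteDepth

/-- The function `k ↦ k coth (h k)`, with its limit value `1 / h` at `k = 0`. -/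
def mulCoth (h k : ℝ) : ℝ :=
  if k = 0 then 1 / h else k * (Real.cosh (h * k) / Real.sinh (h * k))

/-- The symbol `m` of the operator `1 - a ∂ₓ² - b 𝓛 ∂ₓ`. -/
def dispersionSymbol (L : DispersionOperator) (a b h k : ℝ) : ℝ :=
  match L with
  | .hilbert => 1 + b * |k| + a * k ^ 2
  | .finiteDepth => 1 + b * mulCoth h k + a * k ^ 2

/-- The symbol `φ(k) = k / m(k)`; the operator `A` is the Fourier multiplier by `-i φ(k)`. -/
def phaseSymbol (L : DispersionOperator) (a b h k : ℝ) : ℝ :=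
  k / dispersionSymbol L a b h k

/-! ### Real-valued Sobolev spaces on the line

With Mathlib's normalisation `𝓕 f (ξ) = ∫ f(x) e^{-2π i x ξ} dx`, the angular frequency is
`k = 2 π ξ`, and with `f̂(k) = (2π)^{-1/2} ∫ f(x) e^{-i k x} dx` one has
`∫ (1 + k²)^s |f̂(k)|² dk = ∫ (1 + (2πξ)²)^s |𝓕 f (ξ)|² dξ`. -/

/-- The `L²` Fourier transform of a real-valued square integrable function on the line. -/
def lineFourier : Lp ℝ 2 (volume : Measure ℝ) →ₗ[ℝ] Lp ℂ 2 (volume : Measure ℝ) where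
  toFun u := 𝓕 (Complex.ofRealCLM.compLp u)
  map_add' u v := by
    rw [← FourierTransform.fourier_add]
    congr 1
    exact (Complex.ofRealCLM.compLpₗ 2 (volume : Measure ℝ)).map_add u v
  map_smul' c u := by
    have h1 : Complex.ofRealCLM.compLp (c • u) = (c : ℂ) • Complex.ofRealCLM.compLp u := by
      rw [Complex.coe_smul]
      exact (Complex.ofRealCLM.compLpₗ 2 (volume : Measure ℝ)).map_smul c u
    rw [h1, FourierTransform.fourier_smul, Complex.coe_smul, RingHom.id_apply]
    rfl

theorem lineFourier_injective : Function.Injective lineFourier := by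
  intro u v huv
  have h1 : Complex.ofRealCLM.compLp u = Complex.ofRealCLM.compLp v :=
    (Lp.fourierTransformₗᵢ ℝ ℂ).injective huv
  refine Lp.ext ?_
  filter_upwards [Complex.ofRealCLM.coeFn_compLp u, Complex.ofRealCLM.coeFn_compLp v]
    with x hx hy
  rw [h1, hy] at hx
  simpa using hx.symm

/-- The weighted Fourier transform `(1 + k²)^{s/2} 𝓕 u (ξ)` with `k = 2 π ξ`. -/
def lineWeighted (s : ℝ) (u : Lp ℝ 2 (volume : Measure ℝ)) (ξ : ℝ) : ℂ :=
  ((1 + (2 * π * ξ) ^ 2) ^ (s / 2) : ℝ) • lineFourier u ξ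

theorem lineWeighted_add (s : ℝ) (u v : Lp ℝ 2 (volume : Measure ℝ)) :
    lineWeighted s (u + v) =ᵐ[volume] lineWeighted s u + lineWeighted s v := by
  filter_upwards [Lp.coeFn_add (lineFourier u) (lineFourier v)] with ξ hξ
  simp only [lineWeighted, map_add, hξ, Pi.add_apply, smul_add]

theorem lineWeighted_smul (s c : ℝ) (u : Lp ℝ 2 (volume : Measure ℝ)) :
    lineWeighted s (c • u) =ᵐ[volume] c • lineWeighted s u := by
  filter_upwards [Lp.coeFn_smul c (lineFourier u)] with ξ hξ
  simp only [lineWeighted, map_smul, hξ, Pi.smul_apply]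
  exact smul_comm _ _ _

/-- The real-valued functions on the line that lie in the Sobolev space of order `s`, as a subspace
of `L²`. When `s ≥ 0`, every tempered distribution in the Sobolev space is a function in `L²`, so
that this is the whole space. -/
def lineSobolev (s : ℝ) : Submodule ℝ (Lp ℝ 2 (volume : Measure ℝ)) where
  carrier := {u | MemLp (lineWeighted s u) 2 volume}
  zero_mem' := by
    have h : lineWeighted s 0 =ᵐ[volume] 0 := by
      simpa using lineWeighted_smul s 0 0
    exact (memLp_congr_ae h).2 MemLp.zero
  add_mem' {u v} hu hv := (memLp_congr_ae (lineWeighted_add s u v)).2 (hu.add hv)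
  smul_mem' c u hu := (memLp_congr_ae (lineWeighted_smul s c u)).2 (hu.const_smul c)

/-- Square integrability with the weight `(1 + (2πξ)²)^{s/2}` is the same as with the weight
`(1 + ξ²)^{s/2}`, which Mathlib uses. -/
theorem mem_lineSobolev_iff_memLp (s : ℝ) (u : Lp ℝ 2 (volume : Measure ℝ)) :
    u ∈ lineSobolev s ↔
      MemLp (fun ξ : ℝ => ((1 + ‖ξ‖ ^ 2) ^ (s / 2) : ℝ) • lineFourier u ξ) 2 volume := by
  have key (w w' : ℝ → ℝ) (hw : Continuous w) (C : ℝ)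
      (hb : ∀ ξ, |w ξ| ≤ C * |w' ξ|)
      (h : MemLp (fun ξ : ℝ => w' ξ • lineFourier u ξ) 2 volume) :
      MemLp (fun ξ : ℝ => w ξ • lineFourier u ξ) 2 volume := by
    refine h.of_le_mul (c := C)
      (hw.aestronglyMeasurable.smul (Lp.aestronglyMeasurable _)) (ae_of_all _ fun ξ => ?_)
    rw [norm_smul, norm_smul, Real.norm_eq_abs, Real.norm_eq_abs, ← mul_assoc]
    exact mul_le_mul_of_nonneg_right (hb ξ) (norm_nonneg _)
  have c1 : Continuous fun ξ : ℝ => ((1 + (2 * π * ξ) ^ 2) ^ (s / 2) : ℝ) :=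
    Continuous.rpow_const (by fun_prop) fun ξ => Or.inl (by positivity)
  have c2 : Continuous fun ξ : ℝ => ((1 + ‖ξ‖ ^ 2) ^ (s / 2) : ℝ) :=
    Continuous.rpow_const (by fun_prop) fun ξ => Or.inl (by positivity)
  have hpi : (1 : ℝ) ≤ (2 * π) ^ 2 := by nlinarith [Real.pi_gt_three]
  have hlow (ξ : ℝ) : 1 + ‖ξ‖ ^ 2 ≤ 1 + (2 * π * ξ) ^ 2 := by
    rw [Real.norm_eq_abs, sq_abs, mul_pow]
    nlinarith [sq_nonneg ξ]
  have hupp (ξ : ℝ) : 1 + (2 * π * ξ) ^ 2 ≤ (2 * π) ^ 2 * (1 + ‖ξ‖ ^ 2) := by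
    rw [Real.norm_eq_abs, sq_abs, mul_pow]
    nlinarith [sq_nonneg ξ]
  have cmp (x y c t : ℝ) (hx : 0 < x) (hc : 1 ≤ c) (hxy : x ≤ c * y) (hyx : y ≤ c * x)
      (hy : 0 < y) : |x ^ t| ≤ c ^ |t| * |y ^ t| := by
    have hc0 : 0 < c := by linarith
    rw [abs_of_pos (Real.rpow_pos_of_pos hx t), abs_of_pos (Real.rpow_pos_of_pos hy t)]
    rcases le_total 0 t with ht | ht
    · rw [abs_of_nonneg ht, ← Real.mul_rpow hc0.le hy.le]
      exact Real.rpow_le_rpow hx.le hxy ht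
    · have h1 : (c * x) ^ t ≤ y ^ t := Real.rpow_le_rpow_of_nonpos hy hyx ht
      rw [Real.mul_rpow hc0.le hx.le] at h1
      rw [abs_of_nonpos ht, Real.rpow_neg hc0.le]
      have h2 : 0 < c ^ t := Real.rpow_pos_of_pos hc0 t
      rwa [inv_mul_eq_div, le_div_iff₀' h2]
  constructor
  · refine key _ _ c2 (((2 * π) ^ 2) ^ |s / 2|) fun ξ => ?_
    refine cmp _ _ _ _ (by positivity) hpi ?_ (hupp ξ) (by positivity)
    nlinarith [hlow ξ, sq_nonneg (2 * π * ξ)]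
  · refine key _ _ c1 (((2 * π) ^ 2) ^ |s / 2|) fun ξ => ?_
    refine cmp _ _ _ _ (by positivity) hpi (hupp ξ) ?_ (by positivity)
    nlinarith [hlow ξ, sq_nonneg (2 * π * ξ)]

/-- The subspace `lineSobolev s` consists of the real-valued square integrable functions that belong
to Mathlib's Sobolev space of tempered distributions. -/
theorem mem_lineSobolev_iff (s : ℝ) (u : Lp ℝ 2 (volume : Measure ℝ)) :
    u ∈ lineSobolev s ↔ TemperedDistribution.MemSobolev s 2
      (Lp.toTemperedDistribution (Complex.ofRealCLM.compLp u)) := by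
  rw [mem_lineSobolev_iff_memLp, TemperedDistribution.memSobolev_iff_exists_smulLeftCLM_fourier,
    Lp.fourier_toTemperedDistribution_eq]
  change _ ↔ ∃ f' : Lp ℂ 2 (volume : Measure ℝ), TemperedDistribution.smulLeftCLM ℂ _
    (Lp.toTemperedDistribution (lineFourier u)) = _
  have hw : (fun x : ℝ => (((1 + ‖x‖ ^ 2) ^ (s / 2) : ℝ) : ℂ)).HasTemperateGrowth := by
    fun_prop
  have c2 : Continuous fun ξ : ℝ => ((1 + ‖ξ‖ ^ 2) ^ (s / 2) : ℝ) :=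
    Continuous.rpow_const (by fun_prop) fun ξ => Or.inl (by positivity)
  constructor
  · intro h
    refine ⟨h.toLp, ?_⟩
    ext g
    rw [TemperedDistribution.smulLeftCLM_apply_apply, Lp.toTemperedDistribution_apply,
      Lp.toTemperedDistribution_apply]
    refine integral_congr_ae ?_
    filter_upwards [h.coeFn_toLp] with ξ hξ
    rw [hξ, SchwartzMap.smulLeftCLM_apply_apply hw, Complex.real_smul]
    simp only [smul_eq_mul]
    ring
  · rintro ⟨f', hf'⟩
    have hU : LocallyIntegrable (lineFourier u : ℝ → ℂ) volume :=
      (Lp.memLp _).locallyIntegrable (by norm_num)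
    have hae : ∀ᵐ ξ : ℝ, ((1 + ‖ξ‖ ^ 2) ^ (s / 2) : ℝ) • lineFourier u ξ = f' ξ := by
      refine ae_eq_of_integral_contDiff_smul_eq ?_
        ((Lp.memLp f').locallyIntegrable (by norm_num)) fun g hg hgs => ?_
      · exact (locallyIntegrableOn_univ.1
          ((locallyIntegrableOn_univ.2 hU).continuousOn_smul isOpen_univ.isLocallyClosed c2.continuousOn))
      · have hgs' : HasCompactSupport (fun x => (g x : ℂ)) :=
          hgs.comp_left (g := Complex.ofReal) Complex.ofReal_zero
        have hg' : ContDiff ℝ ((⊤ : ℕ∞) : WithTop ℕ∞) (fun x => (g x : ℂ)) :=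
          Complex.ofRealCLM.contDiff.comp hg
        have h1 := congrArg (fun T => T (hgs'.toSchwartzMap hg')) hf'
        simp only [TemperedDistribution.smulLeftCLM_apply_apply,
          Lp.toTemperedDistribution_apply, SchwartzMap.smulLeftCLM_apply_apply hw] at h1
        refine Eq.trans (integral_congr_ae (ae_of_all _ fun x => ?_))
          (h1.trans (integral_congr_ae (ae_of_all _ fun x => ?_)))
        · change g x • (_ • _) = (_ • (g x : ℂ)) • _
          simp only [Complex.real_smul, smul_eq_mul]
          ring
        · change (g x : ℂ) • _ = g x • _
          rw [Complex.real_smul, smul_eq_mul]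
    exact (memLp_congr_ae hae).2 (Lp.memLp f')

/-- The space `H^s(ℝ)` of real-valued functions, `s ≥ 0`, which carries the norm
`‖u‖_s² = ∫ (1 + k²)^s |û(k)|² dk` (and not the norm of `L²`). -/
def SobolevLine (s : ℝ) : Type := lineSobolev s

instance (s : ℝ) : AddCommGroup (SobolevLine s) := inferInstanceAs (AddCommGroup (lineSobolev s))

instance (s : ℝ) : Module ℝ (SobolevLine s) := inferInstanceAs (Module ℝ (lineSobolev s))

/-- The square integrable function underlying an element of `H^s(ℝ)`. -/
def SobolevLine.toL2 {s : ℝ} : SobolevLine s →ₗ[ℝ] Lp ℝ 2 (volume : Measure ℝ) :=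
  (lineSobolev s).subtype

theorem SobolevLine.toL2_injective {s : ℝ} :
    Function.Injective (SobolevLine.toL2 : SobolevLine s →ₗ[ℝ] _) :=
  (lineSobolev s).subtype_injective

theorem SobolevLine.memLp {s : ℝ} (u : SobolevLine s) :
    MemLp (lineWeighted s u.toL2) 2 volume := u.2

/-- The map `u ↦ (1 + k²)^{s/2} û` into `L²`, whose `L²` norm is the norm of `H^s(ℝ)`. -/
def SobolevLine.weighted (s : ℝ) : SobolevLine s →ₗ[ℝ] Lp ℂ 2 (volume : Measure ℝ) where
  toFun u := u.memLp.toLp _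
  map_add' u v := by
    rw [← MemLp.toLp_add, MemLp.toLp_eq_toLp_iff, map_add]
    exact lineWeighted_add s _ _
  map_smul' c u := by
    rw [RingHom.id_apply, ← MemLp.toLp_const_smul, MemLp.toLp_eq_toLp_iff, map_smul]
    exact lineWeighted_smul s c _

theorem SobolevLine.weighted_injective (s : ℝ) :
    Function.Injective (SobolevLine.weighted s) := by
  intro u v huv
  apply SobolevLine.toL2_injective
  apply lineFourier_injective
  refine Lp.ext ?_
  filter_upwards [(MemLp.toLp_eq_toLp_iff u.memLp v.memLp).1 huv] with ξ hξ
  have hpos : ((1 + (2 * π * ξ) ^ 2) ^ (s / 2) : ℝ) ≠ 0 := by positivity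
  exact smul_right_injective ℂ hpos hξ

instance (s : ℝ) : NormedAddCommGroup (SobolevLine s) :=
  NormedAddCommGroup.induced _ _ (SobolevLine.weighted s) (SobolevLine.weighted_injective s)

instance (s : ℝ) : NormedSpace ℝ (SobolevLine s) :=
  NormedSpace.induced ℝ _ _ (SobolevLine.weighted s)

/-- `g = A (u - (3/4) α u²)` on the line, where `A` is the Fourier multiplier by `-i φ(k)`,
`k = 2 π ξ`. Here `u ∈ L²`, so that `u²` is integrable and its Fourier transform is given by the
Fourier integral. -/
def IsLineVectorField (φ : ℝ → ℝ) (α : ℝ) {s : ℝ} (u g : SobolevLine s) : Prop :=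
  ∀ᵐ ξ : ℝ, lineFourier g.toL2 ξ = -Complex.I * φ (2 * π * ξ) *
    (lineFourier u.toL2 ξ - 3 / 4 * α * 𝓕 (fun x : ℝ => ((u.toL2 x ^ 2 : ℝ) : ℂ)) ξ)

/-! ### Real-valued Sobolev spaces on the circle of length `2π` -/

instance twoPiPos : Fact (0 < 2 * π) := ⟨Real.two_pi_pos⟩

/-- Real-valued square integrable functions on the circle `ℝ / 2πℤ`, with respect to the normalised
measure `dx / 2π`. -/
abbrev CircleL2 : Type := Lp ℝ 2 (AddCircle.haarAddCircle : Measure (AddCircle (2 * π)))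

/-- The Fourier coefficients `û(k) = (1 / 2π) ∫_{-π}^{π} u(x) e^{-i k x} dx`. -/
def circleFourier (u : CircleL2) (k : ℤ) : ℂ :=
  fourierCoeff (fun x => (u x : ℂ)) k

theorem circleL2_integrable (u : CircleL2) :
    Integrable (fun x => (u x : ℂ)) (AddCircle.haarAddCircle : Measure (AddCircle (2 * π))) :=
  ((Lp.memLp u).integrable (by norm_num)).ofReal

theorem circleFourier_add (u v : CircleL2) :
    circleFourier (u + v) = circleFourier u + circleFourier v := by
  have h : (fun x => ((u + v : CircleL2) x : ℂ)) =ᵐ[AddCircle.haarAddCircle]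
      (fun x => (u x : ℂ)) + fun x => (v x : ℂ) := by
    filter_upwards [Lp.coeFn_add u v] with x hx
    rw [hx]
    simp
  unfold circleFourier
  rw [← fourierCoeff.add (circleL2_integrable u) (circleL2_integrable v)]
  exact fourierCoeff_congr_ae h

theorem circleFourier_smul (c : ℝ) (u : CircleL2) :
    circleFourier (c • u) = c • circleFourier u := by
  have h : (fun x => ((c • u : CircleL2) x : ℂ)) =ᵐ[AddCircle.haarAddCircle]
      (c : ℂ) • fun x => (u x : ℂ) := by
    filter_upwards [Lp.coeFn_smul c u] with x hx
    simp [hx]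
  unfold circleFourier
  ext k
  rw [fourierCoeff_congr_ae h]
  simpa using fourierCoeff.const_smul (fun x => (u x : ℂ)) (c : ℂ) k

theorem circleFourier_injective : Function.Injective circleFourier := by
  intro u v huv
  have hc (w : CircleL2) (k : ℤ) :
      fourierBasis.repr (Complex.ofRealCLM.compLp w) k = circleFourier w k := by
    rw [fourierBasis_repr]
    exact congrFun (fourierCoeff_congr_ae (Complex.ofRealCLM.coeFn_compLp w)) k
  have h1 : Complex.ofRealCLM.compLp u = Complex.ofRealCLM.compLp v := by
    apply fourierBasis.repr.injective
    ext k
    rw [hc, hc, huv]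
  refine Lp.ext ?_
  filter_upwards [Complex.ofRealCLM.coeFn_compLp u, Complex.ofRealCLM.coeFn_compLp v]
    with x hx hy
  rw [h1, hy] at hx
  simpa using hx.symm

/-- The weighted Fourier coefficients `(1 + k²)^{s/2} û(k)`. -/
def circleWeighted (s : ℝ) (u : CircleL2) (k : ℤ) : ℂ :=
  ((1 + (k : ℝ) ^ 2) ^ (s / 2) : ℝ) • circleFourier u k

theorem circleWeighted_add (s : ℝ) (u v : CircleL2) :
    circleWeighted s (u + v) = circleWeighted s u + circleWeighted s v := by
  ext k
  simp [circleWeighted, circleFourier_add]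

theorem circleWeighted_smul (s c : ℝ) (u : CircleL2) :
    circleWeighted s (c • u) = c • circleWeighted s u := by
  ext k
  simp only [circleWeighted, circleFourier_smul, Pi.smul_apply]
  exact smul_comm _ _ _

/-- The real-valued functions on the circle that lie in the Sobolev space of order `s`, as a
subspace of `L²`. When `s ≥ 0`, every periodic distribution in the Sobolev space is a function in
`L²`, so that this is the whole space. -/
def circleSobolev (s : ℝ) : Submodule ℝ CircleL2 where
  carrier := {u | Memℓp (circleWeighted s u) 2}
  zero_mem' := by
    have h : circleWeighted s 0 = 0 := by simpa using circleWeighted_smul s 0 0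
    simpa only [Set.mem_ofPred_eq, h] using zero_memℓp
  add_mem' {u v} hu hv := by
    simpa only [Set.mem_ofPred_eq, circleWeighted_add] using Memℓp.add hu hv
  smul_mem' c u hu := by
    simpa only [Set.mem_ofPred_eq, circleWeighted_smul] using Memℓp.const_smul hu c

/-- The space `H^s_per` of real-valued functions, `s ≥ 0`, which carries the norm
`‖u‖_s² = ∑ₖ (1 + k²)^s |û(k)|²` (and not the norm of `L²`). -/
def SobolevCircle (s : ℝ) : Type := circleSobolev s

instance (s : ℝ) : AddCommGroup (SobolevCircle s) :=
  inferInstanceAs (AddCommGroup (circleSobolev s))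

instance (s : ℝ) : Module ℝ (SobolevCircle s) := inferInstanceAs (Module ℝ (circleSobolev s))

/-- The square integrable function underlying an element of `H^s_per`. -/
def SobolevCircle.toL2 {s : ℝ} : SobolevCircle s →ₗ[ℝ] CircleL2 := (circleSobolev s).subtype

theorem SobolevCircle.toL2_injective {s : ℝ} :
    Function.Injective (SobolevCircle.toL2 : SobolevCircle s →ₗ[ℝ] _) :=
  (circleSobolev s).subtype_injective

theorem SobolevCircle.memℓp {s : ℝ} (u : SobolevCircle s) :
    Memℓp (circleWeighted s u.toL2) 2 := u.2

/-- The map `u ↦ (1 + k²)^{s/2} û` into `ℓ²`, whose `ℓ²` norm is the norm of `H^s_per`. -/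
def SobolevCircle.weighted (s : ℝ) : SobolevCircle s →ₗ[ℝ] lp (fun _ : ℤ => ℂ) 2 where
  toFun u := ⟨circleWeighted s u.toL2, u.memℓp⟩
  map_add' u v := Subtype.ext (circleWeighted_add s u.toL2 v.toL2)
  map_smul' c u := Subtype.ext (circleWeighted_smul s c u.toL2)

theorem SobolevCircle.weighted_injective (s : ℝ) :
    Function.Injective (SobolevCircle.weighted s) := by
  intro u v huv
  apply SobolevCircle.toL2_injective
  apply circleFourier_injective
  ext k
  have hk : circleWeighted s u.toL2 k = circleWeighted s v.toL2 k :=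
    congrFun (congrArg Subtype.val huv) k
  have hpos : ((1 + (k : ℝ) ^ 2) ^ (s / 2) : ℝ) ≠ 0 := by positivity
  exact smul_right_injective ℂ hpos hk

instance (s : ℝ) : NormedAddCommGroup (SobolevCircle s) :=
  NormedAddCommGroup.induced _ _ (SobolevCircle.weighted s) (SobolevCircle.weighted_injective s)

instance (s : ℝ) : NormedSpace ℝ (SobolevCircle s) :=
  NormedSpace.induced ℝ _ _ (SobolevCircle.weighted s)

/-- `g = A (u - (3/4) α u²)` on the circle, where `A` is the Fourier multiplier by `-i φ(k)`,
`k ∈ ℤ`. Here `u ∈ L²`, so that `u²` is integrable and has Fourier coefficients. -/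
def IsCircleVectorField (φ : ℝ → ℝ) (α : ℝ) {s : ℝ} (u g : SobolevCircle s) : Prop :=
  ∀ k : ℤ, circleFourier g.toL2 k = -Complex.I * φ k *
    (circleFourier u.toL2 k - 3 / 4 * α *
      fourierCoeff (fun x : AddCircle (2 * π) => ((u.toL2 x ^ 2 : ℝ) : ℂ)) k)

/-! ### Well-posedness -/

section WellPosedness

variable {X : Type*} [NormedAddCommGroup X] [NormedSpace ℝ X]

/-- `η ∈ C([-T,T]; X)` solves `η_t = F(η)`, `η(0) = η₀`; the derivative is taken in the norm of `X`,
and it is one-sided at `t = ±T`. -/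
structure IsSolutionOn (F : X → X) (η₀ : X) (T : ℝ) (η : ℝ → X) : Prop where
  continuousOn : ContinuousOn η (Set.Icc (-T) T)
  initial : η 0 = η₀
  hasDeriv : ∀ t ∈ Set.Icc (-T) T, HasDerivWithinAt η (F (η t)) (Set.Icc (-T) T) t

/-- `η ∈ C(ℝ; X)` solves `η_t = F(η)`, `η(0) = η₀` on the whole line. -/
structure IsGlobalSolution (F : X → X) (η₀ : X) (η : C(ℝ, X)) : Prop where
  initial : η 0 = η₀
  hasDeriv : ∀ t : ℝ, HasDerivAt η (F (η t)) t

/-- Global well-posedness in `X` of the Cauchy problem `η_t = F(η)`, `η(0) = η₀`, with `F`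
continuous: for every `T > 0` there is a solution on `[-T, T]` for every initial value, there is at
most one, and it depends continuously on the initial value, uniformly on `[-T, T]`. -/
structure IsGloballyWellPosed (F : X → X) : Prop where
  continuous : Continuous F
  exists_solution : ∀ T : ℝ, 0 < T → ∀ η₀ : X, ∃ η : ℝ → X, IsSolutionOn F η₀ T η
  unique_solution : ∀ T : ℝ, 0 < T → ∀ (η₀ : X) (η₁ η₂ : ℝ → X),
    IsSolutionOn F η₀ T η₁ → IsSolutionOn F η₀ T η₂ → Set.EqOn η₁ η₂ (Set.Icc (-T) T)
  continuous_dependence : ∀ T : ℝ, 0 < T → ∀ (ψ : ℕ → X) (ψ' : X), Tendsto ψ atTop (𝓝 ψ') →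
    ∀ η' : ℝ → X, IsSolutionOn F ψ' T η' →
      ∃ η : ℕ → ℝ → X, (∀ᶠ n in atTop, IsSolutionOn F (ψ n) T (η n)) ∧
        TendstoUniformlyOn η η' atTop (Set.Icc (-T) T)

end WellPosedness

end

/-! On the Fourier side the equation is `û_t = -iφ û + iβ φ (û * û)` with `φ = k / m` and `β =
3α/4`. Both symbols satisfy `m ≥ c (1 + k²)`, and `(1 + k²)⁻¹` is integrable over the frequencies,
so `φ` is bounded and square integrable (`IsDispersive.sq_phase_le`). For `u ∈ L²` the convolution
`û * û` is bounded by Cauchy–Schwarz, hence `φ (û * û) ∈ L²`. The right-hand side is therefore a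
bounded linear plus a bounded quadratic map, and the Cauchy problem is an ordinary differential
equation with a field that is Lipschitz on balls. Local existence, uniqueness and continuous
dependence come from Picard–Lindelöf and Grönwall; what remains is an a priori bound on `[-T, T]`.

The energy `∫ m |û|²` is conserved: the linear symbol is imaginary, and the quadratic term
contributes a multiple of `∫ u_x u² = 0` (`IsDispersive.inner_energyKernel_eq_zero`). The energy may
be infinite for `u ∈ L²`, so for `s = 0` the initial value is split as `v₀ + w₀`, with `w₀` of
finite energy and `v₀` so small that its solution `v` stays in the unit ball of `L²` on `[-T, T]`.
The remainder `w` solves the same equation with the additional cross term `2 B(v, w)`, which is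
bounded in the energy norm although `v` is only in `L²`
(`IsDispersive.exists_isConvKernel_energyKernel`). The energy of `w` thus grows at most
exponentially, and `v + w` is the solution (`exists_isSolutionOn_of_dense_conservative`).

For `s ≥ 0` the subadditivity of the weight gives `‖B(u, u)‖_s ≤ C ‖u‖₀ ‖u‖_s`. This is linear in
the `s`-norm, so the bound on the `L²` solution and Grönwall prevent blow-up in `H^s`
(`isGloballyWellPosed_of_tame`).

Line and circle are treated together, as `L²` spaces of Hermitian functions on the frequency group
(`ℝ` with Lebesgue measure, `ℤ` with counting measure). The isometries `lineEquiv` and `circleEquiv`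
carry the result back, once squares have been identified with convolutions. -/

/-! ### Ordinary differential equations on symmetric intervals -/

/-- Lipschitz continuity on every ball around the origin. -/
def LipschitzOnBalls {X : Type*} [NormedAddCommGroup X] (F : X → X) : Prop :=
  ∀ R : ℝ, ∃ K : NNReal, LipschitzOnWith K F (Metric.closedBall 0 R)

theorem LipschitzOnBalls.continuous {X : Type*} [NormedAddCommGroup X] {F : X → X} (hF : LipschitzOnBalls F) : Continuous F := by
  rw [continuous_iff_continuousAt]
  intro x
  obtain ⟨K, hK⟩ := hF (‖x‖ + 1)
  refine hK.continuousOn.continuousAt ?_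
  refine mem_of_superset (Metric.closedBall_mem_nhds x one_pos) fun y hy => ?_
  rw [mem_closedBall_zero_iff]
  rw [Metric.mem_closedBall, dist_eq_norm] at hy
  linarith [norm_le_norm_add_norm_sub' y x]

section AbstractODE

variable {X : Type*} [NormedAddCommGroup X] [NormedSpace ℝ X]

theorem zero_mem_Icc_neg {T : ℝ} (hT : 0 < T) : (0 : ℝ) ∈ Set.Icc (-T) T :=
  ⟨by linarith, hT.le⟩

/-- Grönwall's inequality on `[-T, T]`, in both directions of time. -/
theorem norm_le_exp_of_norm_deriv_le {f f' : ℝ → X} {T K : ℝ} (hK : 0 ≤ K)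
    (hf : ∀ t ∈ Set.Icc (-T) T, HasDerivWithinAt f (f' t) (Set.Icc (-T) T) t)
    (hb : ∀ t ∈ Set.Icc (-T) T, ‖f' t‖ ≤ K * ‖f t‖) :
    ∀ t ∈ Set.Icc (-T) T, ‖f t‖ ≤ ‖f 0‖ * Real.exp (K * T) := by
  -- Grönwall forward in time; the half `[-T, 0]` follows by applying it to `t ↦ f (-t)`.
  have key : ∀ g g' : ℝ → X,
      (∀ t ∈ Set.Icc (-T) T, HasDerivWithinAt g (g' t) (Set.Icc (-T) T) t) →
      (∀ t ∈ Set.Icc (-T) T, ‖g' t‖ ≤ K * ‖g t‖) →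
      ∀ t ∈ Set.Icc 0 T, ‖g t‖ ≤ ‖g 0‖ * Real.exp (K * T) := by
    intro g g' hg hgb t ht
    have hT : 0 ≤ T := ht.1.trans ht.2
    have h := norm_le_gronwallBound_of_norm_deriv_right_le (f := g) (f' := g') (δ := ‖g 0‖)
      (K := K) (ε := 0) (a := 0) (b := T)
      (fun x hx => ((hg x ⟨by linarith [hx.1], hx.2⟩).continuousWithinAt).mono
        (Set.Icc_subset_Icc_left (by linarith)))
      (fun x hx => (hg x ⟨by linarith [hx.1], hx.2.le⟩).mono_of_mem_nhdsWithin
        (Icc_mem_nhdsGE_of_mem ⟨by linarith [hx.1], hx.2⟩))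
      le_rfl
      (fun x hx => by simpa using hgb x ⟨by linarith [hx.1], hx.2.le⟩) t ht
    rw [gronwallBound_ε0] at h
    refine h.trans ?_
    gcongr
    linarith [ht.2]
  intro t ht
  rcases le_total 0 t with h0 | h0
  · exact key f f' hf hb t ⟨h0, ht.2⟩
  · have hneg : Set.MapsTo (fun t : ℝ => -t) (Set.Icc (-T) T) (Set.Icc (-T) T) :=
      fun x hx => ⟨by linarith [hx.2], by linarith [hx.1]⟩
    have h := key (fun t => f (-t)) (fun t => -f' (-t))
      (fun x hx => by
        have h1 := (hf (-x) (hneg hx)).scomp x (hasDerivAt_neg x).hasDerivWithinAt hneg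
        simpa [Function.comp_def] using h1)
      (fun x hx => by simpa using hb (-x) (hneg hx)) (-t) ⟨by linarith, by linarith [ht.1]⟩
    simpa using h

/-- The radial retraction onto the closed ball of radius `R`. -/
noncomputable def radialClip (R : ℝ) (x : X) : X := (R / max R ‖x‖) • x

theorem radialClip_eq_self {R : ℝ} (hR : 0 < R) {x : X} (hx : ‖x‖ ≤ R) : radialClip R x = x := by
  rw [radialClip, max_eq_left hx, div_self hR.ne', one_smul]

theorem norm_radialClip_le {R : ℝ} (hR : 0 < R) (x : X) : ‖radialClip R x‖ ≤ R := by
  have h : 0 < max R ‖x‖ := lt_max_of_lt_left hR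
  rw [radialClip, norm_smul, Real.norm_of_nonneg (by positivity), div_mul_eq_mul_div,
    div_le_iff₀ h]
  exact mul_le_mul_of_nonneg_left (le_max_right _ _) hR.le

theorem norm_radialClip_le_norm {R : ℝ} (hR : 0 < R) (x : X) : ‖radialClip R x‖ ≤ ‖x‖ := by
  have h : 0 < max R ‖x‖ := lt_max_of_lt_left hR
  rw [radialClip, norm_smul, Real.norm_of_nonneg (by positivity)]
  exact mul_le_of_le_one_left (norm_nonneg _) ((div_le_one h).2 (le_max_left _ _))

/-- With `a`, `b` the two maxima, the difference is `(R/a)(x - y) + (R/a - R/b) y`, and each term is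
at most `‖x - y‖`. This works in any normed space, at the price of the constant `2`. -/
theorem lipschitzWith_radialClip {R : ℝ} (hR : 0 < R) :
    LipschitzWith 2 (radialClip R : X → X) := by
  refine LipschitzWith.of_dist_le_mul fun x y => ?_
  have ha : 0 < max R ‖x‖ := lt_max_of_lt_left hR
  have hb : 0 < max R ‖y‖ := lt_max_of_lt_left hR
  set a := max R ‖x‖
  set b := max R ‖y‖
  have hab : |b - a| ≤ ‖x - y‖ := by
    have h1 : |max R ‖y‖ - max R ‖x‖| ≤ |‖y‖ - ‖x‖| := by
      simpa using abs_max_sub_max_le_max R ‖y‖ R ‖x‖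
    exact h1.trans (by simpa [norm_sub_rev] using abs_norm_sub_norm_le y x)
  rw [dist_eq_norm, dist_eq_norm]
  have h1 : radialClip R x - radialClip R y = (R / a) • (x - y) + (R / a - R / b) • y := by
    simp only [radialClip, smul_sub, sub_smul, a, b]
    abel
  rw [h1]
  refine (norm_add_le _ _).trans ?_
  rw [norm_smul, norm_smul, Real.norm_of_nonneg (by positivity : 0 ≤ R / a)]
  have h2 : R / a * ‖x - y‖ ≤ ‖x - y‖ :=
    mul_le_of_le_one_left (norm_nonneg _) ((div_le_one ha).2 (le_max_left _ _))
  have h3 : ‖R / a - R / b‖ * ‖y‖ ≤ ‖x - y‖ := by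
    have h4 : R / a - R / b = (R / a) * ((b - a) / b) := by field_simp
    rw [h4, norm_mul, Real.norm_of_nonneg (by positivity : 0 ≤ R / a), norm_div,
      Real.norm_of_nonneg hb.le, Real.norm_eq_abs]
    have h5 : R / a ≤ 1 := (div_le_one ha).2 (le_max_left _ _)
    have h6 : ‖y‖ / b ≤ 1 := (div_le_one hb).2 (le_max_right _ _)
    calc R / a * (|b - a| / b) * ‖y‖ = (R / a) * (‖y‖ / b) * |b - a| := by ring
      _ ≤ 1 * 1 * |b - a| := by gcongr
      _ ≤ ‖x - y‖ := by simpa using hab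
  have : ((2 : NNReal) : ℝ) = 2 := rfl
  rw [this]
  linarith

/-- The purpose of the clipping: the clipped field is globally Lipschitz, and a solution of it that
stays in the ball of radius `R` solves the original equation, and conversely. -/
theorem LipschitzOnBalls.exists_lipschitzWith_radialClip {F : X → X} (hF : LipschitzOnBalls F)
    {R : ℝ} (hR : 0 < R) : ∃ K : NNReal, LipschitzWith K (F ∘ radialClip R) := by
  obtain ⟨K, hK⟩ := hF R
  refine ⟨K * 2, ?_⟩
  rw [← lipschitzOnWith_univ]
  refine hK.comp (lipschitzWith_radialClip hR).lipschitzOnWith fun x _ => ?_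
  simpa using norm_radialClip_le hR x

theorem IsSolutionOn.mk_of_hasDeriv {F : X → X} {x₀ : X} {T : ℝ} {y : ℝ → X} (h0 : y 0 = x₀)
    (h : ∀ t ∈ Set.Icc (-T) T, HasDerivWithinAt y (F (y t)) (Set.Icc (-T) T) t) :
    IsSolutionOn F x₀ T y :=
  ⟨fun t ht => (h t ht).continuousWithinAt, h0, h⟩

theorem IsSolutionOn.mono {F : X → X} {x₀ : X} {T T' : ℝ} {y : ℝ → X}
    (h : IsSolutionOn F x₀ T y) (hT : T' ≤ T) : IsSolutionOn F x₀ T' y := by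
  have hs : Set.Icc (-T') T' ⊆ Set.Icc (-T) T := Set.Icc_subset_Icc (by linarith) hT
  exact .mk_of_hasDeriv h.initial fun t ht => (h.hasDeriv t (hs ht)).mono hs

theorem IsSolutionOn.congr_field {F G : X → X} {x₀ : X} {T : ℝ} {y : ℝ → X}
    (h : IsSolutionOn F x₀ T y) (hFG : ∀ t ∈ Set.Icc (-T) T, F (y t) = G (y t)) :
    IsSolutionOn G x₀ T y :=
  .mk_of_hasDeriv h.initial fun t ht => hFG t ht ▸ h.hasDeriv t ht

/-- Used for isometries, for embeddings between spaces of different regularity, and for projections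
and sums on a product space. -/
theorem IsSolutionOn.map {Y : Type*} [NormedAddCommGroup Y] [NormedSpace ℝ Y] {F : X → X}
    {G : Y → Y} {x₀ : X} {T : ℝ} {y : ℝ → X} (h : IsSolutionOn F x₀ T y) (J : X →L[ℝ] Y)
    (hJ : ∀ x, J (F x) = G (J x)) : IsSolutionOn G (J x₀) T (fun t => J (y t)) := by
  refine .mk_of_hasDeriv (by rw [h.initial]) fun t ht => ?_
  rw [← hJ]
  exact J.hasFDerivAt.comp_hasDerivWithinAt t (h.hasDeriv t ht)

theorem IsSolutionOn.exists_bound {F : X → X} {x₀ : X} {T : ℝ} {y : ℝ → X}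
    (h : IsSolutionOn F x₀ T y) : ∃ R : ℝ, 0 < R ∧ ∀ t ∈ Set.Icc (-T) T, ‖y t‖ ≤ R := by
  obtain ⟨R, hR⟩ := isCompact_Icc.exists_bound_of_continuousOn h.continuousOn
  exact ⟨max R 1, by positivity, fun t ht => (hR t ht).trans (le_max_left _ _)⟩

theorem IsSolutionOn.radialClip {F : X → X} {x₀ : X} {T R : ℝ} {y : ℝ → X}
    (h : IsSolutionOn F x₀ T y) (hR : 0 < R) (hy : ∀ t ∈ Set.Icc (-T) T, ‖y t‖ ≤ R) :
    IsSolutionOn (F ∘ radialClip R) x₀ T y :=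
  h.congr_field fun t ht => by rw [Function.comp_apply, radialClip_eq_self hR (hy t ht)]

theorem IsSolutionOn.of_radialClip {F : X → X} {x₀ : X} {T R : ℝ} {y : ℝ → X}
    (h : IsSolutionOn (F ∘ _root_.radialClip R) x₀ T y) (hR : 0 < R)
    (hy : ∀ t ∈ Set.Icc (-T) T, ‖y t‖ ≤ R) : IsSolutionOn F x₀ T y :=
  h.congr_field fun t ht => by rw [Function.comp_apply, radialClip_eq_self hR (hy t ht)]

theorem norm_sub_le_of_lipschitzWith {F : X → X} {K : NNReal} (hF : LipschitzWith K F)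
    {T : ℝ} {x₁ x₂ : X} {y₁ y₂ : ℝ → X} (h₁ : IsSolutionOn F x₁ T y₁)
    (h₂ : IsSolutionOn F x₂ T y₂) :
    ∀ t ∈ Set.Icc (-T) T, ‖y₁ t - y₂ t‖ ≤ ‖x₁ - x₂‖ * Real.exp (K * T) := by
  have h := norm_le_exp_of_norm_deriv_le (f := fun t => y₁ t - y₂ t) K.coe_nonneg
    (fun t ht => (h₁.hasDeriv t ht).sub (h₂.hasDeriv t ht))
    (fun t _ => by simpa [dist_eq_norm] using hF.dist_le_mul (y₁ t) (y₂ t))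
  simpa only [h₁.initial, h₂.initial] using h

/-- Solutions are bounded on a compact interval, so both survive clipping at a common radius, where
the global Lipschitz estimate applies. -/
theorem LipschitzOnBalls.eqOn {F : X → X} (hF : LipschitzOnBalls F) {T : ℝ} {x₀ : X}
    {y₁ y₂ : ℝ → X} (h₁ : IsSolutionOn F x₀ T y₁) (h₂ : IsSolutionOn F x₀ T y₂) :
    Set.EqOn y₁ y₂ (Set.Icc (-T) T) := by
  intro t ht
  obtain ⟨R₁, hR₁, hb₁⟩ := h₁.exists_bound
  obtain ⟨R₂, hR₂, hb₂⟩ := h₂.exists_bound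
  have hR : 0 < max R₁ R₂ := lt_max_of_lt_left hR₁
  obtain ⟨K, hK⟩ := hF.exists_lipschitzWith_radialClip hR
  have h := norm_sub_le_of_lipschitzWith hK
    (h₁.radialClip hR fun t ht => (hb₁ t ht).trans (le_max_left _ _))
    (h₂.radialClip hR fun t ht => (hb₂ t ht).trans (le_max_right _ _)) t ht
  rw [sub_self, norm_zero, zero_mul] at h
  exact sub_eq_zero.1 (norm_le_zero_iff.1 h)

variable [CompleteSpace X]

theorem LipschitzOnBalls.exists_isSolutionOn_radialClip {F : X → X} (hF : LipschitzOnBalls F)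
    {R T : ℝ} (hR : 0 < R) (hT : 0 < T) (x₀ : X) :
    ∃ y : ℝ → X, IsSolutionOn (F ∘ radialClip R) x₀ T y := by
  obtain ⟨K, hK⟩ := hF.exists_lipschitzWith_radialClip hR
  obtain ⟨K', hK'⟩ := hF R
  have hbound : ∀ x, ‖(F ∘ radialClip R) x‖ ≤ (‖F 0‖₊ + K' * R.toNNReal : NNReal) := by
    intro x
    have hx := norm_radialClip_le hR x
    have h1 := hK'.dist_le_mul (radialClip R x) (by simpa using hx) 0 (by simpa using hR.le)
    rw [dist_eq_norm, dist_zero_right] at h1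
    have h2 := norm_le_norm_add_norm_sub' (F (radialClip R x)) (F 0)
    have h3 : (K' : ℝ) * ‖radialClip R x‖ ≤ K' * R := by gcongr
    rw [Function.comp_apply, NNReal.coe_add, NNReal.coe_mul, Real.coe_toNNReal _ hR.le,
      coe_nnnorm]
    linarith
  set L : NNReal := ‖F 0‖₊ + K' * R.toNNReal
  -- The clipped field is bounded by `L` everywhere, so a curve starting at `x₀` cannot leave the
  -- ball of radius `L T` before time `T`. With this radius the interval need not be shortened.
  have hpl : IsPicardLindelof (fun _ => F ∘ radialClip R)
      (⟨0, zero_mem_Icc_neg hT⟩ : Set.Icc (-T) T) x₀ (L * T.toNNReal) 0 L K := by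
    refine IsPicardLindelof.of_time_independent (fun x _ => hbound x) hK.lipschitzOnWith ?_
    simp [hT.le]
  obtain ⟨y, hy0, hy⟩ := hpl.exists_eq_forall_mem_Icc_hasDerivWithinAt₀
  exact ⟨y, .mk_of_hasDeriv hy0 hy⟩

/-- Clip at `R + 1`, where `R` bounds the reference solution. The clipped solutions converge
uniformly to it; once they are within distance `1`, they lie in the ball of radius `R + 1`, where
the clipping has no effect. -/
theorem LipschitzOnBalls.continuous_dependence {F : X → X} (hF : LipschitzOnBalls F)
    {T : ℝ} (hT : 0 < T) {ψ : ℕ → X} {ψ' : X} (hψ : Tendsto ψ atTop (𝓝 ψ')) {η' : ℝ → X}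
    (hη' : IsSolutionOn F ψ' T η') :
    ∃ η : ℕ → ℝ → X, (∀ᶠ n in atTop, IsSolutionOn F (ψ n) T (η n)) ∧
        TendstoUniformlyOn η η' atTop (Set.Icc (-T) T) := by
  obtain ⟨R, hR, hb⟩ := hη'.exists_bound
  have hR1 : 0 < R + 1 := by linarith
  obtain ⟨K, hK⟩ := hF.exists_lipschitzWith_radialClip hR1
  choose η hη using fun n => hF.exists_isSolutionOn_radialClip hR1 hT (ψ n)
  have hη'' := hη'.radialClip hR1 fun t ht => (hb t ht).trans (by linarith)
  have hlim : Tendsto (fun n => ‖ψ n - ψ'‖ * Real.exp (K * T)) atTop (𝓝 0) := by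
    simpa using (tendsto_iff_norm_sub_tendsto_zero.1 hψ).mul_const (Real.exp (K * T))
  have hest : ∀ n, ∀ t ∈ Set.Icc (-T) T, ‖η n t - η' t‖ ≤ ‖ψ n - ψ'‖ * Real.exp (K * T) :=
    fun n => norm_sub_le_of_lipschitzWith hK (hη n) hη''
  refine ⟨η, ?_, ?_⟩
  · filter_upwards [hlim.eventually (gt_mem_nhds one_pos)] with n hn
    refine (hη n).of_radialClip hR1 fun t ht => ?_
    linarith [hest n t ht, hb t ht, norm_le_norm_add_norm_sub' (η n t) (η' t)]
  · rw [Metric.tendstoUniformlyOn_iff]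
    intro ε hε
    filter_upwards [hlim.eventually (gt_mem_nhds hε)] with n hn t ht
    rw [dist_comm, dist_eq_norm]
    exact (hest n t ht).trans_lt hn

/-- A solution exists on `[-T, T]` as soon as all solutions on smaller intervals obey a common
bound. -/
theorem LipschitzOnBalls.exists_isSolutionOn {F : X → X} (hF : LipschitzOnBalls F)
    {T : ℝ} (hT : 0 < T) {x₀ : X} {R : ℝ}
    (hR : ∀ τ : ℝ, 0 < τ → τ ≤ T → ∀ y : ℝ → X, IsSolutionOn F x₀ τ y →
      ∀ t ∈ Set.Icc (-τ) τ, ‖y t‖ ≤ R) :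
    ∃ y : ℝ → X, IsSolutionOn F x₀ T y := by
  -- The gap between the a priori bound `M` and the clipping radius `M + 1` drives the continuation
  -- argument. Including `‖x₀‖` covers the degenerate interval `τ = 0`, about which `hR` says
  -- nothing.
  set M := max R ‖x₀‖
  have hM : 0 ≤ M := (norm_nonneg x₀).trans (le_max_right _ _)
  have hM1 : 0 < M + 1 := by linarith
  obtain ⟨y, hy⟩ := hF.exists_isSolutionOn_radialClip hM1 hT x₀
  refine ⟨y, hy.of_radialClip hM1 fun t ht => ?_⟩
  have hcy : ContinuousOn (fun t => max ‖y t‖ ‖y (-t)‖) (Set.Icc 0 T) := by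
    refine ContinuousOn.sup (hy.continuousOn.mono ?_).norm
      (hy.continuousOn.comp continuousOn_neg ?_).norm
    · exact Set.Icc_subset_Icc_left (by linarith)
    · exact fun x hx => ⟨by linarith [hx.2], by linarith [hx.1]⟩
  -- The times up to which the clipped solution obeys the bound `M` in both directions. By `hsmall`,
  -- the weaker bound `M + 1` on `[-τ, τ]` already puts `τ` in `S`: the clipping is then inactive
  -- and the a priori bound applies.
  set S : Set ℝ := {τ | ∀ t ∈ Set.Icc 0 τ, max ‖y t‖ ‖y (-t)‖ ≤ M}
  have hsmall : ∀ τ ∈ Set.Icc 0 T, (∀ t ∈ Set.Icc 0 τ, max ‖y t‖ ‖y (-t)‖ ≤ M + 1) → τ ∈ S := by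
    intro τ hτ hbd
    have habs : ∀ t ∈ Set.Icc (-τ) τ, ‖y t‖ ≤ M + 1 := by
      intro t ht
      rcases le_total 0 t with h0 | h0
      · exact (le_max_left _ _).trans (hbd t ⟨h0, ht.2⟩)
      · have := (le_max_right _ _).trans (hbd (-t) ⟨by linarith, by linarith [ht.1]⟩)
        simpa using this
    rcases hτ.1.eq_or_lt with h0 | h0
    · intro t ht
      have : t = 0 := le_antisymm (h0 ▸ ht.2) ht.1
      subst this
      simp [hy.initial, M]
    · have hsol := (hy.mono hτ.2).of_radialClip hM1 habs
      have hb := hR τ h0 hτ.2 y hsol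
      intro t ht
      exact max_le ((hb t ⟨by linarith [ht.1], ht.2⟩).trans (le_max_left _ _))
        ((hb (-t) ⟨by linarith [ht.2], by linarith [ht.1]⟩).trans (le_max_left _ _))
  have hsub : Set.Icc 0 T ⊆ S := by
    have hclosed : IsClosed (S ∩ Set.Icc 0 T) := by
      have hC : IsClosed {t ∈ Set.Icc (0 : ℝ) T | max ‖y t‖ ‖y (-t)‖ ≤ M} :=
        hcy.preimage_isClosed_of_isClosed isClosed_Icc isClosed_Iic
      refine isClosed_of_closure_subset fun τ hτ => ?_
      have hτI : τ ∈ Set.Icc 0 T :=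
        closure_minimal Set.inter_subset_right isClosed_Icc hτ
      refine ⟨fun t ht => ?_, hτI⟩
      have hlt : ∀ t ∈ Set.Ico 0 τ, t ∈ {t ∈ Set.Icc (0 : ℝ) T | max ‖y t‖ ‖y (-t)‖ ≤ M} := by
        intro t ht
        obtain ⟨σ, hσt, hσ⟩ := mem_closure_iff.1 hτ (Set.Ioi t) isOpen_Ioi ht.2
        exact ⟨⟨ht.1, ht.2.le.trans hτI.2⟩, hσ.1 t ⟨ht.1, le_of_lt hσt⟩⟩
      rcases hτI.1.eq_or_lt with h0 | h0
      · have : t = 0 := le_antisymm (h0 ▸ ht.2) ht.1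
        subst this
        simp [hy.initial, M]
      · have h := closure_minimal hlt hC
        rw [closure_Ico h0.ne] at h
        exact (h ht).2
    -- Connectedness of `[0, T]`: the set contains `0`, is closed, and can be continued to the right
    -- of each of its points, since by continuity the norm stays below `M + 1` a little longer.
    refine hclosed.Icc_subset_of_forall_mem_nhdsWithin
      (hsmall 0 ⟨le_rfl, hT.le⟩ fun t ht => ?_) fun τ hτ => ?_
    · have : t = 0 := le_antisymm ht.2 ht.1
      subst this
      simp only [neg_zero, max_self, hy.initial]
      linarith [le_max_right R ‖x₀‖]
    · have hlt : max ‖y τ‖ ‖y (-τ)‖ < M + 1 := by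
        linarith [hτ.1 τ ⟨hτ.2.1, le_rfl⟩]
      have hnear : ∀ᶠ σ in 𝓝[Set.Icc 0 T] τ, max ‖y σ‖ ‖y (-σ)‖ < M + 1 :=
        (hcy τ ⟨hτ.2.1, hτ.2.2.le⟩).eventually (gt_mem_nhds hlt)
      obtain ⟨δ, hδ, hball⟩ := Metric.mem_nhdsWithin_iff.1 hnear
      have hev : ∀ᶠ σ in 𝓝[>] τ, σ ∈ Set.Ioo τ (min T (τ + δ)) :=
        Ioo_mem_nhdsGT (lt_min hτ.2.2 (by linarith))
      filter_upwards [hev] with σ hσ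
      have hσT : σ < T := hσ.2.trans_le (min_le_left _ _)
      have hσδ : σ < τ + δ := hσ.2.trans_le (min_le_right _ _)
      refine hsmall σ ⟨hτ.2.1.trans hσ.1.le, hσT.le⟩ fun t ht => ?_
      rcases le_total t τ with h | h
      · exact (hτ.1 t ⟨ht.1, h⟩).trans (by linarith)
      · refine le_of_lt (hball ⟨?_, ht.1, ht.2.trans hσT.le⟩)
        rw [Metric.mem_ball, Real.dist_eq, abs_of_nonneg (by linarith)]
        linarith [ht.2]
  have hfin : max ‖y |t|‖ ‖y (-|t|)‖ ≤ M :=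
    hsub ⟨abs_nonneg t, abs_le.2 ht⟩ |t| ⟨abs_nonneg t, le_rfl⟩
  rcases abs_choice t with h | h
  · rw [h] at hfin
    linarith [le_max_left ‖y t‖ ‖y (-t)‖]
  · rw [h, neg_neg] at hfin
    linarith [le_max_right ‖y (-t)‖ ‖y t‖]

theorem LipschitzOnBalls.isGloballyWellPosed {F : X → X} (hF : LipschitzOnBalls F)
    (h : ∀ T : ℝ, 0 < T → ∀ x₀ : X, ∃ y, IsSolutionOn F x₀ T y) : IsGloballyWellPosed F where
  continuous := hF.continuous
  exists_solution := h
  unique_solution _ _ _ _ _ := hF.eqOn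
  continuous_dependence _ hT _ _ hψ _ := hF.continuous_dependence hT hψ

end AbstractODE

/-! ### Global solutions and transport along isometries -/

section Gluing

variable {X : Type*} [NormedAddCommGroup X] [NormedSpace ℝ X]

theorem IsGlobalSolution.isSolutionOn {F : X → X} {x₀ : X} {η : C(ℝ, X)}
    (h : IsGlobalSolution F x₀ η) (T : ℝ) : IsSolutionOn F x₀ T η :=
  .mk_of_hasDeriv h.initial fun t _ => (h.hasDeriv t).hasDerivWithinAt

/-- Solutions on all the intervals `[-T, T]` glue to a unique solution on the whole line. -/
theorem IsGloballyWellPosed.existsUnique_isGlobalSolution {F : X → X}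
    (hF : IsGloballyWellPosed F) (x₀ : X) : ∃! η : C(ℝ, X), IsGlobalSolution F x₀ η := by
  choose y hy using fun n : ℕ => hF.exists_solution (n + 1) (by positivity) x₀
  have hagree : ∀ n m : ℕ, n ≤ m → Set.EqOn (y n) (y m) (Set.Icc (-(n + 1 : ℝ)) (n + 1)) :=
    fun n m hnm => hF.unique_solution _ (by positivity) x₀ _ _ (hy n)
      ((hy m).mono (by gcongr))
  -- Since `y n` lives on `[-(n + 1), n + 1]`, the index `⌈|t|⌉₊` places `t` in the interior of the
  -- interval, so the one-sided derivatives at endpoints never matter.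
  set z : ℝ → X := fun t => y ⌈|t|⌉₊ t
  have hz : ∀ n : ℕ, ∀ t ∈ Set.Icc (-(n + 1 : ℝ)) (n + 1), z t = y n t := by
    intro n t ht
    have h1 : t ∈ Set.Icc (-((⌈|t|⌉₊ : ℝ) + 1)) ((⌈|t|⌉₊ : ℝ) + 1) :=
      abs_le.1 ((Nat.le_ceil |t|).trans (by linarith))
    rcases le_total ⌈|t|⌉₊ n with h | h
    · exact hagree _ _ h h1
    · exact (hagree _ _ h ht).symm
  have hd : ∀ t, HasDerivAt z (F (z t)) t := by
    intro t
    set n := ⌈|t|⌉₊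
    have h1 : t ∈ Set.Ioo (-(n + 1 : ℝ)) (n + 1) :=
      abs_lt.1 ((Nat.le_ceil |t|).trans_lt (lt_add_one _))
    have h2 : Set.Icc (-(n + 1 : ℝ)) (n + 1) ∈ 𝓝 t := Icc_mem_nhds h1.1 h1.2
    have h3 := ((hy n).hasDeriv t (Set.Ioo_subset_Icc_self h1)).hasDerivAt h2
    rw [← hz n t (Set.Ioo_subset_Icc_self h1)] at h3
    refine h3.congr_of_eventuallyEq ?_
    filter_upwards [h2] with s hs using hz n s hs
  refine ⟨⟨z, continuous_iff_continuousAt.2 fun t => (hd t).continuousAt⟩, ⟨?_, hd⟩, ?_⟩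
  · exact (hz 0 0 (by simp)).trans (hy 0).initial
  · intro η hη
    ext t
    have h1 : t ∈ Set.Icc (-(|t| + 1)) (|t| + 1) := abs_le.1 (by linarith)
    refine hF.unique_solution (|t| + 1) (by positivity) x₀ _ _ (hη.isSolutionOn _)
      (.mk_of_hasDeriv ?_ fun s _ => (hd s).hasDerivWithinAt) h1
    exact (hz 0 0 (by simp)).trans (hy 0).initial

/-- This brings the result from the frequency side back to the Sobolev spaces: solutions correspond
under `e`, and distances are unchanged. -/
theorem IsGloballyWellPosed.of_linearIsometryEquiv {Y : Type*} [NormedAddCommGroup Y]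
    [NormedSpace ℝ Y] {G : Y → Y} (hG : IsGloballyWellPosed G) (e : X ≃ₗᵢ[ℝ] Y) :
    IsGloballyWellPosed (fun x => e.symm (G (e x))) := by
  have toG {x₀ : X} {T : ℝ} {y : ℝ → X}
      (h : IsSolutionOn (fun x => e.symm (G (e x))) x₀ T y) :
      IsSolutionOn G (e x₀) T (fun t => e (y t)) :=
    h.map e.toContinuousLinearEquiv.toContinuousLinearMap fun x => e.apply_symm_apply _
  have ofG {x₀ : Y} {T : ℝ} {y : ℝ → Y} (h : IsSolutionOn G x₀ T y) :
      IsSolutionOn (fun x => e.symm (G (e x))) (e.symm x₀) T (fun t => e.symm (y t)) :=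
    h.map e.symm.toContinuousLinearEquiv.toContinuousLinearMap fun x => by simp
  refine ⟨?_, fun T hT x₀ => ?_, fun T hT x₀ y₁ y₂ h₁ h₂ t ht => ?_,
    fun T hT ψ ψ' hψ η' hη' => ?_⟩
  · exact e.symm.continuous.comp (hG.continuous.comp e.continuous)
  · obtain ⟨y, hy⟩ := hG.exists_solution T hT (e x₀)
    exact ⟨_, by simpa using ofG hy⟩
  · exact e.injective (hG.unique_solution T hT _ _ _ (toG h₁) (toG h₂) ht)
  · obtain ⟨η, hη, hlim⟩ := hG.continuous_dependence T hT (fun n => e (ψ n)) (e ψ')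
      ((e.continuous.tendsto _).comp hψ) _ (toG hη')
    refine ⟨fun n t => e.symm (η n t), ?_, ?_⟩
    · filter_upwards [hη] with n hn
      simpa using ofG hn
    · rw [Metric.tendstoUniformlyOn_iff] at hlim ⊢
      intro ε hε
      filter_upwards [hlim ε hε] with n hn t ht
      have := hn t ht
      rw [← e.symm.dist_map] at this
      simpa using this

end Gluing

/-! ### Quadratic vector fields -/

section Quadratic

/-- The vector field `x ↦ A x + B (x, x)`. -/
noncomputable def quadraticField {X : Type*} [NormedAddCommGroup X] [NormedSpace ℝ X] (A : X →L[ℝ] X)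
    (B : X →L[ℝ] X →L[ℝ] X) (x : X) : X := A x + B x x

variable {X₀ X₁ X : Type*} [NormedAddCommGroup X₀] [NormedSpace ℝ X₀]
  [NormedAddCommGroup X₁] [InnerProductSpace ℝ X₁] [NormedAddCommGroup X] [NormedSpace ℝ X]

theorem lipschitzOnBalls_quadraticField (A : X →L[ℝ] X) (B : X →L[ℝ] X →L[ℝ] X) :
    LipschitzOnBalls (quadraticField A B) := by
  intro R
  refine ⟨(‖A‖ + 2 * ‖B‖ * |R|).toNNReal, LipschitzOnWith.of_dist_le_mul fun x hx y hy => ?_⟩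
  rw [mem_closedBall_zero_iff] at hx hy
  have hx' := hx.trans (le_abs_self R)
  have hy' := hy.trans (le_abs_self R)
  rw [Real.coe_toNNReal _ (by positivity), dist_eq_norm, dist_eq_norm]
  have h1 : quadraticField A B x - quadraticField A B y
      = A (x - y) + B x (x - y) + B (x - y) y := by
    simp only [quadraticField, map_sub, sub_apply]
    abel
  rw [h1]
  have h2 := A.le_opNorm (x - y)
  have h3 : ‖B x (x - y)‖ ≤ ‖B‖ * |R| * ‖x - y‖ := (B.le_opNorm₂ _ _).trans (by gcongr)
  have h4 : ‖B (x - y) y‖ ≤ ‖B‖ * ‖x - y‖ * |R| := (B.le_opNorm₂ _ _).trans (by gcongr)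
  have := norm_add₃_le (a := A (x - y)) (b := B x (x - y)) (c := B (x - y) y)
  linarith

/-- Small data have a solution on `[-T, T]` in the unit ball. -/
theorem exists_isSolutionOn_of_small [CompleteSpace X] (A : X →L[ℝ] X) (B : X →L[ℝ] X →L[ℝ] X)
    {T : ℝ} (hT : 0 < T) {x₀ : X} (hx₀ : ‖x₀‖ * Real.exp ((‖A‖ + ‖B‖) * T) ≤ 1) :
    ∃ y, IsSolutionOn (quadraticField A B) x₀ T y ∧ ∀ t ∈ Set.Icc (-T) T, ‖y t‖ ≤ 1 := by
  obtain ⟨y, hy⟩ :=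
    (lipschitzOnBalls_quadraticField A B).exists_isSolutionOn_radialClip one_pos hT x₀
  have hb : ∀ t ∈ Set.Icc (-T) T, ‖y t‖ ≤ 1 := by
    intro t ht
    -- The clipped argument `p` has norm at most `1`, so `‖B p p‖ ≤ ‖B‖ ‖p‖` and the growth is at
    -- most linear with rate `‖A‖ + ‖B‖`. The smallness of `x₀` then keeps the solution in the unit
    -- ball, where the clipping is inactive.
    refine (norm_le_exp_of_norm_deriv_le (K := ‖A‖ + ‖B‖) (by positivity) hy.hasDeriv
      (fun t _ => ?_) t ht).trans (by rwa [hy.initial])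
    set p := radialClip 1 (y t)
    have hp1 : ‖p‖ ≤ 1 := norm_radialClip_le one_pos _
    have hp : ‖p‖ ≤ ‖y t‖ := norm_radialClip_le_norm one_pos _
    have h1 := A.le_opNorm p
    have h2 : ‖B p p‖ ≤ ‖B‖ * 1 * ‖p‖ := (B.le_opNorm₂ _ _).trans (by gcongr)
    calc ‖A p + B p p‖ ≤ ‖A p‖ + ‖B p p‖ := norm_add_le _ _
      _ ≤ (‖A‖ + ‖B‖) * ‖p‖ := by linarith
      _ ≤ (‖A‖ + ‖B‖) * ‖y t‖ := by gcongr
  exact ⟨y, hy.of_radialClip one_pos hb, hb⟩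

/-- Global existence for a quadratic vector field on `X₀`, given a dense subspace `X₁` on which the
field conserves the norm: the initial value is split into a small part and a part in `X₁`. -/
theorem exists_isSolutionOn_of_dense_conservative [CompleteSpace X₀] [CompleteSpace X₁]
    (A₀ : X₀ →L[ℝ] X₀) (B₀ : X₀ →L[ℝ] X₀ →L[ℝ] X₀) (hB₀ : ∀ x y, B₀ x y = B₀ y x)
    (A₁ : X₁ →L[ℝ] X₁) (B₁ : X₀ →L[ℝ] X₁ →L[ℝ] X₁) (J : X₁ →L[ℝ] X₀) (hJ : DenseRange J)
    (hJA : ∀ x, J (A₁ x) = A₀ (J x)) (hJB : ∀ x y, J (B₁ x y) = B₀ x (J y))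
    (hA₁ : ∀ x, inner ℝ x (A₁ x) = 0) (hB₁ : ∀ x, inner ℝ x (B₁ (J x) x) = 0)
    {T : ℝ} (hT : 0 < T) (x₀ : X₀) : ∃ y, IsSolutionOn (quadraticField A₀ B₀) x₀ T y := by
  -- Density of the energy space makes the remainder `x₀ - J w₀` as small as the previous lemma
  -- demands for the given `T`.
  obtain ⟨w₀, hw₀⟩ : ∃ w₀ : X₁, ‖x₀ - J w₀‖ * Real.exp ((‖A₀‖ + ‖B₀‖) * T) ≤ 1 := by
    obtain ⟨w₀, hw₀⟩ := hJ.exists_dist_lt x₀ (Real.exp_pos (-((‖A₀‖ + ‖B₀‖) * T)))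
    refine ⟨w₀, ?_⟩
    rw [dist_eq_norm, Real.exp_neg] at hw₀
    exact (le_div_iff₀ (Real.exp_pos _)).1 (by rw [one_div]; exact hw₀.le)
  obtain ⟨v, hv, hv1⟩ := exists_isSolutionOn_of_small A₀ B₀ hT hw₀
  set P₀ := ContinuousLinearMap.fst ℝ X₀ X₁
  set P₁ := ContinuousLinearMap.snd ℝ X₀ X₁
  -- The system for `(v, w)`: `v' = A₀ v + B₀(v, v)` and `w' = A₁ w + B₁(2v + J w, w)`. Posed on the
  -- product, it is again an autonomous quadratic equation, so the continuation criterion applies to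
  -- it.
  set A : X₀ × X₁ →L[ℝ] X₀ × X₁ := (A₀.comp P₀).prod (A₁.comp P₁)
  set B : X₀ × X₁ →L[ℝ] X₀ × X₁ →L[ℝ] X₀ × X₁ :=
    (ContinuousLinearMap.compL ℝ (X₀ × X₁) X₀ (X₀ × X₁) (ContinuousLinearMap.inl ℝ X₀ X₁)).comp
      (B₀.bilinearComp P₀ P₀) +
    (ContinuousLinearMap.compL ℝ (X₀ × X₁) X₁ (X₀ × X₁) (ContinuousLinearMap.inr ℝ X₀ X₁)).comp
      (B₁.bilinearComp ((2 : ℝ) • P₀ + J.comp P₁) P₁)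
  have hfield : ∀ z : X₀ × X₁, quadraticField A B z =
      (A₀ z.1 + B₀ z.1 z.1, A₁ z.2 + (2 • B₁ z.1 z.2 + B₁ (J z.2) z.2)) := by
    intro z
    simp [quadraticField, A, B, P₀, P₁, two_smul]
  have hLip := lipschitzOnBalls_quadraticField A B
  set C := 4 * ‖B₁‖
  obtain ⟨z, hz⟩ := hLip.exists_isSolutionOn hT (x₀ := (x₀ - J w₀, w₀))
    (R := max 1 (√(‖w₀‖ ^ 2 * Real.exp (C * T)))) fun τ hτ hτT z hz t ht => by
      have hz1 : IsSolutionOn (quadraticField A₀ B₀) (x₀ - J w₀) τ (fun t => (z t).1) :=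
        hz.map P₀ fun z => by rw [hfield]; rfl
      have hzv : ∀ t ∈ Set.Icc (-τ) τ, ‖(z t).1‖ ≤ 1 := fun t ht => by
        have h := (lipschitzOnBalls_quadraticField A₀ B₀).eqOn hz1 (hv.mono hτT) ht
        simp only at h
        rw [h]
        exact hv1 t ⟨by linarith [ht.1], ht.2.trans hτT⟩
      have hd : ∀ t ∈ Set.Icc (-τ) τ, HasDerivWithinAt (fun t => ‖(z t).2‖ ^ 2)
          (2 * inner ℝ (z t).2 (quadraticField A B (z t)).2) (Set.Icc (-τ) τ) t := fun t ht =>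
        (P₁.hasFDerivAt.comp_hasDerivWithinAt t (hz.hasDeriv t ht)).norm_sq
      -- In the derivative of `‖w‖²` the terms `⟨w, A₁ w⟩` and `⟨w, B₁(J w, w)⟩` vanish. The cross
      -- term leaves `4 ⟨w, B₁(v, w)⟩`, at most `4 ‖B₁‖ ‖w‖²` because `‖v‖ ≤ 1`; hence the value of
      -- `C`.
      have hg := norm_le_exp_of_norm_deriv_le (K := C) (by positivity) hd (fun t ht => by
        rw [hfield, inner_add_right, inner_add_right, hA₁, hB₁, two_smul, inner_add_right]
        have h1 := abs_real_inner_le_norm (z t).2 (B₁ (z t).1 (z t).2)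
        have h2 : ‖B₁ (z t).1 (z t).2‖ ≤ ‖B₁‖ * 1 * ‖(z t).2‖ :=
          (B₁.le_opNorm₂ _ _).trans (by gcongr; exact hzv t ht)
        have h3 : |inner ℝ (z t).2 (B₁ (z t).1 (z t).2)| ≤ ‖(z t).2‖ * (‖B₁‖ * 1 * ‖(z t).2‖) :=
          h1.trans (by gcongr)
        have h4 : ∀ r : ℝ, ‖2 * (0 + (r + r + 0))‖ = 4 * |r| := fun r => by
          rw [show 2 * (0 + (r + r + 0)) = 4 * r by ring, norm_mul]
          simp
        rw [h4, Real.norm_of_nonneg (by positivity)]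
        simp only [C]
        nlinarith [h3]) t ht
      rw [Real.norm_of_nonneg (by positivity), Real.norm_of_nonneg (by positivity),
        hz.initial] at hg
      refine max_le_max (hzv t ht) (Real.le_sqrt_of_sq_le (hg.trans ?_))
      gcongr
  refine ⟨fun t => (z t).1 + J (z t).2, ?_⟩
  -- The sum `v + J w` solves the original equation: the symmetry of `B₀` merges its two mixed terms
  -- into `2 B₀(v, J w)`.
  have h := hz.map (P₀ + J.comp P₁) (G := quadraticField A₀ B₀) fun z => by
    rw [hfield]
    simp only [P₀, P₁, add_apply, ContinuousLinearMap.comp_apply, ContinuousLinearMap.coe_fst',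
      ContinuousLinearMap.coe_snd', quadraticField, map_add, hJA, hJB, two_smul,
      hB₀ (J z.2) z.1]
    abel
  simpa [P₀, P₁] using h

/-- Persistence of regularity: if the quadratic term on `X` is controlled linearly by the norm of
`X` and by the norm of the image in `X₀`, then global existence in `X₀` implies global
well-posedness in `X`. -/
theorem isGloballyWellPosed_of_tame [CompleteSpace X] (A₀ : X₀ →L[ℝ] X₀)
    (B₀ : X₀ →L[ℝ] X₀ →L[ℝ] X₀)
    (h₀ : ∀ T : ℝ, 0 < T → ∀ x₀, ∃ y, IsSolutionOn (quadraticField A₀ B₀) x₀ T y)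
    (A : X →L[ℝ] X) (B : X →L[ℝ] X →L[ℝ] X) (J : X →L[ℝ] X₀)
    (hJA : ∀ x, J (A x) = A₀ (J x)) (hJB : ∀ x, J (B x x) = B₀ (J x) (J x))
    (C : ℝ) (hC : ∀ x, ‖B x x‖ ≤ C * ‖J x‖ * ‖x‖) :
    IsGloballyWellPosed (quadraticField A B) := by
  have hC' : ∀ x, ‖B x x‖ ≤ |C| * ‖J x‖ * ‖x‖ := fun x =>
    (hC x).trans (by gcongr; exact le_abs_self C)
  refine (lipschitzOnBalls_quadraticField A B).isGloballyWellPosed fun T hT x₀ => ?_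
  obtain ⟨u, hu⟩ := h₀ T hT (J x₀)
  obtain ⟨M, hM, hb⟩ := hu.exists_bound
  refine (lipschitzOnBalls_quadraticField A B).exists_isSolutionOn hT
    (R := ‖x₀‖ * Real.exp ((‖A‖ + |C| * M) * T)) fun τ hτ hτT y hy t ht => ?_
  -- By uniqueness in `X₀` the image `J y` is the solution `u`, which is already bounded by `M` on
  -- `[-T, T]`. The quadratic term then acts as a linear one of size `|C| M`.
  have hJy := hy.map J (G := quadraticField A₀ B₀) fun x => by
    simp only [quadraticField, map_add, hJA, hJB]
  have hJb : ∀ t ∈ Set.Icc (-τ) τ, ‖J (y t)‖ ≤ M := fun t ht => by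
    have h := (lipschitzOnBalls_quadraticField A₀ B₀).eqOn hJy (hu.mono hτT) ht
    simp only at h
    rw [h]
    exact hb t ⟨by linarith [ht.1], ht.2.trans hτT⟩
  have hg := norm_le_exp_of_norm_deriv_le (K := ‖A‖ + |C| * M) (by positivity) hy.hasDeriv
    (fun t ht => by
      have h1 := A.le_opNorm (y t)
      have h2 : ‖B (y t) (y t)‖ ≤ |C| * M * ‖y t‖ :=
        (hC' _).trans (by gcongr; exact hJb t ht)
      exact (norm_add_le _ _).trans (by linarith)) t ht
  rw [hy.initial] at hg
  exact hg.trans (by gcongr)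

end Quadratic

/-! ### Hermitian square integrable functions on the frequency group -/

section Hermitian

variable {G : Type*} [AddCommGroup G] [MeasurableSpace G]

open ComplexConjugate

/-- A bounded measurable multiplier that preserves Hermitian functions. -/
structure IsHermitianMultiplier (a : G → ℂ) (C : ℝ) : Prop where
  measurable : Measurable a
  neg_eq : ∀ x, a (-x) = conj (a x)
  bound : ∀ x, ‖a x‖ ≤ C

namespace IsHermitianMultiplier

variable {a : G → ℂ} {C : ℝ}

theorem memLp {μ : Measure G} (ha : IsHermitianMultiplier a C) (f : Lp ℂ 2 μ) :
    MemLp (fun x => a x * f x) 2 μ :=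
  (Lp.memLp f).of_le_mul (c := C)
    (ha.measurable.aestronglyMeasurable.mul (Lp.aestronglyMeasurable f))
    (ae_of_all _ fun x => by rw [norm_mul]; gcongr; exact ha.bound x)

end IsHermitianMultiplier

variable [MeasurableNeg G]

/-- The real subspace of `L²` of the functions with `f (-x) = conj (f x)`. -/
noncomputable def hermitianL2 (μ : Measure G) [μ.IsNegInvariant] : Submodule ℝ (Lp ℂ 2 μ) :=
  LinearMap.eqLocus
    (Lp.compMeasurePreservingₗ ℝ (Neg.neg : G → G) (Measure.measurePreserving_neg μ))
    ((Complex.conjCLE : ℂ →L[ℝ] ℂ).compLpₗ 2 μ)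

variable {μ : Measure G} [μ.IsNegInvariant]

theorem mem_hermitianL2_iff {f : Lp ℂ 2 μ} :
    f ∈ hermitianL2 μ ↔ ∀ᵐ x ∂μ, f (-x) = conj (f x) := by
  have h1 := Lp.coeFn_compMeasurePreserving f (Measure.measurePreserving_neg μ)
  have h2 := (Complex.conjCLE : ℂ →L[ℝ] ℂ).coeFn_compLp f
  change Lp.compMeasurePreserving (Neg.neg : G → G) (Measure.measurePreserving_neg μ) f =
    (Complex.conjCLE : ℂ →L[ℝ] ℂ).compLp f ↔ _
  rw [Lp.ext_iff]
  constructor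
  · intro h
    filter_upwards [h, h1, h2] with x hx hx1 hx2
    simpa using hx1.symm.trans (hx.trans hx2)
  · intro h
    filter_upwards [h, h1, h2] with x hx hx1 hx2
    exact hx1.trans ((by simpa using hx : (f ∘ Neg.neg) x = _).trans hx2.symm)

theorem ae_neg_eq_conj (f : hermitianL2 μ) :
    ∀ᵐ x ∂μ, (f : Lp ℂ 2 μ) (-x) = conj ((f : Lp ℂ 2 μ) x) := mem_hermitianL2_iff.1 f.2

instance : CompleteSpace (hermitianL2 μ) := by
  refine IsClosed.completeSpace_coe (hs := ?_)
  exact isClosed_eq (Lp.compMeasurePreservingₗᵢ ℝ (Neg.neg : G → G)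
    (Measure.measurePreserving_neg μ)).continuous
    ((Complex.conjCLE : ℂ →L[ℝ] ℂ).compLpL 2 μ).continuous

namespace IsHermitianMultiplier

variable {a : G → ℂ} {C : ℝ}

/-- The multiplication operator on Hermitian functions. -/
noncomputable def toCLM (μ : Measure G) [μ.IsNegInvariant] (ha : IsHermitianMultiplier a C) :
    hermitianL2 μ →L[ℝ] hermitianL2 μ :=
  LinearMap.mkContinuous
    { toFun := fun f => ⟨(ha.memLp (f : Lp ℂ 2 μ)).toLp _, by
        rw [mem_hermitianL2_iff]
        have h := (ha.memLp (f : Lp ℂ 2 μ)).coeFn_toLp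
        filter_upwards [h, (Measure.measurePreserving_neg μ).quasiMeasurePreserving.ae h,
          ae_neg_eq_conj f] with x h1 h2 h3
        rw [h1, h2, h3, ha.neg_eq, map_mul]⟩
      map_add' := fun f g => by
        refine Subtype.ext (Lp.ext ?_)
        filter_upwards [(ha.memLp (f : Lp ℂ 2 μ)).coeFn_toLp, (ha.memLp (g : Lp ℂ 2 μ)).coeFn_toLp,
          (ha.memLp ((f + g : hermitianL2 μ) : Lp ℂ 2 μ)).coeFn_toLp,
          Lp.coeFn_add (f : Lp ℂ 2 μ) g,
          Lp.coeFn_add ((ha.memLp (f : Lp ℂ 2 μ)).toLp _) ((ha.memLp (g : Lp ℂ 2 μ)).toLp _)]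
          with x h1 h2 h3 h4 h5
        rw [h3]
        refine Eq.trans ?_ h5.symm
        rw [Pi.add_apply, h1, h2, Submodule.coe_add, h4, Pi.add_apply, mul_add]
      map_smul' := fun c f => by
        refine Subtype.ext (Lp.ext ?_)
        filter_upwards [(ha.memLp (f : Lp ℂ 2 μ)).coeFn_toLp,
          (ha.memLp ((c • f : hermitianL2 μ) : Lp ℂ 2 μ)).coeFn_toLp,
          Lp.coeFn_smul c (f : Lp ℂ 2 μ),
          Lp.coeFn_smul c ((ha.memLp (f : Lp ℂ 2 μ)).toLp _)]
          with x h1 h3 h4 h5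
        rw [h3]
        refine Eq.trans ?_ h5.symm
        rw [Pi.smul_apply, h1, Submodule.coe_smul, h4, Pi.smul_apply, mul_smul_comm] } C
    fun f => by
      refine Lp.norm_le_mul_norm_of_ae_le_mul ?_
      filter_upwards [(ha.memLp (f : Lp ℂ 2 μ)).coeFn_toLp] with x h1
      refine (congrArg norm h1).trans_le ?_
      rw [norm_mul]
      exact mul_le_mul_of_nonneg_right (ha.bound x) (norm_nonneg _)

theorem coeFn_toCLM (ha : IsHermitianMultiplier a C) (f : hermitianL2 μ) :
    (ha.toCLM μ f : Lp ℂ 2 μ) =ᵐ[μ] fun x => a x * (f : Lp ℂ 2 μ) x :=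
  (ha.memLp (f : Lp ℂ 2 μ)).coeFn_toLp

end IsHermitianMultiplier

end Hermitian

/-! ### Cauchy–Schwarz and Young inequalities for nonnegative functions -/

section SquareIntegral

theorem enorm_toLp_sq {α : Type*} [MeasurableSpace α] {μ : Measure α} (f : α → ℂ) :
    eLpNorm f 2 μ ^ 2 = ∫⁻ x, ‖f x‖ₑ ^ 2 ∂μ := by
  have h := eLpNorm_nnreal_pow_eq_lintegral (μ := μ) (f := f) (p := 2) two_ne_zero
  simpa using h

theorem enorm_sq_eq_lintegral {α : Type*} [MeasurableSpace α] {μ : Measure α} (f : Lp ℂ 2 μ) :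
    ‖f‖ₑ ^ 2 = ∫⁻ x, ‖f x‖ₑ ^ 2 ∂μ := by
  rw [Lp.enorm_def, enorm_toLp_sq]

theorem sq_lintegral_mul_le {α : Type*} [MeasurableSpace α] {μ : Measure α} {F H : α → ℝ≥0∞}
    (hF : AEMeasurable F μ) (hH : AEMeasurable H μ) :
    (∫⁻ x, F x * H x ∂μ) ^ 2 ≤ (∫⁻ x, F x ^ 2 ∂μ) * ∫⁻ x, H x ^ 2 ∂μ := by
  have h := ENNReal.lintegral_mul_le_Lp_mul_Lq μ Real.HolderConjugate.two_two hF hH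
  have h2 : ∀ a : ℝ≥0∞, (a ^ (1 / (2 : ℝ))) ^ 2 = a := fun a => by
    rw [← ENNReal.rpow_natCast, ← ENNReal.rpow_mul]
    norm_num
  calc (∫⁻ x, F x * H x ∂μ) ^ 2 ≤ _ := pow_le_pow_left' h 2
    _ = _ := by simp only [mul_pow, h2, ENNReal.rpow_two]

variable {G : Type*} [AddCommGroup G] [MeasurableSpace G] [MeasurableAdd₂ G] [MeasurableNeg G]
  {μ : Measure G} [μ.IsAddLeftInvariant] [μ.IsNegInvariant]

/-- Cauchy–Schwarz and invariance of the measure under `y ↦ x - y`; the bound is uniform in `x`,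
which is what the square integrable phase `φ` needs. -/
theorem sq_lintegral_mul_sub_le {F H : G → ℝ≥0∞} (hF : Measurable F) (hH : Measurable H) (x : G) :
    (∫⁻ y, F y * H (x - y) ∂μ) ^ 2 ≤ (∫⁻ y, F y ^ 2 ∂μ) * ∫⁻ y, H y ^ 2 ∂μ := by
  refine (sq_lintegral_mul_le hF.aemeasurable
    (hH.comp (measurable_const_sub x)).aemeasurable).trans_eq ?_
  congr 1
  exact lintegral_sub_left_eq_self (fun y => H y ^ 2) x

variable [SFinite μ]

/-- Young's inequality `‖F ∗ H‖₂ ≤ ‖F‖₂ ‖H‖₁`. -/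
theorem lintegral_sq_convolution_le {F H : G → ℝ≥0∞} (hF : Measurable F) (hH : Measurable H) :
    ∫⁻ x, (∫⁻ y, F y * H (x - y) ∂μ) ^ 2 ∂μ ≤ (∫⁻ y, F y ^ 2 ∂μ) * (∫⁻ y, H y ∂μ) ^ 2 := by
  have hsub : Measurable fun p : G × G => p.1 - p.2 := measurable_fst.sub measurable_snd
  have hsq : ∀ a : ℝ≥0∞, (a ^ (1 / 2 : ℝ)) ^ 2 = a := fun a => by
    rw [← ENNReal.rpow_natCast, ← ENNReal.rpow_mul]
    norm_num
  have h1 : ∀ x, (∫⁻ y, F y * H (x - y) ∂μ) ^ 2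
      ≤ (∫⁻ y, F y ^ 2 * H (x - y) ∂μ) * ∫⁻ y, H y ∂μ := by
    intro x
    -- Writing `H = H^{1/2} H^{1/2}` and applying Cauchy–Schwarz leaves `F² * H`, whose integral
    -- Tonelli evaluates.
    have h := sq_lintegral_mul_le (μ := μ) (F := fun y => F y * H (x - y) ^ (1 / 2 : ℝ))
      (H := fun y => H (x - y) ^ (1 / 2 : ℝ))
      (hF.mul ((hH.comp (measurable_const_sub x)).pow_const _)).aemeasurable
      ((hH.comp (measurable_const_sub x)).pow_const _).aemeasurable
    simp only [mul_pow, hsq, mul_assoc, ← pow_two] at h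
    rwa [lintegral_sub_left_eq_self H x] at h
  calc ∫⁻ x, (∫⁻ y, F y * H (x - y) ∂μ) ^ 2 ∂μ
      ≤ ∫⁻ x, (∫⁻ y, F y ^ 2 * H (x - y) ∂μ) * ∫⁻ y, H y ∂μ ∂μ := lintegral_mono h1
    _ = (∫⁻ x, ∫⁻ y, F y ^ 2 * H (x - y) ∂μ ∂μ) * ∫⁻ y, H y ∂μ := by
        rw [lintegral_mul_const]
        exact Measurable.lintegral_prod_right'
          (f := fun p : G × G => F p.2 ^ 2 * H (p.1 - p.2))
          (((hF.comp measurable_snd).pow_const 2).mul (hH.comp hsub))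
    _ = (∫⁻ y, F y ^ 2 * ∫⁻ x, H x ∂μ ∂μ) * ∫⁻ y, H y ∂μ := by
        rw [lintegral_lintegral_swap
          (((hF.comp measurable_snd).pow_const 2).mul (hH.comp hsub)).aemeasurable]
        congr 1
        refine lintegral_congr fun y => ?_
        rw [lintegral_const_mul _ (by fun_prop),
          lintegral_sub_right_eq_self H y]
    _ = _ := by
        rw [lintegral_mul_const _ (hF.pow_const 2)]
        ring

end SquareIntegral

/-! ### Bilinear operators of convolution type -/

section KernelConv

variable {G : Type*} [AddCommGroup G] [MeasurableSpace G]

open ComplexConjugate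

/-- The convolution with a kernel `∫ K(x, y) f(y) g(x - y) dy`. -/
noncomputable def kernelConv (μ : Measure G) (K : G → G → ℂ) (f g : G → ℂ) (x : G) : ℂ :=
  ∫ y, K x y * (f y * g (x - y)) ∂μ

/-- A kernel for which `kernelConv` is bounded on `L²` and preserves Hermitian functions. -/
structure IsConvKernel (μ : Measure G) (K : G → G → ℂ) (C : NNReal) : Prop where
  measurable : Measurable fun p : G × G => K p.1 p.2
  neg_eq : ∀ x y, K (-x) (-y) = conj (K x y)
  bound : ∀ F H : G → ℝ≥0∞, Measurable F → Measurable H →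
    ∫⁻ x, (∫⁻ y, ‖K x y‖ₑ * (F y * H (x - y)) ∂μ) ^ 2 ∂μ
      ≤ C ^ 2 * ((∫⁻ x, F x ^ 2 ∂μ) * ∫⁻ x, H x ^ 2 ∂μ)

theorem lintegral_enorm_kernelConv_sq_le (μ : Measure G) (K : G → G → ℂ) (f g : G → ℂ) :
    ∫⁻ x, ‖kernelConv μ K f g x‖ₑ ^ 2 ∂μ
      ≤ ∫⁻ x, (∫⁻ y, ‖K x y‖ₑ * (‖f y‖ₑ * ‖g (x - y)‖ₑ) ∂μ) ^ 2 ∂μ := by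
  refine lintegral_mono fun x => ?_
  gcongr
  refine (enorm_integral_le_lintegral_enorm _).trans_eq ?_
  simp only [enorm_mul]

theorem IsConvKernel.lintegral_le {μ : Measure G} {K : G → G → ℂ} {C : NNReal}
    (hK : IsConvKernel μ K C) (f g : Lp ℂ 2 μ) :
    ∫⁻ x, ‖kernelConv μ K f g x‖ₑ ^ 2 ∂μ ≤ (C * ‖f‖ₑ * ‖g‖ₑ) ^ 2 := by
  refine (lintegral_enorm_kernelConv_sq_le μ K f g).trans ((hK.bound _ _
    (Lp.stronglyMeasurable f).measurable.enorm (Lp.stronglyMeasurable g).measurable.enorm).trans_eq ?_)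
  rw [← enorm_sq_eq_lintegral, ← enorm_sq_eq_lintegral]
  ring

variable [MeasurableAdd₂ G] [MeasurableNeg G] {μ : Measure G}

theorem measurable_kernel_integrand {K : G → G → ℂ} (hK : Measurable fun p : G × G => K p.1 p.2)
    {f g : G → ℂ} (hf : Measurable f) (hg : Measurable g) :
    Measurable fun p : G × G => K p.1 p.2 * (f p.2 * g (p.1 - p.2)) :=
  hK.mul ((hf.comp measurable_snd).mul (hg.comp (measurable_fst.sub measurable_snd)))

theorem stronglyMeasurable_kernelConv [SFinite μ] {K : G → G → ℂ}
    (hK : Measurable fun p : G × G => K p.1 p.2) {f g : G → ℂ} (hf : Measurable f)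
    (hg : Measurable g) : StronglyMeasurable (kernelConv μ K f g) :=
  StronglyMeasurable.integral_prod_right
    (f := fun x y => K x y * (f y * g (x - y)))
    (measurable_kernel_integrand hK hf hg).stronglyMeasurable

namespace IsConvKernel

variable [SFinite μ] {K : G → G → ℂ} {C : NNReal}

/-- The kernel bound has absolute values inside, so the square of the inner integral has finite
integral and is finite almost everywhere. Additivity of the operator depends on this. -/
theorem ae_integrable (hK : IsConvKernel μ K C) (f g : Lp ℂ 2 μ) :
    ∀ᵐ x ∂μ, Integrable (fun y => K x y * (f y * g (x - y))) μ := by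
  have hf := (Lp.stronglyMeasurable f).measurable
  have hg := (Lp.stronglyMeasurable g).measurable
  have hm : Measurable fun p : G × G => ‖K p.1 p.2‖ₑ * (‖f p.2‖ₑ * ‖g (p.1 - p.2)‖ₑ) :=
    hK.measurable.enorm.mul ((hf.comp measurable_snd).enorm.mul
      (hg.comp (measurable_fst.sub measurable_snd)).enorm)
  have hfin : ∫⁻ x, (∫⁻ y, ‖K x y‖ₑ * (‖f y‖ₑ * ‖g (x - y)‖ₑ) ∂μ) ^ 2 ∂μ ≠ ∞ := by
    refine ne_top_of_le_ne_top ?_ (hK.bound _ _ hf.enorm hg.enorm)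
    rw [← enorm_sq_eq_lintegral, ← enorm_sq_eq_lintegral]
    finiteness
  filter_upwards [ae_lt_top (hm.lintegral_prod_right'.pow_const 2) hfin] with x hx
  refine ⟨((measurable_kernel_integrand hK.measurable hf hg).comp
    measurable_prodMk_left).aestronglyMeasurable, ?_⟩
  rw [hasFiniteIntegral_iff_enorm]
  simp only [enorm_mul]
  exact by simpa using hx

theorem memLp (hK : IsConvKernel μ K C) (f g : Lp ℂ 2 μ) : MemLp (kernelConv μ K f g) 2 μ := by
  refine ⟨(stronglyMeasurable_kernelConv hK.measurable (Lp.stronglyMeasurable f).measurable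
    (Lp.stronglyMeasurable g).measurable).aestronglyMeasurable, ?_⟩
  have h : eLpNorm (kernelConv μ K f g) 2 μ ^ 2 < ∞ := by
    rw [enorm_toLp_sq]
    exact (hK.lintegral_le f g).trans_lt (by finiteness)
  simpa using h

theorem norm_toLp_le (hK : IsConvKernel μ K C) (f g : Lp ℂ 2 μ) :
    ‖(hK.memLp f g).toLp _‖ ≤ C * ‖f‖ * ‖g‖ := by
  have h : ‖(hK.memLp f g).toLp _‖ₑ ≤ C * ‖f‖ₑ * ‖g‖ₑ := by
    rw [← ENNReal.pow_le_pow_left_iff two_ne_zero, Lp.enorm_toLp, enorm_toLp_sq]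
    exact hK.lintegral_le f g
  have h' := ENNReal.toReal_mono (by finiteness) h
  simpa [ENNReal.toReal_mul] using h'

end IsConvKernel

variable [μ.IsAddLeftInvariant] [μ.IsNegInvariant]

theorem kernelConv_congr (K : G → G → ℂ) {f f' g g' : G → ℂ} (hf : f =ᵐ[μ] f')
    (hg : g =ᵐ[μ] g') : kernelConv μ K f g = kernelConv μ K f' g' := by
  ext x
  refine integral_congr_ae ?_
  filter_upwards [hf, (Measure.measurePreserving_sub_left μ x).quasiMeasurePreserving.ae hg] with y h1 h2
  rw [h1, h2]

/-- Substitute `y ↦ -y`; the kernel and both factors are then conjugated. -/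
theorem kernelConv_neg {K : G → G → ℂ} (hK : ∀ x y, K (-x) (-y) = conj (K x y)) {f g : G → ℂ}
    (hf : ∀ᵐ x ∂μ, f (-x) = conj (f x)) (hg : ∀ᵐ x ∂μ, g (-x) = conj (g x)) (x : G) :
    kernelConv μ K f g (-x) = conj (kernelConv μ K f g x) := by
  rw [kernelConv, kernelConv, ← integral_neg_eq_self, ← integral_conj]
  refine integral_congr_ae ?_
  filter_upwards [hf, (Measure.measurePreserving_sub_left μ x).quasiMeasurePreserving.ae hg] with y h1 h2
  rw [hK, h1, show -x - -y = -(x - y) by abel, h2, map_mul, map_mul]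

namespace IsConvKernel

variable [SFinite μ] {K : G → G → ℂ} {C : NNReal}

/-- The bounded bilinear operator on Hermitian functions given by a kernel. -/
noncomputable def toCLM (hK : IsConvKernel μ K C) :
    hermitianL2 μ →L[ℝ] hermitianL2 μ →L[ℝ] hermitianL2 μ :=
  LinearMap.mkContinuous₂
    (LinearMap.mk₂ ℝ
      (fun f g => (⟨(hK.memLp (f : Lp ℂ 2 μ) (g : Lp ℂ 2 μ)).toLp _, by
        rw [mem_hermitianL2_iff]
        have h := (hK.memLp (f : Lp ℂ 2 μ) (g : Lp ℂ 2 μ)).coeFn_toLp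
        filter_upwards [h, (Measure.measurePreserving_neg μ).quasiMeasurePreserving.ae h]
          with x h1 h2
        rw [h1, h2, kernelConv_neg hK.neg_eq (ae_neg_eq_conj f) (ae_neg_eq_conj g)]⟩ :
          hermitianL2 μ))
      (fun f f' g => by
        refine Subtype.ext (Eq.trans ((MemLp.toLp_eq_toLp_iff (hK.memLp (f + f' : hermitianL2 μ) g)
          ((hK.memLp f g).add (hK.memLp f' g))).2 ?_)
          (MemLp.toLp_add (hK.memLp f g) (hK.memLp f' g)))
        -- Splitting the integral requires both parts to be integrable, which holds for almost every
        -- `x` only; homogeneity holds for every `x`.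
        filter_upwards [hK.ae_integrable f g, hK.ae_integrable f' g] with x h1 h2
        rw [Pi.add_apply, Submodule.coe_add, kernelConv_congr K (Lp.coeFn_add _ _) (ae_eq_refl _),
          kernelConv, kernelConv, kernelConv, ← integral_add h1 h2]
        simp only [Pi.add_apply, add_mul, mul_add])
      (fun c f g => by
        refine Subtype.ext (Eq.trans ((MemLp.toLp_eq_toLp_iff (hK.memLp (c • f : hermitianL2 μ) g)
          ((hK.memLp f g).const_smul c)).2 ?_)
          (MemLp.toLp_const_smul c (hK.memLp f g)))
        refine ae_of_all _ fun x => ?_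
        rw [Pi.smul_apply, Submodule.coe_smul,
          kernelConv_congr K (Lp.coeFn_smul _ _) (ae_eq_refl _),
          kernelConv, kernelConv, ← integral_smul]
        simp only [Pi.smul_apply, smul_mul_assoc, mul_smul_comm])
      (fun f g g' => by
        refine Subtype.ext (Eq.trans ((MemLp.toLp_eq_toLp_iff (hK.memLp f (g + g' : hermitianL2 μ))
          ((hK.memLp f g).add (hK.memLp f g'))).2 ?_)
          (MemLp.toLp_add (hK.memLp f g) (hK.memLp f g')))
        filter_upwards [hK.ae_integrable f g, hK.ae_integrable f g'] with x h1 h2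
        rw [Pi.add_apply, Submodule.coe_add, kernelConv_congr K (ae_eq_refl _) (Lp.coeFn_add _ _),
          kernelConv, kernelConv, kernelConv, ← integral_add h1 h2]
        simp only [Pi.add_apply, mul_add])
      (fun c f g => by
        refine Subtype.ext (Eq.trans ((MemLp.toLp_eq_toLp_iff (hK.memLp f (c • g : hermitianL2 μ))
          ((hK.memLp f g).const_smul c)).2 ?_)
          (MemLp.toLp_const_smul c (hK.memLp f g)))
        refine ae_of_all _ fun x => ?_
        rw [Pi.smul_apply, Submodule.coe_smul,
          kernelConv_congr K (ae_eq_refl _) (Lp.coeFn_smul _ _),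
          kernelConv, kernelConv, ← integral_smul]
        simp only [Pi.smul_apply, mul_smul_comm]))
    C fun f g => hK.norm_toLp_le _ _

theorem coeFn_toCLM (hK : IsConvKernel μ K C) (f g : hermitianL2 μ) :
    (hK.toCLM f g : Lp ℂ 2 μ) =ᵐ[μ] kernelConv μ K (f : Lp ℂ 2 μ) (g : Lp ℂ 2 μ) :=
  (hK.memLp (f : Lp ℂ 2 μ) (g : Lp ℂ 2 μ)).coeFn_toLp

end IsConvKernel

end KernelConv

/-! ### The dispersive equation on the frequency side -/

section Dispersive

theorem ennreal_add_sq_le (a b : ℝ≥0∞) : (a + b) ^ 2 ≤ 2 * (a ^ 2 + b ^ 2) := by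
  have h := ENNReal.rpow_add_le_mul_rpow_add_rpow a b (p := 2) one_le_two
  norm_num at h
  exact h

open ComplexConjugate

variable {G : Type*} [AddCommGroup G]

/-- The kernel `i β φ(x) p(x) q(y) r(x - y)`. -/
noncomputable def symbolKernel (β : ℝ) (φ p q r : G → ℝ) (x y : G) : ℂ :=
  ((β * φ x * (p x * (q y * r (x - y))) : ℝ) : ℂ) * Complex.I

/-- An odd real symbol is compatible with Hermitian symmetry only together with the factor `i`: the
sign from `φ` matches the conjugation of `i`. -/
theorem symbolKernel_neg {β : ℝ} {φ p q r : G → ℝ} (hφ : ∀ x, φ (-x) = -φ x)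
    (hp : ∀ x, p (-x) = p x) (hq : ∀ x, q (-x) = q x) (hr : ∀ x, r (-x) = r x) (x y : G) :
    symbolKernel β φ p q r (-x) (-y) = conj (symbolKernel β φ p q r x y) := by
  have h : -x - -y = -(x - y) := by abel
  simp only [symbolKernel, h, hφ, hp, hq, hr, map_mul, Complex.conj_ofReal, Complex.conj_I]
  push_cast
  ring

variable [MeasurableSpace G] {μ : Measure G}

theorem exists_isConvKernel {K : G → G → ℂ} (hm : Measurable fun p : G × G => K p.1 p.2)
    (hn : ∀ x y, K (-x) (-y) = conj (K x y)) {B : ℝ≥0∞} (hB : B ≠ ∞)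
    (h : ∀ F H : G → ℝ≥0∞, Measurable F → Measurable H →
      ∫⁻ x, (∫⁻ y, ‖K x y‖ₑ * (F y * H (x - y)) ∂μ) ^ 2 ∂μ
        ≤ B * ((∫⁻ x, F x ^ 2 ∂μ) * ∫⁻ x, H x ^ 2 ∂μ)) :
    ∃ C, IsConvKernel μ K C := by
  refine ⟨NNReal.sqrt B.toNNReal, hm, hn, fun F H hF hH => (h F H hF hH).trans_eq ?_⟩
  rw [← ENNReal.coe_pow, NNReal.sq_sqrt, ENNReal.coe_toNNReal hB]

variable [MeasurableAdd₂ G] [MeasurableNeg G]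

theorem measurable_symbolKernel (β : ℝ) {φ p q r : G → ℝ} (hφ : Measurable φ)
    (hp : Measurable p) (hq : Measurable q) (hr : Measurable r) :
    Measurable fun z : G × G => symbolKernel β φ p q r z.1 z.2 := by
  unfold symbolKernel
  have h : Measurable fun z : G × G => r (z.1 - z.2) :=
    hr.comp (measurable_fst.sub measurable_snd)
  fun_prop

variable [μ.IsAddLeftInvariant] [μ.IsNegInvariant]

/-- The `L²` estimate for a kernel bounded by `a(x) (Q(y) + Q(x - y))` with `a ∈ L²`. -/
theorem lintegral_sq_tame_le {K : G → G → ℂ} {a Q : G → ℝ≥0∞} (ha : Measurable a)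
    (hQ : Measurable Q) (hK : ∀ x y, ‖K x y‖ₑ ≤ a x * (Q y + Q (x - y))) {F H : G → ℝ≥0∞}
    (hF : Measurable F) (hH : Measurable H) :
    ∫⁻ x, (∫⁻ y, ‖K x y‖ₑ * (F y * H (x - y)) ∂μ) ^ 2 ∂μ
      ≤ 2 * (∫⁻ x, a x ^ 2 ∂μ) * ((∫⁻ x, (Q x * F x) ^ 2 ∂μ) * (∫⁻ x, H x ^ 2 ∂μ) +
        (∫⁻ x, F x ^ 2 ∂μ) * ∫⁻ x, (Q x * H x) ^ 2 ∂μ) := by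
  set N := (∫⁻ x, (Q x * F x) ^ 2 ∂μ) * (∫⁻ x, H x ^ 2 ∂μ) +
        (∫⁻ x, F x ^ 2 ∂μ) * ∫⁻ x, (Q x * H x) ^ 2 ∂μ
  -- For fixed `x`, `Q` is distributed over the two factors and Cauchy–Schwarz is used on each
  -- piece. The result depends on `x` only through `a x ^ 2`, which is integrated last.
  have hpt : ∀ x, (∫⁻ y, ‖K x y‖ₑ * (F y * H (x - y)) ∂μ) ^ 2 ≤ a x ^ 2 * (2 * N) := by
    intro x
    have hHx : Measurable fun y => H (x - y) := hH.comp (measurable_const_sub x)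
    have hQx : Measurable fun y => Q (x - y) := hQ.comp (measurable_const_sub x)
    have h1 : ∫⁻ y, ‖K x y‖ₑ * (F y * H (x - y)) ∂μ ≤ a x *
        ((∫⁻ y, (Q y * F y) * H (x - y) ∂μ) + ∫⁻ y, F y * (Q (x - y) * H (x - y)) ∂μ) := by
      rw [← lintegral_add_left (by fun_prop), ← lintegral_const_mul _ (by fun_prop)]
      refine lintegral_mono fun y => ?_
      calc ‖K x y‖ₑ * (F y * H (x - y)) ≤ a x * (Q y + Q (x - y)) * (F y * H (x - y)) := by
            gcongr
            exact hK x y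
        _ = _ := by ring
    have h2 := sq_lintegral_mul_sub_le (μ := μ) (hQ.mul hF) hH x
    have h3 := sq_lintegral_mul_sub_le (μ := μ) hF (hQ.mul hH) x
    refine (pow_le_pow_left' h1 2).trans ?_
    rw [mul_pow]
    gcongr
    refine (ennreal_add_sq_le _ _).trans ?_
    gcongr
    exact add_le_add h2 h3
  refine (lintegral_mono hpt).trans_eq ?_
  rw [lintegral_mul_const _ (ha.pow_const 2)]
  ring

/-- The `L²` estimate for a kernel bounded by `D P(x - y)` with `P ∈ L²`. -/
theorem lintegral_sq_young_le [SFinite μ] {K : G → G → ℂ} {P : G → ℝ≥0∞} {D : ℝ≥0∞}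
    (hP : Measurable P) (hK : ∀ x y, ‖K x y‖ₑ ≤ D * P (x - y)) {F H : G → ℝ≥0∞}
    (hF : Measurable F) (hH : Measurable H) :
    ∫⁻ x, (∫⁻ y, ‖K x y‖ₑ * (F y * H (x - y)) ∂μ) ^ 2 ∂μ
      ≤ D ^ 2 * (∫⁻ x, P x ^ 2 ∂μ) * ((∫⁻ x, F x ^ 2 ∂μ) * ∫⁻ x, H x ^ 2 ∂μ) := by
  have hm : Measurable fun p : G × G => F p.2 * (P (p.1 - p.2) * H (p.1 - p.2)) := by
    have h1 : Measurable fun p : G × G => P (p.1 - p.2) :=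
      hP.comp (measurable_fst.sub measurable_snd)
    have h2 : Measurable fun p : G × G => H (p.1 - p.2) :=
      hH.comp (measurable_fst.sub measurable_snd)
    fun_prop
  have hpt : ∀ x, (∫⁻ y, ‖K x y‖ₑ * (F y * H (x - y)) ∂μ) ^ 2
      ≤ D ^ 2 * (∫⁻ y, F y * (P (x - y) * H (x - y)) ∂μ) ^ 2 := by
    intro x
    have hx : Measurable fun y => F y * (P (x - y) * H (x - y)) := hm.comp measurable_prodMk_left
    rw [← mul_pow, ← lintegral_const_mul _ hx]
    refine pow_le_pow_left' (lintegral_mono fun y => ?_) 2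
    calc ‖K x y‖ₑ * (F y * H (x - y)) ≤ D * P (x - y) * (F y * H (x - y)) := by
          gcongr
          exact hK x y
      _ = _ := by ring
  refine (lintegral_mono hpt).trans ?_
  rw [lintegral_const_mul _ (hm.lintegral_prod_right'.pow_const 2), mul_assoc]
  gcongr
  -- `P` is absorbed into `H`: the `L¹` norm of `P H` in Young's inequality is at most `‖P‖₂ ‖H‖₂`.
  refine (lintegral_sq_convolution_le hF (hP.mul hH)).trans ?_
  calc (∫⁻ x, F x ^ 2 ∂μ) * (∫⁻ x, P x * H x ∂μ) ^ 2
      ≤ (∫⁻ x, F x ^ 2 ∂μ) * ((∫⁻ x, P x ^ 2 ∂μ) * ∫⁻ x, H x ^ 2 ∂μ) := by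
        gcongr
        exact sq_lintegral_mul_le hP.aemeasurable hH.aemeasurable
    _ = _ := by ring

/-- The cancellation `∫ (∂ₓ w) w² = 0` on the frequency side. -/
theorem integral_trilinear_eq_zero [SFinite μ] {κ : G → ℝ}
    (hadd : ∀ x y, κ (x + y) = κ x + κ y) {w : G → ℂ}
    (hint : Integrable (fun p : G × G => (κ p.1 : ℂ) * (w (-p.1) * w p.2 * w (p.1 - p.2)))
      (μ.prod μ)) :
    ∫ p, (κ p.1 : ℂ) * (w (-p.1) * w p.2 * w (p.1 - p.2)) ∂(μ.prod μ) = 0 := by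
  have hκ0 : κ 0 = 0 := by simpa using hadd 0 0
  have hκn : ∀ x, κ (-x) = -κ x := fun x => by
    have := hadd x (-x)
    rw [add_neg_cancel, hκ0] at this
    linarith
  have hκs : ∀ x y, κ (x - y) = κ x - κ y := fun x y => by
    rw [sub_eq_add_neg, hadd, hκn]
    ring
  -- The product `w(-x) w(y) w(x - y)` is symmetric in the three frequencies `-x`, `y`, `x - y`,
  -- whose sum is zero. The map `σ` exchanges the first two and `ρ` the last two.
  have hσ : MeasurePreserving (fun p : G × G => (-p.2, -p.1)) (μ.prod μ) (μ.prod μ) :=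
    ((Measure.measurePreserving_neg μ).prod (Measure.measurePreserving_neg μ)).comp
      Measure.measurePreserving_swap
  have hρ : MeasurePreserving (fun p : G × G => (p.1, p.1 - p.2)) (μ.prod μ) (μ.prod μ) := by
    have h := ((MeasurePreserving.id μ).prod (Measure.measurePreserving_neg μ)).comp
      (measurePreserving_prod_neg_add μ μ)
    convert h using 2 with p
    simp [sub_eq_add_neg, add_comm]
  have hσe : MeasurableEmbedding fun p : G × G => (-p.2, -p.1) :=
    (MeasurableEquiv.prodComm.trans
      ((MeasurableEquiv.neg G).prodCongr (MeasurableEquiv.neg G))).measurableEmbedding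
  have hρm : Measurable fun p : G × G => (p.1, p.1 - p.2) :=
    measurable_fst.prodMk (measurable_fst.sub measurable_snd)
  have hρe : MeasurableEmbedding fun p : G × G => (p.1, p.1 - p.2) :=
    (MeasurableEquiv.mk ⟨fun p : G × G => (p.1, p.1 - p.2), fun p => (p.1, p.1 - p.2),
      fun p => by simp, fun p => by simp⟩ hρm hρm).measurableEmbedding
  have hT : ∀ p : G × G, w (- -p.2) * w (-p.1) * w (-p.2 - -p.1)
      = w (-p.1) * w p.2 * w (p.1 - p.2) := fun p => by
    rw [neg_neg, show -p.2 - -p.1 = p.1 - p.2 by abel]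
    ring
  have hT' : ∀ p : G × G, w (-p.1) * w (p.1 - p.2) * w (p.1 - (p.1 - p.2))
      = w (-p.1) * w p.2 * w (p.1 - p.2) := fun p => by
    rw [sub_sub_cancel]
    ring
  set I := ∫ p, (κ p.1 : ℂ) * (w (-p.1) * w p.2 * w (p.1 - p.2)) ∂(μ.prod μ)
  set I' := ∫ p, (κ p.2 : ℂ) * (w (-p.1) * w p.2 * w (p.1 - p.2)) ∂(μ.prod μ)
  have hint' : Integrable (fun p : G × G => (κ p.2 : ℂ) * (w (-p.1) * w p.2 * w (p.1 - p.2)))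
      (μ.prod μ) := by
    refine ((hσ.integrable_comp_emb hσe).2 hint).neg.congr (ae_of_all _ fun p => ?_)
    simp only [Pi.neg_apply, Function.comp_apply, hκn, hT]
    push_cast
    ring
  -- The symmetry `σ` gives `I = -I'`, the symmetry `ρ` gives `I' = I - I'`; together `3 I = 0`.
  have h1 : I = -I' := by
    rw [← integral_neg]
    refine (hσ.integral_comp hσe _).symm.trans (integral_congr_ae (ae_of_all _ fun p => ?_))
    simp only [hκn, hT]
    push_cast
    ring
  have h2 : I' = I - I' := by
    rw [← integral_sub hint hint']
    refine (hρ.integral_comp hρe _).symm.trans (integral_congr_ae (ae_of_all _ fun p => ?_))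
    simp only [hκs, hT']
    push_cast
    ring
  have h3 : 3 * I = 0 := by linear_combination 2 * h1 - h2
  simpa using h3

end Dispersive

/-! ### Dispersive symbols and estimates for the quadratic kernels -/

section FrequencyEquation

open ComplexConjugate

variable {G : Type*}

/-- The Sobolev weight `(1 + κ²)^{s/2}`. -/
noncomputable def sobolevWeight (κ : G → ℝ) (s : ℝ) (x : G) : ℝ := (1 + κ x ^ 2) ^ (s / 2)

theorem sobolevWeight_pos (κ : G → ℝ) (s : ℝ) (x : G) : 0 < sobolevWeight κ s x := by
  unfold sobolevWeight
  positivity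

theorem one_le_sobolevWeight (κ : G → ℝ) {s : ℝ} (hs : 0 ≤ s) (x : G) :
    1 ≤ sobolevWeight κ s x :=
  Real.one_le_rpow (by nlinarith [sq_nonneg (κ x)]) (by linarith)

variable [AddCommGroup G]

theorem enorm_symbolKernel (β : ℝ) (φ p q r : G → ℝ) (x y : G) :
    ‖symbolKernel β φ p q r x y‖ₑ = ENNReal.ofReal |β * φ x * (p x * (q y * r (x - y)))| := by
  rw [← ofReal_norm, symbolKernel, norm_mul, Complex.norm_I, mul_one, Complex.norm_real,
    Real.norm_eq_abs]

/-- The kernel of the quadratic term in the weighted space of order `s`. -/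
noncomputable def sobolevKernel (κ m : G → ℝ) (β s : ℝ) : G → G → ℂ :=
  symbolKernel β (fun x => κ x / m x) (sobolevWeight κ s) (fun x => (sobolevWeight κ s x)⁻¹)
    (fun x => (sobolevWeight κ s x)⁻¹)

theorem sobolevKernel_zero (κ m : G → ℝ) (β : ℝ) (x y : G) :
    sobolevKernel κ m β 0 x y = ((β * (κ x / m x) : ℝ) : ℂ) * Complex.I := by
  simp [sobolevKernel, symbolKernel, sobolevWeight]

/-- The kernel of the quadratic term in the energy space, with one factor in `L²`. -/
noncomputable def energyKernel (κ m : G → ℝ) (β : ℝ) : G → G → ℂ :=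
  symbolKernel β (fun x => κ x / m x) (fun x => √(m x)) (fun _ => 1) (fun x => (√(m x))⁻¹)

variable [MeasurableSpace G]

/-- A frequency function `κ` on the dual group and a symbol `m` that is even and bounded below by
`c (1 + κ²)`, where `(1 + κ²)⁻¹` is integrable. -/
structure IsDispersive (μ : Measure G) (κ m : G → ℝ) (c : ℝ) : Prop where
  measurable_freq : Measurable κ
  freq_add : ∀ x y, κ (x + y) = κ x + κ y
  measurable_symbol : Measurable m
  symbol_neg : ∀ x, m (-x) = m x
  pos : 0 < c
  le_symbol : ∀ x, c * (1 + κ x ^ 2) ≤ m x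
  integrable : Integrable (fun x => (1 + κ x ^ 2)⁻¹) μ

namespace IsDispersive

variable {μ : Measure G} {κ m : G → ℝ} {c : ℝ}

theorem freq_neg (h : IsDispersive μ κ m c) (x : G) : κ (-x) = -κ x := by
  have h0 : κ 0 = 0 := by simpa using h.freq_add 0 0
  have h1 := h.freq_add x (-x)
  rw [add_neg_cancel, h0] at h1
  linarith

theorem symbol_pos (h : IsDispersive μ κ m c) (x : G) : 0 < m x :=
  lt_of_lt_of_le (mul_pos h.pos (by positivity)) (h.le_symbol x)

/-- The left side equals `κ² / m`. This bounds the factor of the energy kernel that depends on the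
output frequency. -/
theorem sq_phase_mul_le (h : IsDispersive μ κ m c) (x : G) : (κ x / m x * √(m x)) ^ 2 ≤ c⁻¹ := by
  have hm := h.symbol_pos x
  have hc := h.pos
  rw [mul_pow, Real.sq_sqrt hm.le, div_pow, show κ x ^ 2 / m x ^ 2 * m x = κ x ^ 2 / m x by
    field_simp, div_le_iff₀ hm, inv_mul_eq_div, le_div_iff₀ hc]
  nlinarith [h.le_symbol x]

theorem sq_inv_sqrt_le (h : IsDispersive μ κ m c) (x : G) :
    (√(m x))⁻¹ ^ 2 ≤ c⁻¹ * (1 + κ x ^ 2)⁻¹ := by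
  rw [inv_pow, Real.sq_sqrt (h.symbol_pos x).le, ← mul_inv]
  exact inv_anti₀ (mul_pos h.pos (by positivity)) (h.le_symbol x)

theorem inv_sqrt_le (h : IsDispersive μ κ m c) (x : G) : (√(m x))⁻¹ ≤ √c⁻¹ := by
  refine Real.le_sqrt_of_sq_le ((h.sq_inv_sqrt_le x).trans ?_)
  exact mul_le_of_le_one_right (inv_pos.2 h.pos).le
    (inv_le_one_of_one_le₀ (by nlinarith [sq_nonneg (κ x)]))

/-- Factor `φ = (φ √m) · m^{-1/2}`: the first factor is bounded and the second is square integrable.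
This makes multiplication by `φ` send bounded functions, such as the transform of `u²`, into `L²`.
-/
theorem sq_phase_le (h : IsDispersive μ κ m c) (x : G) :
    (κ x / m x) ^ 2 ≤ c⁻¹ * c⁻¹ * (1 + κ x ^ 2)⁻¹ := by
  have hm := h.symbol_pos x
  have hs : √(m x) ≠ 0 := (Real.sqrt_pos.2 hm).ne'
  have h1 : κ x / m x = κ x / m x * √(m x) * (√(m x))⁻¹ := by field_simp
  rw [h1, mul_pow, mul_assoc]
  exact mul_le_mul (h.sq_phase_mul_le x) (h.sq_inv_sqrt_le x) (by positivity)
    (inv_pos.2 h.pos).le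

theorem lintegral_sq_ne_top (h : IsDispersive μ κ m c) {f : G → ℝ} {D : ℝ}
    (hf : ∀ x, f x ^ 2 ≤ D * (1 + κ x ^ 2)⁻¹) : ∫⁻ x, ENNReal.ofReal |f x| ^ 2 ∂μ ≠ ∞ := by
  refine ne_top_of_le_ne_top (h.integrable.const_mul D).lintegral_lt_top.ne
    (lintegral_mono fun x => ?_)
  rw [← ENNReal.ofReal_pow (abs_nonneg _), sq_abs]
  exact ENNReal.ofReal_le_ofReal (hf x)

theorem measurable_sobolevWeight (h : IsDispersive μ κ m c) (s : ℝ) :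
    Measurable (sobolevWeight κ s) :=
  ((h.measurable_freq.pow_const 2).const_add 1).pow_const _

theorem sobolevWeight_neg (h : IsDispersive μ κ m c) (s : ℝ) (x : G) :
    sobolevWeight κ s (-x) = sobolevWeight κ s x := by
  rw [sobolevWeight, h.freq_neg, neg_sq, sobolevWeight]

theorem sobolevWeight_le_add (h : IsDispersive μ κ m c) {s : ℝ} (hs : 0 ≤ s) (x y : G) :
    sobolevWeight κ s x
      ≤ 4 ^ (s / 2) * (sobolevWeight κ s y + sobolevWeight κ s (x - y)) := by
  have h1 : κ x = κ y + κ (x - y) := by rw [← h.freq_add, add_sub_cancel]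
  have hs2 : 0 ≤ s / 2 := by linarith
  unfold sobolevWeight
  set u := κ y
  set v := κ (x - y)
  -- From `(u + v)² ≤ 2u² + 2v²`, so that `1 + κ x ^ 2` is at most twice the sum of the two
  -- brackets.
  have h2 : 1 + κ x ^ 2 ≤ 4 * max (1 + u ^ 2) (1 + v ^ 2) := by
    rw [h1]
    nlinarith [le_max_left (1 + u ^ 2) (1 + v ^ 2), le_max_right (1 + u ^ 2) (1 + v ^ 2),
      sq_nonneg (u - v)]
  refine (Real.rpow_le_rpow (by positivity) h2 hs2).trans ?_
  rw [Real.mul_rpow (by norm_num) (by positivity)]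
  gcongr
  rcases max_cases (1 + u ^ 2) (1 + v ^ 2) with ⟨h3, -⟩ | ⟨h3, -⟩ <;> rw [h3]
  · exact le_add_of_nonneg_right (by positivity)
  · exact le_add_of_nonneg_left (by positivity)

theorem measurable_phase (h : IsDispersive μ κ m c) : Measurable fun x => κ x / m x :=
  h.measurable_freq.div h.measurable_symbol

theorem phase_neg (h : IsDispersive μ κ m c) (x : G) : κ (-x) / m (-x) = -(κ x / m x) := by
  rw [h.freq_neg, h.symbol_neg, neg_div]

/-- Dividing the subadditivity of the weight by both weights leaves a single inverse weight in each
term. In the product, one factor is thus measured in `H^s` and the other only in `L²`. -/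
theorem enorm_sobolevKernel_le (h : IsDispersive μ κ m c) (β : ℝ) {s : ℝ} (hs : 0 ≤ s) (x y : G) :
    ‖sobolevKernel κ m β s x y‖ₑ ≤ ENNReal.ofReal |β * 4 ^ (s / 2) * (κ x / m x)| *
      (ENNReal.ofReal (sobolevWeight κ s y)⁻¹ + ENNReal.ofReal (sobolevWeight κ s (x - y))⁻¹) := by
  have hx := sobolevWeight_pos κ s x
  have hy := sobolevWeight_pos κ s y
  have hz := sobolevWeight_pos κ s (x - y)
  rw [sobolevKernel, enorm_symbolKernel, ← ENNReal.ofReal_add (by positivity) (by positivity),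
    ← ENNReal.ofReal_mul (abs_nonneg _)]
  refine ENNReal.ofReal_le_ofReal ?_
  have h1 : sobolevWeight κ s x * ((sobolevWeight κ s y)⁻¹ * (sobolevWeight κ s (x - y))⁻¹)
      ≤ 4 ^ (s / 2) * ((sobolevWeight κ s y)⁻¹ + (sobolevWeight κ s (x - y))⁻¹) := by
    have h2 := h.sobolevWeight_le_add hs x y
    calc _ ≤ 4 ^ (s / 2) * (sobolevWeight κ s y + sobolevWeight κ s (x - y)) *
          ((sobolevWeight κ s y)⁻¹ * (sobolevWeight κ s (x - y))⁻¹) := by gcongr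
      _ = _ := by
        field_simp
        ring
  rw [abs_mul, abs_of_pos (a := sobolevWeight κ s x * _) (by positivity)]
  calc _ ≤ |β * (κ x / m x)| *
        (4 ^ (s / 2) * ((sobolevWeight κ s y)⁻¹ + (sobolevWeight κ s (x - y))⁻¹)) := by gcongr
    _ = _ := by
      rw [abs_mul, abs_mul (β * _), abs_mul β,
        abs_of_pos (by positivity : (0 : ℝ) < 4 ^ (s / 2))]
      ring

theorem lintegral_phase_ne_top (h : IsDispersive μ κ m c) (D : ℝ) :
    ∫⁻ x, ENNReal.ofReal |D * (κ x / m x)| ^ 2 ∂μ ≠ ∞ :=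
  h.lintegral_sq_ne_top (D := D ^ 2 * (c⁻¹ * c⁻¹)) fun x => by
    rw [mul_pow, mul_assoc]
    exact mul_le_mul_of_nonneg_left (h.sq_phase_le x) (sq_nonneg _)

variable [MeasurableAdd₂ G] [MeasurableNeg G] [μ.IsAddLeftInvariant] [μ.IsNegInvariant]

/-- The tame estimate for the quadratic term. -/
theorem exists_tame (h : IsDispersive μ κ m c) (β : ℝ) {s : ℝ} (hs : 0 ≤ s) :
    ∃ B : ℝ≥0∞, B ≠ ∞ ∧ ∀ F H : G → ℝ≥0∞, Measurable F → Measurable H →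
      ∫⁻ x, (∫⁻ y, ‖sobolevKernel κ m β s x y‖ₑ * (F y * H (x - y)) ∂μ) ^ 2 ∂μ
        ≤ B * ((∫⁻ x, (ENNReal.ofReal (sobolevWeight κ s x)⁻¹ * F x) ^ 2 ∂μ) *
            (∫⁻ x, H x ^ 2 ∂μ) +
          (∫⁻ x, F x ^ 2 ∂μ) *
            ∫⁻ x, (ENNReal.ofReal (sobolevWeight κ s x)⁻¹ * H x) ^ 2 ∂μ) := by
  refine ⟨_, ?_, fun F H hF hH => lintegral_sq_tame_le ?_ ?_ (h.enorm_sobolevKernel_le β hs) hF hH⟩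
  · exact ENNReal.mul_ne_top (by finiteness) (h.lintegral_phase_ne_top _)
  · have := h.measurable_phase
    exact ENNReal.measurable_ofReal.comp (this.const_mul _).abs
  · exact ENNReal.measurable_ofReal.comp (h.measurable_sobolevWeight s).inv

theorem exists_isConvKernel_sobolevKernel (h : IsDispersive μ κ m c) (β : ℝ) {s : ℝ}
    (hs : 0 ≤ s) : ∃ C, IsConvKernel μ (sobolevKernel κ m β s) C := by
  obtain ⟨B, hB, hBB⟩ := h.exists_tame β hs
  have hw := h.measurable_sobolevWeight s
  have hwn := h.sobolevWeight_neg s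
  refine exists_isConvKernel (B := B * 2)
    (measurable_symbolKernel β h.measurable_phase hw hw.inv hw.inv)
    (symbolKernel_neg h.phase_neg hwn (fun x => by rw [hwn]) (fun x => by rw [hwn]))
    (by finiteness) fun F H hF hH => (hBB F H hF hH).trans ?_
  have hle : ∀ (F : G → ℝ≥0∞) x, ENNReal.ofReal (sobolevWeight κ s x)⁻¹ * F x ≤ F x := fun F x => by
    refine mul_le_of_le_one_left' (ENNReal.ofReal_le_one.2 ?_)
    exact inv_le_one_of_one_le₀ (one_le_sobolevWeight κ hs x)
  rw [mul_assoc, two_mul]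
  gcongr <;> exact hle _ _

/-- In the kernel `φ(x) √m(x) · 1 · m(x - y)^{-1/2}` the factor in `x` is bounded and the one in `x
- y` is square integrable, so Young's inequality applies. The factor in `y` carries no weight: the
first argument need only be in `L²`. -/
theorem exists_isConvKernel_energyKernel [SFinite μ] (h : IsDispersive μ κ m c) (β : ℝ) :
    ∃ C, IsConvKernel μ (energyKernel κ m β) C := by
  have hw : Measurable fun x => √(m x) := h.measurable_symbol.sqrt
  have hwn : ∀ x, √(m (-x)) = √(m x) := fun x => by rw [h.symbol_neg]
  refine exists_isConvKernel
    (measurable_symbolKernel β h.measurable_phase hw measurable_const hw.inv)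
    (symbolKernel_neg h.phase_neg hwn (fun x => rfl) (fun x => by rw [hwn])) ?_
    fun F H hF hH => lintegral_sq_young_le (D := ENNReal.ofReal (|β| * √c⁻¹))
      (P := fun x => ENNReal.ofReal |(√(m x))⁻¹|)
      (ENNReal.measurable_ofReal.comp hw.inv.abs) (fun x y => ?_) hF hH
  · exact ENNReal.mul_ne_top (by finiteness) (h.lintegral_sq_ne_top h.sq_inv_sqrt_le)
  · rw [energyKernel, enorm_symbolKernel, ← ENNReal.ofReal_mul (by positivity)]
    refine ENNReal.ofReal_le_ofReal ?_
    have h1 : |κ x / m x * √(m x)| ≤ √c⁻¹ := Real.abs_le_sqrt (h.sq_phase_mul_le x)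
    calc _ = |β| * |κ x / m x * √(m x)| * |(√(m (x - y)))⁻¹| := by
          rw [← abs_mul, ← abs_mul]
          congr 1
          ring
      _ ≤ _ := by gcongr

end IsDispersive

end FrequencyEquation

/-! ### Energy conservation and well-posedness on the frequency side -/

section FrequencyWellPosed

open ComplexConjugate

variable {G : Type*} [AddCommGroup G] [MeasurableSpace G] {μ : Measure G}

namespace IsDispersive

variable {κ m : G → ℝ} {c : ℝ}

theorem isHermitianMultiplier_phase (h : IsDispersive μ κ m c) :
    IsHermitianMultiplier (fun x => -Complex.I * (κ x / m x : ℝ)) (√(c⁻¹ * c⁻¹)) where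
  measurable := by
    have := h.measurable_phase
    fun_prop
  neg_eq x := by
    rw [h.phase_neg, map_mul, map_neg, Complex.conj_I, Complex.conj_ofReal]
    push_cast
    ring
  bound x := by
    rw [norm_mul, norm_neg, Complex.norm_I, one_mul, Complex.norm_real]
    refine Real.abs_le_sqrt ((h.sq_phase_le x).trans ?_)
    exact mul_le_of_le_one_right (mul_self_nonneg _)
      (inv_le_one_of_one_le₀ (by nlinarith [sq_nonneg (κ x)]))

theorem isHermitianMultiplier_inv_sqrt (h : IsDispersive μ κ m c) :
    IsHermitianMultiplier (fun x => (((√(m x))⁻¹ : ℝ) : ℂ)) (√c⁻¹) where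
  measurable := by
    have := h.measurable_symbol
    fun_prop
  neg_eq x := by rw [h.symbol_neg, Complex.conj_ofReal]
  bound x := by
    rw [Complex.norm_real, Real.norm_of_nonneg (by positivity)]
    exact h.inv_sqrt_le x

theorem isHermitianMultiplier_inv_sobolevWeight (h : IsDispersive μ κ m c) {s : ℝ} (hs : 0 ≤ s) :
    IsHermitianMultiplier (fun x => (((sobolevWeight κ s x)⁻¹ : ℝ) : ℂ)) 1 where
  measurable := by
    have := h.measurable_sobolevWeight s
    fun_prop
  neg_eq x := by rw [h.sobolevWeight_neg, Complex.conj_ofReal]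
  bound x := by
    rw [Complex.norm_real, Real.norm_of_nonneg (inv_nonneg.2 (sobolevWeight_pos κ s x).le)]
    exact inv_le_one_of_one_le₀ (one_le_sobolevWeight κ hs x)

end IsDispersive

variable [MeasurableNeg G] [μ.IsNegInvariant]

theorem hermitianL2_ext {f g : hermitianL2 μ} (h : (f : Lp ℂ 2 μ) =ᵐ[μ] (g : Lp ℂ 2 μ)) : f = g :=
  Subtype.ext (Lp.ext h)

theorem inner_hermitianL2 (f g : hermitianL2 μ) :
    inner ℝ f g = ∫ x, (conj ((f : Lp ℂ 2 μ) x) * (g : Lp ℂ 2 μ) x).re ∂μ := by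
  change inner ℝ (f : Lp ℂ 2 μ) (g : Lp ℂ 2 μ) = _
  rw [L2.inner_def]
  refine integral_congr_ae (ae_of_all _ fun x => ?_)
  exact (Complex.inner _ _).trans (by rw [mul_comm])

theorem IsHermitianMultiplier.toCLM_comm {a b : G → ℂ} {C D : ℝ} (ha : IsHermitianMultiplier a C)
    (hb : IsHermitianMultiplier b D) (f : hermitianL2 μ) :
    ha.toCLM μ (hb.toCLM μ f) = hb.toCLM μ (ha.toCLM μ f) := by
  refine hermitianL2_ext ?_
  filter_upwards [ha.coeFn_toCLM f, hb.coeFn_toCLM f, ha.coeFn_toCLM (hb.toCLM μ f),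
    hb.coeFn_toCLM (ha.toCLM μ f)] with x h1 h2 h3 h4
  rw [h3, h4, h1, h2]
  ring

namespace IsDispersive

variable {κ m : G → ℝ} {c : ℝ}

/-- The multiplier is purely imaginary, so the real part of the integrand vanishes pointwise. -/
theorem inner_phase_eq_zero (h : IsDispersive μ κ m c) (f : hermitianL2 μ) :
    inner ℝ f (h.isHermitianMultiplier_phase.toCLM μ f) = 0 := by
  rw [inner_hermitianL2]
  refine integral_eq_zero_of_ae ?_
  filter_upwards [h.isHermitianMultiplier_phase.coeFn_toCLM f] with x hx
  rw [hx]
  simp only [Complex.mul_re, Complex.mul_im, Complex.neg_re, Complex.neg_im, Complex.I_re,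
    Complex.I_im, Complex.ofReal_re, Complex.ofReal_im, Complex.conj_re, Complex.conj_im,
    Pi.zero_apply]
  ring

/-- The multiplication by `m^{-1/2}` has dense range. -/
theorem denseRange_inv_sqrt (h : IsDispersive μ κ m c) :
    DenseRange (h.isHermitianMultiplier_inv_sqrt.toCLM μ) := by
  classical
  intro f
  -- Truncation: on `{m ≤ n}` the multiplier `√m` is bounded by `√n`, and applying `m^{-1/2}` to the
  -- truncated `√m f` gives `1_{m ≤ n} f`. This converges to `f` in `L²` by dominated convergence.
  set S : ℕ → Set G := fun n => {x | m x ≤ n}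
  have hS : ∀ n, MeasurableSet (S n) := fun n => measurableSet_le h.measurable_symbol measurable_const
  have hmul : ∀ n, IsHermitianMultiplier
      (fun x => (((S n).indicator (fun x => √(m x)) x : ℝ) : ℂ)) (√n) := fun n =>
    { measurable := Complex.measurable_ofReal.comp
        (h.measurable_symbol.sqrt.indicator (hS n))
      neg_eq := fun x => by
        simp only [Set.indicator, S, Set.mem_ofPred_eq, h.symbol_neg, Complex.conj_ofReal]
      bound := fun x => by
        rw [Complex.norm_real]
        by_cases hx : x ∈ S n
        · rw [Set.indicator_of_mem hx, Real.norm_of_nonneg (Real.sqrt_nonneg _)]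
          exact Real.sqrt_le_sqrt hx
        · rw [Set.indicator_of_notMem hx, norm_zero]
          positivity }
  set u : ℕ → hermitianL2 μ := fun n =>
    h.isHermitianMultiplier_inv_sqrt.toCLM μ ((hmul n).toCLM μ f)
  have hu : ∀ n, ((u n - f : hermitianL2 μ) : Lp ℂ 2 μ) =ᵐ[μ]
      fun x => -(S n)ᶜ.indicator (f : Lp ℂ 2 μ) x := by
    intro n
    filter_upwards [h.isHermitianMultiplier_inv_sqrt.coeFn_toCLM ((hmul n).toCLM μ f),
      (hmul n).coeFn_toCLM f, Lp.coeFn_sub (u n : Lp ℂ 2 μ) f] with x h1 h2 h3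
    rw [Submodule.coe_sub, h3, Pi.sub_apply, h1, h2]
    by_cases hx : x ∈ S n
    · have : (√(m x) : ℂ) ≠ 0 := by exact_mod_cast (Real.sqrt_pos.2 (h.symbol_pos x)).ne'
      rw [Set.indicator_of_mem hx, Set.indicator_of_notMem (by simpa using hx)]
      push_cast
      field_simp
      simp
    · rw [Set.indicator_of_notMem hx, Set.indicator_of_mem (by simpa using hx)]
      simp
  refine mem_closure_of_tendsto (f := u) (b := atTop) ?_ (Eventually.of_forall fun n => ⟨_, rfl⟩)
  have hlim : Tendsto (fun n => ∫⁻ x, ‖(S n)ᶜ.indicator (f : Lp ℂ 2 μ) x‖ₑ ^ 2 ∂μ) atTop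
      (𝓝 (∫⁻ _, 0 ∂μ)) := by
    have hf := (Lp.stronglyMeasurable (f : Lp ℂ 2 μ)).measurable
    refine tendsto_lintegral_of_dominated_convergence (fun x => ‖(f : Lp ℂ 2 μ) x‖ₑ ^ 2)
      (fun n => (hf.indicator (hS n).compl).enorm.pow_const 2) (fun n => ae_of_all _ fun x => ?_)
      ?_ (ae_of_all _ fun x => ?_)
    · exact pow_le_pow_left' (enorm_indicator_le_enorm_self _ _) 2
    · rw [← enorm_sq_eq_lintegral]
      finiteness
    · refine tendsto_const_nhds.congr' ?_
      filter_upwards [eventually_ge_atTop ⌈m x⌉₊] with n hn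
      have hx : m x ≤ n := (Nat.le_ceil _).trans (Nat.cast_le.2 hn)
      have hx : x ∈ S n := hx
      rw [Set.indicator_of_notMem (by simpa using hx)]
      simp
  rw [lintegral_zero] at hlim
  rw [tendsto_iff_norm_sub_tendsto_zero]
  have hsq : ∀ n, ‖u n - f‖ = √(∫⁻ x, ‖(S n)ᶜ.indicator (f : Lp ℂ 2 μ) x‖ₑ ^ 2 ∂μ).toReal := by
    intro n
    have h1 : ∫⁻ x, ‖(S n)ᶜ.indicator (f : Lp ℂ 2 μ) x‖ₑ ^ 2 ∂μ
        = ‖((u n - f : hermitianL2 μ) : Lp ℂ 2 μ)‖ₑ ^ 2 := by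
      rw [enorm_sq_eq_lintegral]
      refine lintegral_congr_ae ?_
      filter_upwards [hu n] with x hx
      rw [hx, enorm_neg]
    rw [h1, ENNReal.toReal_pow, toReal_enorm, Real.sqrt_sq (norm_nonneg _), Submodule.coe_norm]
  simp only [hsq]
  have h2 := (Real.continuous_sqrt.tendsto _).comp
    ((ENNReal.tendsto_toReal ENNReal.zero_ne_top).comp hlim)
  simpa [Function.comp_def] using h2

variable [MeasurableAdd₂ G] [μ.IsAddLeftInvariant] [SFinite μ] {β : ℝ}

/-- For `s = 0` the kernel depends on the output frequency alone, so `y ↦ x - y` exchanges the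
factors. -/
theorem toCLM_sobolevKernel_zero_symm {C : NNReal}
    (hK : IsConvKernel μ (sobolevKernel κ m β 0) C) (f g : hermitianL2 μ) :
    hK.toCLM f g = hK.toCLM g f := by
  refine hermitianL2_ext ?_
  filter_upwards [hK.coeFn_toCLM f g, hK.coeFn_toCLM g f] with x h1 h2
  rw [h1, h2, kernelConv, kernelConv, ← integral_sub_left_eq_self _ μ x]
  refine integral_congr_ae (ae_of_all _ fun y => ?_)
  simp only [sobolevKernel_zero, sub_sub_cancel]
  ring

/-- The energy kernel is the `L²` kernel read in the unknown `√m ŵ`, whose `L²` norm squared is the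
energy. The output factor `√m(x)` cancels, and `m(x - y)^{-1/2}` passes to `g`. -/
theorem inv_sqrt_energyKernel (h : IsDispersive μ κ m c) {C C' : NNReal}
    (hK : IsConvKernel μ (sobolevKernel κ m β 0) C) (hE : IsConvKernel μ (energyKernel κ m β) C')
    (f g : hermitianL2 μ) :
    h.isHermitianMultiplier_inv_sqrt.toCLM μ (hE.toCLM f g) =
      hK.toCLM f (h.isHermitianMultiplier_inv_sqrt.toCLM μ g) := by
  set J := h.isHermitianMultiplier_inv_sqrt
  refine hermitianL2_ext ?_
  filter_upwards [J.coeFn_toCLM (hE.toCLM f g), hE.coeFn_toCLM f g,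
    hK.coeFn_toCLM f (J.toCLM μ g)] with x h1 h2 h3
  rw [h1, h2, h3, kernelConv_congr _ (ae_eq_refl _) (J.coeFn_toCLM g), kernelConv, kernelConv,
    ← integral_const_mul]
  refine integral_congr_ae (ae_of_all _ fun y => ?_)
  have : (√(m x) : ℂ) ≠ 0 := by exact_mod_cast (Real.sqrt_pos.2 (h.symbol_pos x)).ne'
  simp only [sobolevKernel_zero, energyKernel, symbolKernel]
  push_cast
  field_simp

theorem inv_weight_sobolevKernel (h : IsDispersive μ κ m c) {s : ℝ} (hs : 0 ≤ s) {C C' : NNReal}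
    (hK : IsConvKernel μ (sobolevKernel κ m β 0) C) (hE : IsConvKernel μ (sobolevKernel κ m β s) C')
    (f : hermitianL2 μ) :
    (h.isHermitianMultiplier_inv_sobolevWeight hs).toCLM μ (hE.toCLM f f) =
      hK.toCLM ((h.isHermitianMultiplier_inv_sobolevWeight hs).toCLM μ f)
        ((h.isHermitianMultiplier_inv_sobolevWeight hs).toCLM μ f) := by
  set J := h.isHermitianMultiplier_inv_sobolevWeight hs
  refine hermitianL2_ext ?_
  filter_upwards [J.coeFn_toCLM (hE.toCLM f f), hE.coeFn_toCLM f f,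
    hK.coeFn_toCLM (J.toCLM μ f) (J.toCLM μ f)] with x h1 h2 h3
  rw [h1, h2, h3, kernelConv_congr _ (J.coeFn_toCLM f) (J.coeFn_toCLM f), kernelConv, kernelConv,
    ← integral_const_mul]
  refine integral_congr_ae (ae_of_all _ fun y => ?_)
  have : (sobolevWeight κ s x : ℂ) ≠ 0 := by exact_mod_cast (sobolevWeight_pos κ s x).ne'
  simp only [sobolevKernel_zero]
  simp only [sobolevKernel, symbolKernel]
  push_cast
  field_simp

theorem exists_norm_sobolevKernel_le (h : IsDispersive μ κ m c) {s : ℝ} (hs : 0 ≤ s) {C : NNReal}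
    (hE : IsConvKernel μ (sobolevKernel κ m β s) C) :
    ∃ D : ℝ, ∀ f : hermitianL2 μ, ‖hE.toCLM f f‖ ≤
      D * ‖(h.isHermitianMultiplier_inv_sobolevWeight hs).toCLM μ f‖ * ‖f‖ := by
  obtain ⟨B, hB, hBB⟩ := h.exists_tame β hs
  set J := h.isHermitianMultiplier_inv_sobolevWeight hs
  -- With equal arguments the two terms of the tame estimate coincide; hence the factor `2`.
  refine ⟨√(2 * B.toReal), fun f => ?_⟩
  have hf := (Lp.stronglyMeasurable (f : Lp ℂ 2 μ)).measurable
  have h1 : ‖((hE.toCLM f f : hermitianL2 μ) : Lp ℂ 2 μ)‖ₑ ^ 2 ≤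
      2 * B * (‖((J.toCLM μ f : hermitianL2 μ) : Lp ℂ 2 μ)‖ₑ ^ 2 * ‖(f : Lp ℂ 2 μ)‖ₑ ^ 2) := by
    have hJ : ‖((J.toCLM μ f : hermitianL2 μ) : Lp ℂ 2 μ)‖ₑ ^ 2 =
        ∫⁻ x, (ENNReal.ofReal (sobolevWeight κ s x)⁻¹ * ‖(f : Lp ℂ 2 μ) x‖ₑ) ^ 2 ∂μ := by
      rw [enorm_sq_eq_lintegral]
      refine lintegral_congr_ae ?_
      filter_upwards [J.coeFn_toCLM f] with x hx
      rw [hx, enorm_mul, ← ofReal_norm, Complex.norm_real,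
        Real.norm_of_nonneg (inv_nonneg.2 (sobolevWeight_pos κ s x).le)]
    have hl : ‖((hE.toCLM f f : hermitianL2 μ) : Lp ℂ 2 μ)‖ₑ ^ 2 =
        ∫⁻ x, ‖kernelConv μ (sobolevKernel κ m β s) (f : Lp ℂ 2 μ) (f : Lp ℂ 2 μ) x‖ₑ ^ 2 ∂μ := by
      rw [enorm_sq_eq_lintegral]
      refine lintegral_congr_ae ?_
      filter_upwards [hE.coeFn_toCLM f f] with x hx
      rw [hx]
    rw [hl]
    refine (lintegral_enorm_kernelConv_sq_le _ _ _ _).trans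
      ((hBB _ _ hf.enorm hf.enorm).trans_eq ?_)
    rw [← hJ, ← enorm_sq_eq_lintegral]
    ring
  have h2 := ENNReal.toReal_mono (by finiteness) h1
  simp only [ENNReal.toReal_mul, ENNReal.toReal_pow, toReal_enorm, ENNReal.toReal_ofNat] at h2
  refine le_of_sq_le_sq ?_ (by positivity)
  rw [mul_pow, mul_pow, Real.sq_sqrt (by positivity), mul_assoc]
  exact h2

omit [μ.IsNegInvariant] [μ.IsAddLeftInvariant] [SFinite μ] in
theorem measurable_kernel_enorm {K : G → G → ℂ} (hK : Measurable fun p : G × G => K p.1 p.2)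
    {w W : G → ℂ} (hw : Measurable w) (hW : Measurable W) (x : G) :
    Measurable fun y => ‖K x y‖ₑ * (‖w y‖ₑ * ‖W (x - y)‖ₑ) := by
  have h1 : Measurable fun y => K x y := hK.comp measurable_prodMk_left
  have h2 : Measurable fun y => W (x - y) := hW.comp (measurable_const_sub x)
  exact h1.enorm.mul (hw.enorm.mul h2.enorm)

omit [μ.IsNegInvariant] [MeasurableNeg G] [MeasurableAdd₂ G] [μ.IsAddLeftInvariant] [SFinite μ] in
-- Since `φ m = κ`, the two factors `√m(x)`, one from the energy kernel and one from `W(-x)`, turn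
-- `φ` into the derivative symbol `κ`. The energy pairing becomes the form `∫ (∂ₓ w) w²`.
theorem trilinear_mul_I (h : IsDispersive μ κ m c) {w W : G → ℂ}
    (hwW : ∀ x, w x = ((√(m x))⁻¹ : ℝ) * W x) (x y : G) :
    (κ x : ℂ) * (w (-x) * w y * w (x - y)) * Complex.I =
      W (-x) * (energyKernel κ m 1 x y * (w y * W (x - y))) := by
  have hs : (√(m x) : ℂ) ≠ 0 := by exact_mod_cast (Real.sqrt_pos.2 (h.symbol_pos x)).ne'
  have hs2 : (m x : ℂ) = (√(m x) : ℂ) ^ 2 := by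
    exact_mod_cast (Real.sq_sqrt (h.symbol_pos x).le).symm
  rw [hwW (-x), hwW (x - y), h.symbol_neg]
  simp only [energyKernel, symbolKernel]
  push_cast
  rw [hs2]
  field_simp

/-- The factor `κ` is unbounded and `w` alone does not control it. Read through the energy kernel,
the integral pairs `W(-x)` with a function of `x` that the kernel bound places in `L²`, so
Cauchy–Schwarz suffices. -/
theorem integrable_trilinear (h : IsDispersive μ κ m c) {w W : G → ℂ} (hw : Measurable w)
    (hW : Measurable W) (hwW : ∀ x, w x = ((√(m x))⁻¹ : ℝ) * W x)
    (hwL : ∫⁻ x, ‖w x‖ₑ ^ 2 ∂μ ≠ ∞) (hWL : ∫⁻ x, ‖W x‖ₑ ^ 2 ∂μ ≠ ∞) :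
    Integrable (fun p : G × G => (κ p.1 : ℂ) * (w (-p.1) * w p.2 * w (p.1 - p.2)))
      (μ.prod μ) := by
  obtain ⟨C₁, hE₁⟩ := h.exists_isConvKernel_energyKernel 1
  have hwn : Measurable fun p : G × G => w (-p.1) := hw.comp measurable_fst.neg
  have hw2 : Measurable fun p : G × G => w p.2 := hw.comp measurable_snd
  have hws : Measurable fun p : G × G => w (p.1 - p.2) :=
    hw.comp (measurable_fst.sub measurable_snd)
  have hκ1 : Measurable fun p : G × G => (κ p.1 : ℂ) :=
    Complex.measurable_ofReal.comp (h.measurable_freq.comp measurable_fst)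
  have hm : Measurable fun p : G × G => (κ p.1 : ℂ) * (w (-p.1) * w p.2 * w (p.1 - p.2)) :=
    hκ1.mul ((hwn.mul hw2).mul hws)
  refine ⟨hm.aestronglyMeasurable, ?_⟩
  rw [hasFiniteIntegral_iff_enorm, lintegral_prod _ hm.enorm.aemeasurable]
  have hkm : Measurable fun p : G × G =>
      ‖energyKernel κ m 1 p.1 p.2‖ₑ * (‖w p.2‖ₑ * ‖W (p.1 - p.2)‖ₑ) :=
    hE₁.measurable.enorm.mul (hw2.enorm.mul
      (hW.comp (measurable_fst.sub measurable_snd)).enorm)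
  have heq : ∀ x, ∫⁻ y, ‖(κ x : ℂ) * (w (-x) * w y * w (x - y))‖ₑ ∂μ =
      ‖W (-x)‖ₑ * ∫⁻ y, ‖energyKernel κ m 1 x y‖ₑ * (‖w y‖ₑ * ‖W (x - y)‖ₑ) ∂μ := by
    intro x
    have hkx : Measurable fun y => ‖energyKernel κ m 1 x y‖ₑ * (‖w y‖ₑ * ‖W (x - y)‖ₑ) :=
      measurable_kernel_enorm hE₁.measurable hw hW x
    rw [← lintegral_const_mul _ hkx]
    refine lintegral_congr fun y => ?_
    have hI : ‖Complex.I‖ₑ = 1 := by rw [← ofReal_norm, Complex.norm_I, ENNReal.ofReal_one]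
    have h1 := congrArg enorm (h.trilinear_mul_I hwW x y)
    rwa [enorm_mul _ Complex.I, hI, mul_one, enorm_mul (W (-x)), enorm_mul (energyKernel κ m 1 x y),
      enorm_mul (w y)] at h1
  simp only [heq]
  have hfin := sq_lintegral_mul_le (μ := μ) (F := fun x => ‖W (-x)‖ₑ)
    (H := fun x => ∫⁻ y, ‖energyKernel κ m 1 x y‖ₑ * (‖w y‖ₑ * ‖W (x - y)‖ₑ) ∂μ)
    (hW.comp measurable_neg).enorm.aemeasurable hkm.lintegral_prod_right'.aemeasurable
  have hb := hE₁.bound _ _ hw.enorm hW.enorm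
  have hn : ∫⁻ x, ‖W (-x)‖ₑ ^ 2 ∂μ = ∫⁻ x, ‖W x‖ₑ ^ 2 ∂μ :=
    lintegral_neg_eq_self (μ := μ) fun x => ‖W x‖ₑ ^ 2
  rw [hn] at hfin
  have hfin2 := hfin.trans_lt (ENNReal.mul_lt_top hWL.lt_top
    (hb.trans_lt (ENNReal.mul_lt_top (by finiteness) (ENNReal.mul_lt_top hwL.lt_top hWL.lt_top))))
  simpa using hfin2

/-- The quadratic term conserves the energy. -/
theorem inner_energyKernel_eq_zero (h : IsDispersive μ κ m c) {C : NNReal}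
    (hE : IsConvKernel μ (energyKernel κ m β) C) (f : hermitianL2 μ) :
    inner ℝ f (hE.toCLM (h.isHermitianMultiplier_inv_sqrt.toCLM μ f) f) = 0 := by
  have hJ := h.isHermitianMultiplier_inv_sqrt.coeFn_toCLM f
  -- Representatives are fixed so that `w = m^{-1/2} W` holds at every point, as the pointwise
  -- trilinear identity requires.
  obtain ⟨W, hWdef⟩ : ∃ W : G → ℂ, W = ⇑(f : Lp ℂ 2 μ) := ⟨_, rfl⟩
  obtain ⟨w, hwW⟩ : ∃ w : G → ℂ, ∀ x, w x = ((√(m x))⁻¹ : ℝ) * W x := ⟨_, fun _ => rfl⟩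
  have hW : Measurable W := hWdef ▸ (Lp.stronglyMeasurable (f : Lp ℂ 2 μ)).measurable
  have hw : Measurable w := by
    have := h.measurable_symbol
    rw [funext hwW]
    fun_prop
  have hJw : ((h.isHermitianMultiplier_inv_sqrt.toCLM μ f : hermitianL2 μ) : Lp ℂ 2 μ)
      =ᵐ[μ] w := by
    filter_upwards [hJ] with x hx
    rw [hx, hwW, hWdef]
  have hWL : ∫⁻ x, ‖W x‖ₑ ^ 2 ∂μ ≠ ∞ := by
    rw [hWdef, ← enorm_sq_eq_lintegral]
    finiteness
  have hwL : ∫⁻ x, ‖w x‖ₑ ^ 2 ∂μ ≠ ∞ := by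
    rw [lintegral_congr_ae (g := fun x =>
      ‖((h.isHermitianMultiplier_inv_sqrt.toCLM μ f : hermitianL2 μ) : Lp ℂ 2 μ) x‖ₑ ^ 2)
      (by filter_upwards [hJw] with x hx; rw [hx]), ← enorm_sq_eq_lintegral]
    finiteness
  have hint := h.integrable_trilinear hw hW hwW hwL hWL
  have hzero := integral_trilinear_eq_zero h.freq_add hint
  rw [integral_prod _ hint] at hzero
  have hgi := hint.integral_prod_left
  rw [inner_hermitianL2]
  -- Hermitian symmetry replaces the conjugate of `f x` by `W (-x)`, which produces the trilinear
  -- integrand.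
  have hpt : ∀ᵐ x ∂μ, (conj ((f : Lp ℂ 2 μ) x) *
        ((hE.toCLM (h.isHermitianMultiplier_inv_sqrt.toCLM μ f) f : hermitianL2 μ) :
          Lp ℂ 2 μ) x).re =
      (β * Complex.I * ∫ y, (κ x : ℂ) * (w (-x) * w y * w (x - y)) ∂μ).re := by
    filter_upwards [hE.coeFn_toCLM (h.isHermitianMultiplier_inv_sqrt.toCLM μ f) f,
      ae_neg_eq_conj f] with x h1 h2
    rw [h1, kernelConv_congr _ hJw (ae_eq_refl _), ← h2, ← hWdef, kernelConv,
      ← integral_const_mul, ← integral_const_mul]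
    congr 1
    refine integral_congr_ae (ae_of_all _ fun y => ?_)
    have h3 : energyKernel κ m β x y = β * energyKernel κ m 1 x y := by
      simp only [energyKernel, symbolKernel]
      push_cast
      ring
    have h4 := h.trilinear_mul_I hwW x y
    simp only [h3]
    linear_combination (-(β : ℂ)) * h4
  rw [integral_congr_ae hpt]
  have h5 := integral_re (𝕜 := ℂ) (hgi.const_mul (β * Complex.I))
  simp only [RCLike.re_to_complex] at h5
  rw [h5, integral_const_mul, hzero, mul_zero, Complex.zero_re]

/-- Global well-posedness on the frequency side, for the unknown `f = (1 + κ²)^{s/2} û`. -/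
theorem exists_isGloballyWellPosed (h : IsDispersive μ κ m c) (β : ℝ) {s : ℝ} (hs : 0 ≤ s) :
    ∃ Φ : hermitianL2 μ → hermitianL2 μ, IsGloballyWellPosed Φ ∧
      ∀ f : hermitianL2 μ, ∀ᵐ x ∂μ, (Φ f : Lp ℂ 2 μ) x =
        -Complex.I * (κ x / m x : ℝ) * ((f : Lp ℂ 2 μ) x - β * (sobolevWeight κ s x *
          ∫ y, (((sobolevWeight κ s y)⁻¹ : ℝ) * (f : Lp ℂ 2 μ) y) *
            (((sobolevWeight κ s (x - y))⁻¹ : ℝ) * (f : Lp ℂ 2 μ) (x - y)) ∂μ)) := by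
  obtain ⟨C₀, hK⟩ := h.exists_isConvKernel_sobolevKernel β le_rfl
  obtain ⟨C₁, hE⟩ := h.exists_isConvKernel_energyKernel β
  obtain ⟨C₂, hS⟩ := h.exists_isConvKernel_sobolevKernel β hs
  obtain ⟨D, hD⟩ := h.exists_norm_sobolevKernel_le hs hS
  set A := h.isHermitianMultiplier_phase
  refine ⟨quadraticField (A.toCLM μ) hS.toCLM, ?_, fun f => ?_⟩
  · refine isGloballyWellPosed_of_tame (A.toCLM μ) hK.toCLM (fun T hT x₀ => ?_) _ _
      ((h.isHermitianMultiplier_inv_sobolevWeight hs).toCLM μ)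
      (fun f => IsHermitianMultiplier.toCLM_comm _ _ f)
      (fun f => h.inv_weight_sobolevKernel hs hK hS f) D hD
    -- The base space is `L²` and the conservative dense subspace is the energy space, included by
    -- multiplication by `m^{-1/2}`.
    exact exists_isSolutionOn_of_dense_conservative (A.toCLM μ) hK.toCLM
      (toCLM_sobolevKernel_zero_symm hK) (A.toCLM μ) hE.toCLM
      (h.isHermitianMultiplier_inv_sqrt.toCLM μ) h.denseRange_inv_sqrt
      (fun f => IsHermitianMultiplier.toCLM_comm _ _ f)
      (h.inv_sqrt_energyKernel hK hE) h.inner_phase_eq_zero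
      (h.inner_energyKernel_eq_zero hE) hT x₀
  · filter_upwards [A.coeFn_toCLM f, hS.coeFn_toCLM f f,
      Lp.coeFn_add ((A.toCLM μ f : hermitianL2 μ) : Lp ℂ 2 μ) (hS.toCLM f f : hermitianL2 μ)]
      with x h1 h2 h3
    rw [quadraticField, Submodule.coe_add, h3, Pi.add_apply, h1, h2, mul_sub, sub_eq_add_neg]
    congr 1
    rw [kernelConv, ← integral_const_mul, ← integral_const_mul, ← integral_const_mul,
      ← integral_neg]
    refine integral_congr_ae (ae_of_all _ fun y => ?_)
    simp only [sobolevKernel, symbolKernel]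
    push_cast
    ring

end IsDispersive

end FrequencyWellPosed

/-! ### The line -/

section Line

open ComplexConjugate SchwartzMap

/-- The map `g ↦ conj (g (ξ - ·))` on `L²(ℝ)`. -/
noncomputable def reflectConj (ξ : ℝ) (g : Lp ℂ 2 (volume : Measure ℝ)) :
    Lp ℂ 2 (volume : Measure ℝ) :=
  (Complex.conjCLE : ℂ →L[ℝ] ℂ).compLp
    (Lp.compMeasurePreserving (fun y => ξ - y) (Measure.measurePreserving_sub_left volume ξ) g)

theorem coeFn_reflectConj (ξ : ℝ) (g : Lp ℂ 2 (volume : Measure ℝ)) :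
    reflectConj ξ g =ᵐ[volume] fun y => conj (g (ξ - y)) := by
  filter_upwards [(Complex.conjCLE : ℂ →L[ℝ] ℂ).coeFn_compLp
    (Lp.compMeasurePreserving (fun y => ξ - y) (Measure.measurePreserving_sub_left volume ξ) g),
    Lp.coeFn_compMeasurePreserving g (Measure.measurePreserving_sub_left volume ξ)] with y h1 h2
  rw [reflectConj, h1, h2]
  rfl

theorem continuous_reflectConj (ξ : ℝ) : Continuous (reflectConj ξ) :=
  ((Complex.conjCLE : ℂ →L[ℝ] ℂ).compLpL 2 volume).continuous.comp
    (Lp.compMeasurePreservingₗᵢ ℝ (fun y : ℝ => ξ - y)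
      (Measure.measurePreserving_sub_left volume ξ)).continuous

/-- The Schwartz function `y ↦ conj (f (ξ - y))`. -/
noncomputable def schwartzReflectConj (ξ : ℝ) (f : 𝓢(ℝ, ℂ)) : 𝓢(ℝ, ℂ) :=
  postcompCLM (Complex.conjCLE : ℂ →L[ℝ] ℂ)
    (compSubConstCLM ℝ ξ (compCLMOfContinuousLinearEquiv ℝ (ContinuousLinearEquiv.neg ℝ) f))

theorem schwartzReflectConj_apply (ξ : ℝ) (f : 𝓢(ℝ, ℂ)) (y : ℝ) :
    schwartzReflectConj ξ f y = conj (f (ξ - y)) := by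
  simp [schwartzReflectConj]

theorem fourierInv_schwartzReflectConj (ξ : ℝ) (g : 𝓢(ℝ, ℂ)) (x : ℝ) :
    𝓕⁻ (schwartzReflectConj ξ (𝓕 g)) x = Real.fourierChar (x * ξ) • conj (g x) := by
  have hinv : g x = 𝓕⁻ (𝓕 g) x := by rw [fourierInv_fourier_eq]
  rw [hinv, fourierInv_coe, fourierInv_coe, Real.fourierInv_eq, Real.fourierInv_eq,
    Circle.smul_def, smul_eq_mul, ← integral_conj, ← integral_const_mul, ← integral_sub_left_eq_self _ volume ξ]
  refine integral_congr_ae (ae_of_all _ fun y => ?_)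
  simp only [schwartzReflectConj_apply, sub_sub_cancel, Circle.smul_def, smul_eq_mul, map_mul,
    ← Circle.coe_inv_eq_conj, ← AddChar.map_neg_eq_inv, ← mul_assoc, ← Circle.coe_mul,
    ← AddChar.map_add_eq_mul]
  congr 4
  simp
  ring

/-- On Schwartz functions the transforms are honest integrals, so the formula can be computed;
density extends its consequences to `L²`. -/
theorem reflectConj_fourier_toLp (ξ : ℝ) (g : 𝓢(ℝ, ℂ)) :
    (𝓕⁻ (reflectConj ξ (𝓕 (g.toLp 2))) : Lp ℂ 2 (volume : Measure ℝ)) =ᵐ[volume]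
      fun x => Real.fourierChar (x * ξ) • conj (g x) := by
  have h1 : reflectConj ξ (𝓕 (g.toLp 2)) = (schwartzReflectConj ξ (𝓕 g)).toLp 2 := by
    refine Lp.ext ?_
    rw [toLp_fourier_eq]
    filter_upwards [coeFn_reflectConj ξ ((𝓕 g).toLp 2),
      (schwartzReflectConj ξ (𝓕 g)).coeFn_toLp 2,
      (Measure.measurePreserving_sub_left volume ξ).quasiMeasurePreserving.ae
        ((𝓕 g).coeFn_toLp 2 volume)] with y h1 h2 h3
    rw [h1, h2, h3, schwartzReflectConj_apply]
  rw [h1, toLp_fourierInv_eq]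
  filter_upwards [(𝓕⁻ (schwartzReflectConj ξ (𝓕 g))).coeFn_toLp 2] with x hx
  rw [hx, fourierInv_schwartzReflectConj]

/-- The Fourier transform intertwines the conjugation with `reflectConj 0`. -/
theorem fourierInv_reflectConj_zero (g : Lp ℂ 2 (volume : Measure ℝ)) :
    𝓕⁻ (reflectConj 0 (𝓕 g)) = (Complex.conjCLE : ℂ →L[ℝ] ℂ).compLp g := by
  refine DenseRange.induction_on
    (p := fun g => 𝓕⁻ (reflectConj 0 (𝓕 g)) = (Complex.conjCLE : ℂ →L[ℝ] ℂ).compLp g)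
    (denseRange_toLpCLM (E := ℝ) (F := ℂ) (μ := volume) (p := 2) ENNReal.ofNat_ne_top) g ?_
    fun f => ?_
  · refine isClosed_eq ?_ ((Complex.conjCLE : ℂ →L[ℝ] ℂ).compLpL 2 volume).continuous
    exact (Lp.fourierTransformₗᵢ ℝ ℂ).symm.continuous.comp
      ((continuous_reflectConj 0).comp (Lp.fourierTransformₗᵢ ℝ ℂ).continuous)
  · refine Lp.ext ?_
    filter_upwards [reflectConj_fourier_toLp 0 f,
      (Complex.conjCLE : ℂ →L[ℝ] ℂ).coeFn_compLp (f.toLp 2), f.coeFn_toLp 2] with x h1 h2 h3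
    refine h1.trans (Eq.trans ?_ h2.symm)
    rw [h3]
    simp

/-- The Fourier transform of a product is the convolution of the Fourier transforms. -/
theorem fourier_mul_eq_convolution (f g : Lp ℂ 2 (volume : Measure ℝ)) (ξ : ℝ) :
    𝓕 (fun x => f x * g x) ξ =
      ∫ y, (𝓕 f : Lp ℂ 2 (volume : Measure ℝ)) y * (𝓕 g : Lp ℂ 2 (volume : Measure ℝ)) (ξ - y) := by
  have hmem : MemLp (fun x => conj (Real.fourierChar (-(x * ξ)) • f x)) 2 volume := by
    refine (Lp.memLp f).of_le (by
      have h1 : Continuous fun x : ℝ => Real.fourierChar (-(x * ξ)) := by fun_prop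
      exact Complex.continuous_conj.comp_aestronglyMeasurable
        (h1.aestronglyMeasurable.smul (Lp.aestronglyMeasurable f))) (ae_of_all _ fun x => ?_)
    simp
  -- For fixed `ξ` both sides are `L²` inner products: the left by definition of the Fourier
  -- integral, the right by Plancherel. Both are continuous in `g`, so Schwartz `g` suffice.
  have hleft : ∀ g : Lp ℂ 2 (volume : Measure ℝ),
      𝓕 (fun x => f x * g x) ξ = inner ℂ (hmem.toLp _) g := fun g => by
    rw [Real.fourier_eq, L2.inner_def]
    refine integral_congr_ae ?_
    filter_upwards [hmem.coeFn_toLp] with x hx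
    rw [hx, RCLike.inner_apply', conj_trivial, RCLike.inner_apply', Complex.conj_conj,
      smul_mul_assoc]
  have hright : ∀ g : Lp ℂ 2 (volume : Measure ℝ),
      ∫ y, (𝓕 f : Lp ℂ 2 (volume : Measure ℝ)) y * (𝓕 g : Lp ℂ 2 (volume : Measure ℝ)) (ξ - y)
        = inner ℂ (𝓕⁻ (reflectConj ξ (𝓕 g))) f := fun g => by
    rw [← Lp.inner_fourier_eq, FourierTransform.fourier_fourierInv_eq, L2.inner_def]
    refine integral_congr_ae ?_
    filter_upwards [coeFn_reflectConj ξ (𝓕 g)] with y hy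
    rw [hy, RCLike.inner_apply, Complex.conj_conj]
  rw [hleft, hright]
  refine DenseRange.induction_on
    (p := fun g => inner ℂ (hmem.toLp _) g = inner ℂ (𝓕⁻ (reflectConj ξ (𝓕 g))) f)
    (denseRange_toLpCLM (E := ℝ) (F := ℂ) (μ := volume) (p := 2) ENNReal.ofNat_ne_top) g ?_
    fun g => ?_
  · refine isClosed_eq (continuous_const.inner continuous_id) (Continuous.inner ?_ continuous_const)
    exact (Lp.fourierTransformₗᵢ ℝ ℂ).symm.continuous.comp
      ((continuous_reflectConj ξ).comp (Lp.fourierTransformₗᵢ ℝ ℂ).continuous)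
  · rw [L2.inner_def, L2.inner_def]
    refine integral_congr_ae ?_
    filter_upwards [hmem.coeFn_toLp, reflectConj_fourier_toLp ξ g, g.coeFn_toLp 2] with x h1 h2 h3
    change inner ℂ _ (g.toLp 2 volume x) = inner ℂ ((𝓕⁻ (reflectConj ξ (𝓕 (g.toLp 2 volume))) :
      Lp ℂ 2 (volume : Measure ℝ)) x) _
    rw [h1, h2, h3, RCLike.inner_apply', RCLike.inner_apply', Complex.conj_conj, Circle.smul_def,
      Circle.smul_def, smul_eq_mul, smul_eq_mul, map_mul, Complex.conj_conj,
      ← Circle.coe_inv_eq_conj, ← AddChar.map_neg_eq_inv]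
    ring

end Line

/-! ### Real functions on the line as Hermitian functions -/

section LineWellPosed

open ComplexConjugate

theorem reflectConj_zero_eq_iff (g : Lp ℂ 2 (volume : Measure ℝ)) :
    reflectConj 0 g = g ↔ g ∈ hermitianL2 (volume : Measure ℝ) := by
  rw [mem_hermitianL2_iff, Lp.ext_iff]
  constructor
  · intro h
    filter_upwards [h, coeFn_reflectConj 0 g] with x h1 h2
    rw [h2, zero_sub] at h1
    rw [← h1, Complex.conj_conj]
  · intro h
    filter_upwards [h, coeFn_reflectConj 0 g] with x h1 h2
    rw [h2, zero_sub, h1, Complex.conj_conj]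

/-- The Fourier transforms of real functions are the Hermitian functions. -/
theorem lineFourier_mem_hermitianL2 (u : Lp ℝ 2 (volume : Measure ℝ)) :
    lineFourier u ∈ hermitianL2 (volume : Measure ℝ) := by
  rw [← reflectConj_zero_eq_iff]
  have h1 : (Complex.conjCLE : ℂ →L[ℝ] ℂ).compLp (Complex.ofRealCLM.compLp u)
      = Complex.ofRealCLM.compLp u := by
    refine Lp.ext ?_
    filter_upwards [(Complex.conjCLE : ℂ →L[ℝ] ℂ).coeFn_compLp (Complex.ofRealCLM.compLp u),
      Complex.ofRealCLM.coeFn_compLp u] with x h1 h2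
    rw [h1, h2]
    simp
  have h2 := fourierInv_reflectConj_zero (Complex.ofRealCLM.compLp u)
  rw [h1] at h2
  have h3 := congrArg (fun v => (𝓕 v : Lp ℂ 2 (volume : Measure ℝ))) h2
  rw [FourierTransform.fourier_fourierInv_eq] at h3
  exact h3

/-- Hermitian symmetry of `g` makes its inverse transform invariant under conjugation, hence real.
-/
theorem exists_lineFourier_eq {g : Lp ℂ 2 (volume : Measure ℝ)}
    (hg : g ∈ hermitianL2 (volume : Measure ℝ)) : ∃ u, lineFourier u = g := by
  set v : Lp ℂ 2 (volume : Measure ℝ) := 𝓕⁻ g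
  have hv : 𝓕 v = g := FourierTransform.fourier_fourierInv_eq g
  have hconj : (Complex.conjCLE : ℂ →L[ℝ] ℂ).compLp v = v := by
    rw [← fourierInv_reflectConj_zero, hv, (reflectConj_zero_eq_iff g).2 hg]
  refine ⟨Complex.reCLM.compLp v, ?_⟩
  have hre : Complex.ofRealCLM.compLp (Complex.reCLM.compLp v) = v := by
    refine Lp.ext ?_
    filter_upwards [(Complex.conjCLE : ℂ →L[ℝ] ℂ).coeFn_compLp v,
      Complex.ofRealCLM.coeFn_compLp (Complex.reCLM.compLp v),
      Complex.reCLM.coeFn_compLp v] with x h1 h2 h3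
    rw [h2, h3]
    rw [hconj] at h1
    exact Complex.conj_eq_iff_re.1 h1.symm
  change 𝓕 (Complex.ofRealCLM.compLp (Complex.reCLM.compLp v)) = g
  rw [hre, hv]

/-- The angular frequency on the line. -/
noncomputable def lineFreq (ξ : ℝ) : ℝ := 2 * π * ξ

theorem coeFn_weighted_line {s : ℝ} (u : SobolevLine s) :
    SobolevLine.weighted s u =ᵐ[volume]
      fun ξ => sobolevWeight lineFreq s ξ * lineFourier u.toL2 ξ := by
  filter_upwards [u.memLp.coeFn_toLp] with ξ hξ
  refine hξ.trans ?_
  rw [lineWeighted, Complex.real_smul]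
  rfl

theorem weighted_line_mem {s : ℝ} (u : SobolevLine s) :
    SobolevLine.weighted s u ∈ hermitianL2 (volume : Measure ℝ) := by
  rw [mem_hermitianL2_iff]
  have h := coeFn_weighted_line u
  filter_upwards [h, (Measure.measurePreserving_neg volume).quasiMeasurePreserving.ae h,
    mem_hermitianL2_iff.1 (lineFourier_mem_hermitianL2 u.toL2)] with ξ h1 h2 h3
  rw [h1, h2, h3, map_mul, Complex.conj_ofReal, sobolevWeight, sobolevWeight, lineFreq, lineFreq,
    mul_neg, neg_sq]

/-- The weighted Fourier transform as an isometry of `H^s(ℝ)` onto the Hermitian functions. -/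
noncomputable def lineEquiv {s : ℝ} (hs : 0 ≤ s) :
    SobolevLine s ≃ₗᵢ[ℝ] hermitianL2 (volume : Measure ℝ) :=
  LinearIsometryEquiv.ofSurjective
    { toLinearMap := (SobolevLine.weighted s).codRestrict _ weighted_line_mem
      norm_map' := fun _ => rfl }
    (by
      intro f
      -- For surjectivity: since `s ≥ 0`, dividing by the weight preserves `L²`, so the quotient is
      -- the transform of a real `L²` function.
      have hmul : IsHermitianMultiplier
          (fun ξ : ℝ => (((sobolevWeight lineFreq s ξ)⁻¹ : ℝ) : ℂ)) 1 :=
        { measurable := by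
            unfold sobolevWeight lineFreq
            fun_prop
          neg_eq := fun ξ => by
            rw [Complex.conj_ofReal, sobolevWeight, sobolevWeight, lineFreq, lineFreq, mul_neg,
              neg_sq]
          bound := fun ξ => by
            rw [Complex.norm_real,
              Real.norm_of_nonneg (inv_nonneg.2 (sobolevWeight_pos lineFreq s ξ).le)]
            exact inv_le_one_of_one_le₀ (one_le_sobolevWeight lineFreq hs ξ) }
      obtain ⟨u, hu⟩ := exists_lineFourier_eq (hmul.toCLM volume f).2
      have hw : lineWeighted s u =ᵐ[volume] (f : Lp ℂ 2 (volume : Measure ℝ)) := by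
        filter_upwards [hmul.coeFn_toCLM f] with ξ hξ
        rw [lineWeighted, hu, hξ, Complex.real_smul, ← mul_assoc, ← Complex.ofReal_mul]
        change ((sobolevWeight lineFreq s ξ * _ : ℝ) : ℂ) * _ = _
        rw [mul_inv_cancel₀ (sobolevWeight_pos lineFreq s ξ).ne', Complex.ofReal_one, one_mul]
      have hmem : u ∈ lineSobolev s := (memLp_congr_ae hw).2 (Lp.memLp _)
      refine ⟨(⟨u, hmem⟩ : lineSobolev s), Subtype.ext (Lp.ext ?_)⟩
      exact (MemLp.coeFn_toLp (SobolevLine.memLp (⟨u, hmem⟩ : lineSobolev s))).trans hw)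

theorem coeFn_lineEquiv {s : ℝ} (hs : 0 ≤ s) (u : SobolevLine s) :
    (lineEquiv hs u : Lp ℂ 2 (volume : Measure ℝ)) =ᵐ[volume]
      fun ξ => sobolevWeight lineFreq s ξ * lineFourier u.toL2 ξ :=
  coeFn_weighted_line u

theorem fourier_sq_eq_convolution (u : Lp ℝ 2 (volume : Measure ℝ)) (ξ : ℝ) :
    𝓕 (fun x : ℝ => ((u x ^ 2 : ℝ) : ℂ)) ξ = ∫ y, lineFourier u y * lineFourier u (ξ - y) := by
  refine Eq.trans ?_ (fourier_mul_eq_convolution (Complex.ofRealCLM.compLp u)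
    (Complex.ofRealCLM.compLp u) ξ)
  rw [Real.fourier_eq, Real.fourier_eq]
  refine integral_congr_ae ?_
  filter_upwards [Complex.ofRealCLM.coeFn_compLp u] with x hx
  rw [hx]
  simp [pow_two]

/-- Global well-posedness on the line for a general symbol. -/
theorem exists_isGloballyWellPosed_line {m : ℝ → ℝ} {c : ℝ}
    (h : IsDispersive (volume : Measure ℝ) lineFreq (fun ξ => m (2 * π * ξ)) c) (α : ℝ) {s : ℝ}
    (hs : 0 ≤ s) :
    ∃ F : SobolevLine s → SobolevLine s,
      (∀ u, IsLineVectorField (fun k => k / m k) α u (F u)) ∧ IsGloballyWellPosed F := by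
  obtain ⟨Φ, hΦ, hspec⟩ := h.exists_isGloballyWellPosed (3 / 4 * α) hs
  refine ⟨fun u => (lineEquiv hs).symm (Φ (lineEquiv hs u)), fun u => ?_,
    hΦ.of_linearIsometryEquiv _⟩
  have hu := coeFn_lineEquiv hs u
  have hF := coeFn_lineEquiv hs ((lineEquiv hs).symm (Φ (lineEquiv hs u)))
  rw [LinearIsometryEquiv.apply_symm_apply] at hF
  have hcancel : ∀ᵐ y : ℝ, (((sobolevWeight lineFreq s y)⁻¹ : ℝ) : ℂ) *
      (lineEquiv hs u : Lp ℂ 2 (volume : Measure ℝ)) y = lineFourier u.toL2 y := by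
    filter_upwards [hu] with y hy
    rw [hy, ← mul_assoc, ← Complex.ofReal_mul, inv_mul_cancel₀ (sobolevWeight_pos lineFreq s y).ne',
      Complex.ofReal_one, one_mul]
  filter_upwards [hu, hF, hspec (lineEquiv hs u)] with ξ h1 h2 h3
  rw [h2, h1] at h3
  have hint : ∫ y, ((((sobolevWeight lineFreq s y)⁻¹ : ℝ) : ℂ) *
      (lineEquiv hs u : Lp ℂ 2 (volume : Measure ℝ)) y) *
      ((((sobolevWeight lineFreq s (ξ - y))⁻¹ : ℝ) : ℂ) *
      (lineEquiv hs u : Lp ℂ 2 (volume : Measure ℝ)) (ξ - y)) =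
      𝓕 (fun x : ℝ => ((u.toL2 x ^ 2 : ℝ) : ℂ)) ξ := by
    rw [fourier_sq_eq_convolution]
    refine integral_congr_ae ?_
    filter_upwards [hcancel, (Measure.measurePreserving_sub_left volume
      ξ).quasiMeasurePreserving.ae hcancel] with y h4 h5
    rw [h4, h5]
  rw [hint] at h3
  have hw : (sobolevWeight lineFreq s ξ : ℂ) ≠ 0 := by
    exact_mod_cast (sobolevWeight_pos lineFreq s ξ).ne'
  refine mul_left_cancel₀ hw (h3.trans ?_)
  rw [show lineFreq ξ = 2 * π * ξ from rfl]
  push_cast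
  ring

end LineWellPosed

/-! ### Real functions on the circle as Hermitian sequences -/

section CircleWellPosed

open ComplexConjugate

theorem ae_count_int_iff {p : ℤ → Prop} : (∀ᵐ k ∂(Measure.count : Measure ℤ), p k) ↔ ∀ k, p k := by
  simp [ae_iff, Measure.count_eq_zero_iff, Set.eq_empty_iff_forall_notMem]

theorem memLp_count_int_iff {f : ℤ → ℂ} : MemLp f 2 (Measure.count : Measure ℤ) ↔ Memℓp f 2 := by
  rw [memLp_two_iff_integrable_sq_norm (measurable_of_countable f).aestronglyMeasurable,
    integrable_count_iff, memℓp_gen_iff (by norm_num)]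
  simp

/-- Square summable sequences as square integrable functions for the counting measure. -/
noncomputable def lpToCount : lp (fun _ : ℤ => ℂ) 2 →ₗᵢ[ℝ] Lp ℂ 2 (Measure.count : Measure ℤ) where
  toFun f := (memLp_count_int_iff.2 (lp.memℓp f)).toLp f
  map_add' f g := MemLp.toLp_add _ _
  map_smul' c f := MemLp.toLp_const_smul c _
  norm_map' f := by
    have hf := memLp_count_int_iff.2 (lp.memℓp f)
    change ‖hf.toLp f‖ = ‖f‖
    have h1 : ‖hf.toLp f‖ₑ ^ 2 = ‖f‖ₑ ^ 2 := by
      have h3 := lp.hasSum_norm (p := 2) (by norm_num) f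
      simp only [ENNReal.toReal_ofNat, Real.rpow_ofNat] at h3
      rw [Lp.enorm_toLp, enorm_toLp_sq, lintegral_count, ← ofReal_norm f,
        ← ENNReal.ofReal_pow (norm_nonneg _), ← h3.tsum_eq,
        ENNReal.ofReal_tsum_of_nonneg (fun _ => by positivity) h3.summable]
      refine tsum_congr fun k => ?_
      rw [ENNReal.ofReal_pow (norm_nonneg _), ofReal_norm]
    have h2 := congrArg ENNReal.toReal h1
    rw [ENNReal.toReal_pow, ENNReal.toReal_pow, toReal_enorm, toReal_enorm] at h2
    exact (pow_left_inj₀ (norm_nonneg _) (norm_nonneg _) two_ne_zero).1 h2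

theorem coeFn_lpToCount (f : lp (fun _ : ℤ => ℂ) 2) (k : ℤ) : lpToCount f k = f k :=
  ae_count_int_iff.1 (memLp_count_int_iff.2 (lp.memℓp f)).coeFn_toLp k

theorem fourierCoeff_conj (f : AddCircle (2 * π) → ℂ) (k : ℤ) :
    fourierCoeff (fun x => conj (f x)) k = conj (fourierCoeff f (-k)) := by
  rw [fourierCoeff, fourierCoeff, ← integral_conj]
  refine integral_congr_ae (ae_of_all _ fun x => ?_)
  simp only [smul_eq_mul, map_mul, neg_neg, fourier_neg]

theorem fourierCoeff_fourier_mul (f : AddCircle (2 * π) → ℂ) (n k : ℤ) :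
    fourierCoeff (fun x => fourier n x * f x) k = fourierCoeff f (k - n) := by
  rw [fourierCoeff, fourierCoeff]
  refine integral_congr_ae (ae_of_all _ fun x => ?_)
  simp only [smul_eq_mul, ← mul_assoc, ← fourier_add]
  rw [neg_sub, sub_eq_neg_add]

theorem circleFourier_neg (u : CircleL2) (k : ℤ) :
    circleFourier u (-k) = conj (circleFourier u k) := by
  have h := fourierCoeff_conj (fun x => (u x : ℂ)) (-k)
  simp only [Complex.conj_ofReal, neg_neg] at h
  exact h

theorem fourierBasis_repr_ofReal (u : CircleL2) (k : ℤ) :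
    fourierBasis.repr (Complex.ofRealCLM.compLp u) k = circleFourier u k := by
  rw [fourierBasis_repr]
  exact congrFun (fourierCoeff_congr_ae (Complex.ofRealCLM.coeFn_compLp u)) k

/-- Riesz–Fischer produces a complex function; the symmetry of its coefficients makes it real. -/
theorem exists_circleFourier_eq {g : ℤ → ℂ} (hg : Memℓp g 2) (hneg : ∀ k, g (-k) = conj (g k)) :
    ∃ u : CircleL2, circleFourier u = g := by
  set v : Lp ℂ 2 (AddCircle.haarAddCircle : Measure (AddCircle (2 * π))) :=
    fourierBasis.repr.symm ⟨g, hg⟩ with hv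
  have hrepr (k : ℤ) : fourierCoeff v k = g k := by
    rw [← fourierBasis_repr, hv, LinearIsometryEquiv.apply_symm_apply]
  have hconj : (Complex.conjCLE : ℂ →L[ℝ] ℂ).compLp v = v := by
    apply fourierBasis.repr.injective
    ext k
    rw [fourierBasis_repr, fourierBasis_repr, hrepr,
      fourierCoeff_congr_ae ((Complex.conjCLE : ℂ →L[ℝ] ℂ).coeFn_compLp v)]
    refine (fourierCoeff_conj v k).trans ?_
    rw [hrepr, hneg, Complex.conj_conj]
  refine ⟨Complex.reCLM.compLp v, ?_⟩
  have hre : Complex.ofRealCLM.compLp (Complex.reCLM.compLp v) = v := by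
    refine Lp.ext ?_
    filter_upwards [(Complex.conjCLE : ℂ →L[ℝ] ℂ).coeFn_compLp v,
      Complex.ofRealCLM.coeFn_compLp (Complex.reCLM.compLp v),
      Complex.reCLM.coeFn_compLp v] with x h1 h2 h3
    rw [h2, h3]
    rw [hconj] at h1
    exact Complex.conj_eq_iff_re.1 h1.symm
  ext k
  rw [← fourierBasis_repr_ofReal, hre, fourierBasis_repr, hrepr]

/-- The Fourier coefficients of a square are the convolution of the Fourier coefficients. -/
theorem fourierCoeff_sq_eq_convolution (u : CircleL2) (k : ℤ) :
    fourierCoeff (fun x : AddCircle (2 * π) => ((u x ^ 2 : ℝ) : ℂ)) k =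
      ∫ j, circleFourier u j * circleFourier u (k - j) ∂(Measure.count : Measure ℤ) := by
  set U : Lp ℂ 2 (AddCircle.haarAddCircle : Measure (AddCircle (2 * π))) :=
    Complex.ofRealCLM.compLp u
  have hU : U =ᵐ[AddCircle.haarAddCircle] fun x => (u x : ℂ) := Complex.ofRealCLM.coeFn_compLp u
  have hV : MemLp (fun x => fourier k x * U x) 2
      (AddCircle.haarAddCircle : Measure (AddCircle (2 * π))) :=
    (Lp.memLp U).of_le_mul (c := 1)
      ((fourier k).continuous.aestronglyMeasurable.mul (Lp.aestronglyMeasurable U))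
      (ae_of_all _ fun x => by rw [norm_mul, fourier_apply, Circle.norm_coe])
  -- Parseval for the pair `e_k U`, `U`: the first coefficient is the conjugate of `û(j - k)`, which
  -- is `û(k - j)` because `u` is real.
  have hcoeff (j : ℤ) : inner ℂ (hV.toLp _) (fourierBasis j) * inner ℂ (fourierBasis j) U =
      circleFourier u j * circleFourier u (k - j) := by
    rw [← inner_conj_symm, ← HilbertBasis.repr_apply_apply, ← HilbertBasis.repr_apply_apply,
      fourierBasis_repr_ofReal, fourierBasis_repr, fourierCoeff_congr_ae hV.coeFn_toLp,
      fourierCoeff_fourier_mul, mul_comm, ← fourierBasis_repr, fourierBasis_repr_ofReal,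
      ← circleFourier_neg, neg_sub]
  have hsum := fourierBasis.hasSum_inner_mul_inner (hV.toLp _) U
  simp only [hcoeff] at hsum
  have hint : Integrable (fun j => circleFourier u j * circleFourier u (k - j))
      (Measure.count : Measure ℤ) := integrable_count_iff.2 hsum.summable.norm
  rw [integral_countable hint]
  simp only [measureReal_def, Measure.count_singleton, ENNReal.toReal_one, one_smul]
  rw [hsum.tsum_eq, L2.inner_def]
  refine integral_congr_ae ?_
  filter_upwards [hV.coeFn_toLp, hU] with x h1 h2
  rw [h1, h2, RCLike.inner_apply, map_mul, Complex.conj_ofReal, fourier_neg, smul_eq_mul]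
  push_cast
  ring

/-- The frequency on the circle of length `2π`. -/
noncomputable def circleFreq (k : ℤ) : ℝ := k

theorem coeFn_weighted_circle {s : ℝ} (u : SobolevCircle s) (k : ℤ) :
    lpToCount (SobolevCircle.weighted s u) k =
      sobolevWeight circleFreq s k * circleFourier u.toL2 k := by
  rw [coeFn_lpToCount]
  change circleWeighted s u.toL2 k = _
  rw [circleWeighted, Complex.real_smul]
  rfl

theorem weighted_circle_mem {s : ℝ} (u : SobolevCircle s) :
    lpToCount (SobolevCircle.weighted s u) ∈ hermitianL2 (Measure.count : Measure ℤ) := by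
  rw [mem_hermitianL2_iff]
  refine ae_of_all _ fun k => ?_
  rw [coeFn_weighted_circle, coeFn_weighted_circle, circleFourier_neg, map_mul,
    Complex.conj_ofReal, sobolevWeight, sobolevWeight, circleFreq, circleFreq, Int.cast_neg, neg_sq]

/-- The weighted Fourier coefficients as an isometry of `H^s_per` onto the Hermitian functions. -/
noncomputable def circleEquiv {s : ℝ} (hs : 0 ≤ s) :
    SobolevCircle s ≃ₗᵢ[ℝ] hermitianL2 (Measure.count : Measure ℤ) :=
  LinearIsometryEquiv.ofSurjective
    { toLinearMap := (lpToCount.toLinearMap ∘ₗ SobolevCircle.weighted s).codRestrict _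
        weighted_circle_mem
      norm_map' := fun u => lpToCount.norm_map (SobolevCircle.weighted s u) }
    (by
      intro f
      have hf : ∀ k, (f : Lp ℂ 2 (Measure.count : Measure ℤ)) (-k) =
          conj ((f : Lp ℂ 2 (Measure.count : Measure ℤ)) k) :=
        ae_count_int_iff.1 (ae_neg_eq_conj f)
      have hmem : Memℓp (f : Lp ℂ 2 (Measure.count : Measure ℤ)) 2 :=
        memLp_count_int_iff.1 (Lp.memLp _)
      obtain ⟨u, hu⟩ := exists_circleFourier_eq
        (g := fun k => (((sobolevWeight circleFreq s k)⁻¹ : ℝ) : ℂ) *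
          (f : Lp ℂ 2 (Measure.count : Measure ℤ)) k)
        (memLp_count_int_iff.1 ((Lp.memLp (f : Lp ℂ 2 (Measure.count : Measure ℤ))).of_le
          (measurable_of_countable _).aestronglyMeasurable (ae_of_all _ fun k => by
            rw [norm_mul, Complex.norm_real,
              Real.norm_of_nonneg (inv_nonneg.2 (sobolevWeight_pos circleFreq s k).le)]
            exact mul_le_of_le_one_left (norm_nonneg _)
              (inv_le_one_of_one_le₀ (one_le_sobolevWeight circleFreq hs k)))))
        (fun k => by
          rw [hf, map_mul, Complex.conj_ofReal, sobolevWeight, sobolevWeight, circleFreq,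
            circleFreq, Int.cast_neg, neg_sq])
      have hw : circleWeighted s u = (f : Lp ℂ 2 (Measure.count : Measure ℤ)) := by
        ext k
        rw [circleWeighted, hu, Complex.real_smul, ← mul_assoc, ← Complex.ofReal_mul]
        change ((sobolevWeight circleFreq s k * _ : ℝ) : ℂ) * _ = _
        rw [mul_inv_cancel₀ (sobolevWeight_pos circleFreq s k).ne', Complex.ofReal_one, one_mul]
      have hmem' : u ∈ circleSobolev s := by
        change Memℓp (circleWeighted s u) 2
        rwa [hw]
      refine ⟨(⟨u, hmem'⟩ : circleSobolev s), Subtype.ext (Lp.ext (ae_of_all _ fun k => ?_))⟩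
      exact (coeFn_lpToCount _ k).trans (congrFun hw k))

theorem coeFn_circleEquiv {s : ℝ} (hs : 0 ≤ s) (u : SobolevCircle s) (k : ℤ) :
    (circleEquiv hs u : Lp ℂ 2 (Measure.count : Measure ℤ)) k =
      sobolevWeight circleFreq s k * circleFourier u.toL2 k :=
  coeFn_weighted_circle u k

/-- Global well-posedness on the circle for a general symbol. -/
theorem exists_isGloballyWellPosed_circle {m : ℝ → ℝ} {c : ℝ}
    (h : IsDispersive (Measure.count : Measure ℤ) circleFreq (fun k => m k) c) (α : ℝ) {s : ℝ}
    (hs : 0 ≤ s) :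
    ∃ F : SobolevCircle s → SobolevCircle s,
      (∀ u, IsCircleVectorField (fun k => k / m k) α u (F u)) ∧ IsGloballyWellPosed F := by
  obtain ⟨Φ, hΦ, hspec⟩ := h.exists_isGloballyWellPosed (3 / 4 * α) hs
  refine ⟨fun u => (circleEquiv hs).symm (Φ (circleEquiv hs u)), fun u k => ?_,
    hΦ.of_linearIsometryEquiv _⟩
  have hF := coeFn_circleEquiv hs ((circleEquiv hs).symm (Φ (circleEquiv hs u))) k
  rw [LinearIsometryEquiv.apply_symm_apply] at hF
  have hcancel (j : ℤ) : (((sobolevWeight circleFreq s j)⁻¹ : ℝ) : ℂ) *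
      (circleEquiv hs u : Lp ℂ 2 (Measure.count : Measure ℤ)) j = circleFourier u.toL2 j := by
    rw [coeFn_circleEquiv, ← mul_assoc, ← Complex.ofReal_mul,
      inv_mul_cancel₀ (sobolevWeight_pos circleFreq s j).ne', Complex.ofReal_one, one_mul]
  have h3 := ae_count_int_iff.1 (hspec (circleEquiv hs u)) k
  rw [hF] at h3
  simp only [hcancel] at h3
  rw [← fourierCoeff_sq_eq_convolution, coeFn_circleEquiv] at h3
  have hw : (sobolevWeight circleFreq s k : ℂ) ≠ 0 := by
    exact_mod_cast (sobolevWeight_pos circleFreq s k).ne'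
  refine mul_left_cancel₀ hw (h3.trans ?_)
  rw [show circleFreq k = (k : ℝ) from rfl]
  push_cast
  ring

end CircleWellPosed

/-! ### The two concrete symbols are dispersive -/

section DispersionSymbol

theorem mulCoth_nonneg {h : ℝ} (hh : 0 < h) (k : ℝ) : 0 ≤ mulCoth h k := by
  unfold mulCoth
  split_ifs with hk
  · positivity
  · rcases lt_or_gt_of_ne hk with hk | hk
    · have h1 : Real.sinh (h * k) < 0 := Real.sinh_neg_iff.2 (mul_neg_of_pos_of_neg hh hk)
      exact mul_nonneg_of_nonpos_of_nonpos hk.le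
        (div_nonpos_of_nonneg_of_nonpos (Real.cosh_pos _).le h1.le)
    · have h1 : 0 < Real.sinh (h * k) := Real.sinh_pos_iff.2 (mul_pos hh hk)
      have h2 := Real.cosh_pos (h * k)
      positivity

theorem mulCoth_neg (h k : ℝ) : mulCoth h (-k) = mulCoth h k := by
  simp only [mulCoth, neg_eq_zero, mul_neg, Real.cosh_neg, Real.sinh_neg, div_neg, neg_mul, neg_neg]

theorem measurable_mulCoth (h : ℝ) : Measurable (mulCoth h) := by
  refine Measurable.ite (measurableSet_singleton 0) measurable_const ?_
  have h1 : Measurable fun k : ℝ => Real.cosh (h * k) := by fun_prop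
  have h2 : Measurable fun k : ℝ => Real.sinh (h * k) := by fun_prop
  exact measurable_id.mul (h1.div h2)

variable (L : DispersionOperator) {a b h : ℝ}

theorem measurable_dispersionSymbol : Measurable (dispersionSymbol L a b h) := by
  cases L with
  | hilbert => unfold dispersionSymbol; fun_prop
  | finiteDepth =>
    exact ((measurable_const.add ((measurable_mulCoth h).const_mul b))).add (by fun_prop)

theorem dispersionSymbol_neg (k : ℝ) :
    dispersionSymbol L a b h (-k) = dispersionSymbol L a b h k := by
  cases L <;> simp only [dispersionSymbol, abs_neg, neg_sq, mulCoth_neg]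

/-- The nonlocal term is nonnegative for both operators, so `1 + a k²` alone provides the lower
bound. -/
theorem min_mul_le_dispersionSymbol (hb : 0 ≤ b) (hh : 0 < h) (k : ℝ) :
    min 1 a * (1 + k ^ 2) ≤ dispersionSymbol L a b h k := by
  have h1 : min 1 a * (1 + k ^ 2) ≤ 1 + a * k ^ 2 := by
    rw [mul_add, mul_one]
    gcongr
    · exact min_le_left _ _
    · exact min_le_right _ _
  cases L with
  | hilbert =>
    have h2 := mul_nonneg hb (abs_nonneg k)
    simp only [dispersionSymbol]
    linarith
  | finiteDepth =>
    have h2 := mul_nonneg hb (mulCoth_nonneg hh k)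
    simp only [dispersionSymbol]
    linarith

theorem isDispersive_line (ha : 0 < a) (hb : 0 ≤ b) (hh : 0 < h) :
    IsDispersive (volume : Measure ℝ) lineFreq (fun ξ => dispersionSymbol L a b h (2 * π * ξ))
      (min 1 a) where
  measurable_freq := by unfold lineFreq; fun_prop
  freq_add x y := by unfold lineFreq; ring
  measurable_symbol := (measurable_dispersionSymbol L).comp (by fun_prop)
  symbol_neg x := by rw [mul_neg, dispersionSymbol_neg]
  pos := lt_min one_pos ha
  le_symbol x := min_mul_le_dispersionSymbol L hb hh _
  integrable := integrable_inv_one_add_sq.comp_mul_left' Real.two_pi_pos.ne'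

theorem isDispersive_circle (ha : 0 < a) (hb : 0 ≤ b) (hh : 0 < h) :
    IsDispersive (Measure.count : Measure ℤ) circleFreq (fun k => dispersionSymbol L a b h k)
      (min 1 a) where
  measurable_freq := measurable_of_countable _
  freq_add x y := Int.cast_add x y
  measurable_symbol := measurable_of_countable _
  symbol_neg x := by rw [Int.cast_neg, dispersionSymbol_neg]
  pos := lt_min one_pos ha
  le_symbol x := min_mul_le_dispersionSymbol L hb hh _
  integrable := by
    refine integrable_count_iff.2 (Summable.norm ?_)
    -- The comparison with `1 / k²` fails at `k = 0`, so it is made off a finite set.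
    refine Summable.of_norm_bounded_eventually (Real.summable_one_div_int_pow.2 one_lt_two) ?_
    filter_upwards [(Set.finite_singleton (0 : ℤ)).compl_mem_cofinite] with k hk
    have hk' : (k : ℝ) ≠ 0 := Int.cast_ne_zero.2 hk
    have hpos : 0 < (k : ℝ) ^ 2 := by positivity
    unfold circleFreq
    rw [Real.norm_of_nonneg (by positivity), one_div]
    exact inv_anti₀ hpos (by linarith)

end DispersionSymbol

theorem mainTheorem1 (L : DispersionOperator) (α a b h s : ℝ)
    (hα : 0 < α) (ha : 0 < a) (hb : 0 < b) (hh : 0 < h) (hs : 0 ≤ s) :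
    (∃ F : SobolevLine s → SobolevLine s,
      (∀ u, IsLineVectorField (phaseSymbol L a b h) α u (F u)) ∧
      IsGloballyWellPosed F ∧
      ∀ η₀ : SobolevLine s, ∃! η : C(ℝ, SobolevLine s), IsGlobalSolution F η₀ η) ∧
    (∃ F : SobolevCircle s → SobolevCircle s,
      (∀ u, IsCircleVectorField (phaseSymbol L a b h) α u (F u)) ∧
      IsGloballyWellPosed F ∧
      ∀ η₀ : SobolevCircle s, ∃! η : C(ℝ, SobolevCircle s), IsGlobalSolution F η₀ η) := by
  -- `phaseSymbol` is by definition `k / m(k)`, so the results for a general symbol apply as they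
  -- stand.
  obtain ⟨F, hF, hwp⟩ :=
    exists_isGloballyWellPosed_line (isDispersive_line L ha hb.le hh) α hs
  obtain ⟨F', hF', hwp'⟩ :=
    exists_isGloballyWellPosed_circle (isDispersive_circle L ha hb.le hh) α hs
  exact ⟨⟨F, hF, hwp, hwp.existsUnique_isGlobalSolution⟩,
    ⟨F', hF', hwp', hwp'.existsUnique_isGlobalSolution⟩⟩
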